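/- **Conventions.** A closed flat $n$-manifold is a quotient $M=\mathbb R^n/\Gamma$, where $\Gamma$ is a crystallographic space group (a group of isometries of $\mathbb R^n$ whose translations form a lattice of full rank) in which only the identity has a fixed point; for $n=3$ it is called a *platycosm*. Two such manifolds are *isospectral* ($M\sim M'$) if their Laplacians have the same eigenvalues with the same multiplicities. A *closed geodesic of length $\ell>0$* on $M$ is the projection of a straight line traversed at unit speed that is periodic with period $\ell$ (not necessarily the least period); closed geodesics are counted without parametrization and orientation. The *norm* of a vector $v$ is $\langle v,v\rangle$. For $A,B,C,D>0$: * the *didicosm* $c22^{A\,B\,C}$ is $\mathbb R^3/\Gamma$, where, with $a=\sqrt A$, $b=\sqrt B$, $c=\sqrt C$, $\Gamma$ is generated by the three period 2 screw motions $(x,y,z)\mapsto(x+a,\,b-y,\,-z)$, $(x,y,z)\mapsto(-x,\,y+b,\,c-z)$, $(x,y,z)\mapsto(a-x,\,-y,\,z+c)$, whose screw vectors are perpendicular and have norms $A,B,C$; * the *tetracosm* $c4^{D}_{A\,A}$ is $\mathbb R^3/\Gamma$, where $\Gamma$ is generated by the translations by $(\sqrt A,0,0)$ and $(0,\sqrt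 A,0)$ and the period 4 screw motion $(x,y,z)\mapsto(-y,\,x,\,z+\sqrt D)$. **Theorem.** 1. 'Didi', the didicosm $c22^{1^2\,1^2\,2^2}$, and 'Tetra', the tetracosm $c4^{1^2}_{2^2\,2^2}$, are platycosms, and they are isospectral. 2. For every $D>0$, $c22^{D\,4D\,D}$ and $c4^{D}_{4D\,4D}$ are platycosms, and $c22^{D\,4D\,D}\sim c4^{D}_{4D\,4D}$. 3. One can hear the set of lengths of closed geodesics: for every $n$, isospectral closed flat $n$-manifolds have the same set of lengths of closed geodesics. 4. One cannot hear the multiplicities of these lengths: in each of the isospectral platycosms Didi and Tetra the smallest length of a closed geodesic is $1$, but Didi has exactly four closed geodesics of length $1$ and Tetra exactly two. -/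

import Mathlib

open scoped ContDiff Laplacian

noncomputable section

/-! Flat manifolds as quotients of Euclidean space, their Laplace spectra and closed geodesics,
and the didicosms and tetracosms. -/

namespace FlatManifold

/-- Euclidean `n`-space. -/
abbrev E (n : ℕ) : Type := EuclideanSpace ℝ (Fin n)

/-- The group of isometries of Euclidean `n`-space. -/
abbrev Isom (n : ℕ) : Type := E n ≃ᵃⁱ[ℝ] E n

/-- The translation `x ↦ v + x`. -/
def translation {n : ℕ} (v : E n) : Isom n := AffineIsometryEquiv.constVAdd ℝ (E n) v

@[simp] lemma translation_apply {n : ℕ} (v x : E n) : translation v x = v + x := rfl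

/-- The translation lattice of a group `Γ` of isometries: all `v` such that the translation
by `v` belongs to `Γ`. -/
def translationLattice {n : ℕ} (Γ : Subgroup (Isom n)) : Submodule ℤ (E n) :=
  AddSubgroup.toIntSubmodule
    { carrier := {v | translation v ∈ Γ}
      zero_mem' := by
        have h : translation (0 : E n) = 1 := by ext x; simp
        simp [h, Γ.one_mem]
      add_mem' := by
        intro a b ha hb
        have h : translation (a + b) = translation a * translation b := by
          ext x; simp [add_assoc]
        simpa [h] using Γ.mul_mem ha hb
      neg_mem' := by
        intro a ha
        have h : translation (-a) = (translation a)⁻¹ := by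
          rw [eq_inv_iff_mul_eq_one]; ext x; simp
        simpa [h] using Γ.inv_mem ha }

/-- `Γ` is a crystallographic space group (its translations form a lattice of full rank) in which
only the identity has a fixed point. The quotients of Euclidean `n`-space by such groups are
the closed flat `n`-manifolds; for `n = 3` they are the platycosms. -/
structure IsFlatManifoldGroup {n : ℕ} (Γ : Subgroup (Isom n)) : Prop where
  discrete : DiscreteTopology (translationLattice Γ)
  span_eq_top : Submodule.span ℝ (translationLattice Γ : Set (E n)) = ⊤
  free : ∀ g ∈ Γ, ∀ x : E n, g x = x → g = 1

/-- Two points are equivalent when an element of `Γ` takes one to the other. -/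
def orbitSetoid {n : ℕ} (Γ : Subgroup (Isom n)) : Setoid (E n) where
  r x y := ∃ g ∈ Γ, g x = y
  iseqv :=
    { refl := fun _ => ⟨1, Γ.one_mem, rfl⟩
      symm := by
        rintro x y ⟨g, hg, rfl⟩
        exact ⟨g⁻¹, Γ.inv_mem hg, g.symm_apply_apply x⟩
      trans := by
        rintro x y z ⟨g, hg, rfl⟩ ⟨h, hh, rfl⟩
        exact ⟨h * g, Γ.mul_mem hh hg, rfl⟩ }

/-- The quotient space `ℝⁿ / Γ`. -/
def FlatQuot {n : ℕ} (Γ : Subgroup (Isom n)) : Type := Quotient (orbitSetoid Γ)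

/-- The covering map `ℝⁿ → ℝⁿ / Γ`. -/
def proj {n : ℕ} (Γ : Subgroup (Isom n)) (x : E n) : FlatQuot Γ := Quotient.mk (orbitSetoid Γ) x

/-- The space of eigenfunctions of the Laplacian on `ℝⁿ / Γ` for the eigenvalue `μ`, that is,
of the smooth functions `f` with `-Δ f = μ f`. As the covering map is a local
isometry, smoothness and the Laplacian of `f` are computed on its lift to `ℝⁿ`. -/
def laplaceEigenspace {n : ℕ} (Γ : Subgroup (Isom n)) (μ : ℝ) : Submodule ℂ (FlatQuot Γ → ℂ) where
  carrier := {f | ContDiff ℝ ∞ (f ∘ proj Γ) ∧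
    ∀ x, -(Δ (f ∘ proj Γ)) x = (μ : ℂ) * f (proj Γ x)}
  zero_mem' := by
    have h : ((0 : FlatQuot Γ → ℂ) ∘ proj Γ) = fun _ => (0 : ℂ) := rfl
    refine ⟨by rw [h]; exact contDiff_const, fun x => ?_⟩
    rw [h, InnerProductSpace.laplacian_const]
    simp
  add_mem' := by
    rintro f g ⟨hf, hf'⟩ ⟨hg, hg'⟩
    have h : ((f + g) ∘ proj Γ) = (f ∘ proj Γ) + (g ∘ proj Γ) := rfl
    refine ⟨by rw [h]; exact hf.add hg, fun x => ?_⟩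
    have h2 : (2 : WithTop ℕ∞) ≤ ∞ := WithTop.coe_le_coe.2 le_top
    rw [h, (hf.contDiffAt.of_le h2).laplacian_add (hg.contDiffAt.of_le h2)]
    rw [neg_add, hf' x, hg' x, Pi.add_apply, mul_add]
  smul_mem' := by
    rintro c f ⟨hf, hf'⟩
    have h : ((c • f) ∘ proj Γ) = c • (f ∘ proj Γ) := rfl
    refine ⟨by rw [h]; exact contDiff_const.smul hf, fun x => ?_⟩
    have h2 : (2 : WithTop ℕ∞) ≤ ∞ := WithTop.coe_le_coe.2 le_top
    rw [h, InnerProductSpace.laplacian_smul c (hf.contDiffAt.of_le h2), ← smul_neg, hf' x,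
      Pi.smul_apply, smul_eq_mul, smul_eq_mul]
    ring

/-- `ℝⁿ / Γ` and `ℝⁿ / Γ'` have the same Laplace spectrum, with multiplicities. -/
def Isospectral {n : ℕ} (Γ Γ' : Subgroup (Isom n)) : Prop :=
  ∀ μ : ℝ, Module.rank ℂ (laplaceEigenspace Γ μ) = Module.rank ℂ (laplaceEigenspace Γ' μ)

/-- `c` is a closed geodesic of length `ℓ` on `ℝⁿ / Γ`, parametrized by arc length: the projection
of a straight line traversed with unit speed that is periodic with period `ℓ > 0`.
(The period need not be minimal: iterates of closed geodesics are closed geodesics.) -/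
def IsClosedGeodesic {n : ℕ} (Γ : Subgroup (Isom n)) (ℓ : ℝ) (c : ℝ → FlatQuot Γ) : Prop :=
  0 < ℓ ∧ (∃ p v : E n, ‖v‖ = 1 ∧ ∀ t, c t = proj Γ (p + t • v)) ∧ Function.Periodic c ℓ

/-- The closed geodesics of length `ℓ` on `ℝⁿ / Γ`, without parametrization and orientation:
these correspond to the point sets that they trace out. -/
def closedGeodesics {n : ℕ} (Γ : Subgroup (Isom n)) (ℓ : ℝ) : Set (Set (FlatQuot Γ)) :=
  {C | ∃ c, IsClosedGeodesic Γ ℓ c ∧ C = Set.range c}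

/-- The set of lengths of closed geodesics on `ℝⁿ / Γ`. -/
def geodesicLengths {n : ℕ} (Γ : Subgroup (Isom n)) : Set ℝ := {ℓ | ∃ c, IsClosedGeodesic Γ ℓ c}

/-- The multiplicity of the length `ℓ`: the number of closed geodesics of length `ℓ`. -/
def geodesicMultiplicity {n : ℕ} (Γ : Subgroup (Isom n)) (ℓ : ℝ) : ℕ∞ :=
  (closedGeodesics Γ ℓ).encard

/-! ### Didicosms and tetracosms -/

/-- The motion `x ↦ b + L x`. -/
def motion (b : E 3) (L : E 3 ≃ₗᵢ[ℝ] E 3) : Isom 3 :=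
  translation b * L.toAffineIsometryEquiv

/-- The half-turn `(x, y, z) ↦ (x, -y, -z)`. -/
def halfTurnX : E 3 ≃ₗᵢ[ℝ] E 3 where
  toFun x := !₂[x 0, -x 1, -x 2]
  invFun x := !₂[x 0, -x 1, -x 2]
  map_add' x y := by ext i; fin_cases i <;> simp [add_comm]
  map_smul' c x := by ext i; fin_cases i <;> simp
  left_inv x := by ext i; fin_cases i <;> simp
  right_inv x := by ext i; fin_cases i <;> simp
  norm_map' x := by simp [EuclideanSpace.norm_eq, Fin.sum_univ_three]

/-- The half-turn `(x, y, z) ↦ (-x, y, -z)`. -/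
def halfTurnY : E 3 ≃ₗᵢ[ℝ] E 3 where
  toFun x := !₂[-x 0, x 1, -x 2]
  invFun x := !₂[-x 0, x 1, -x 2]
  map_add' x y := by ext i; fin_cases i <;> simp [add_comm]
  map_smul' c x := by ext i; fin_cases i <;> simp
  left_inv x := by ext i; fin_cases i <;> simp
  right_inv x := by ext i; fin_cases i <;> simp
  norm_map' x := by simp [EuclideanSpace.norm_eq, Fin.sum_univ_three]

/-- The half-turn `(x, y, z) ↦ (-x, -y, z)`. -/
def halfTurnZ : E 3 ≃ₗᵢ[ℝ] E 3 where
  toFun x := !₂[-x 0, -x 1, x 2]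
  invFun x := !₂[-x 0, -x 1, x 2]
  map_add' x y := by ext i; fin_cases i <;> simp [add_comm]
  map_smul' c x := by ext i; fin_cases i <;> simp
  left_inv x := by ext i; fin_cases i <;> simp
  right_inv x := by ext i; fin_cases i <;> simp
  norm_map' x := by simp [EuclideanSpace.norm_eq, Fin.sum_univ_three]

/-- The quarter-turn `(x, y, z) ↦ (-y, x, z)`. -/
def quarterTurnZ : E 3 ≃ₗᵢ[ℝ] E 3 where
  toFun x := !₂[-x 1, x 0, x 2]
  invFun x := !₂[x 1, -x 0, x 2]
  map_add' x y := by ext i; fin_cases i <;> simp [add_comm]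
  map_smul' c x := by ext i; fin_cases i <;> simp
  left_inv x := by ext i; fin_cases i <;> simp
  right_inv x := by ext i; fin_cases i <;> simp
  norm_map' x := by simp [EuclideanSpace.norm_eq, Fin.sum_univ_three, add_comm]

/-- The space group of the didicosm `c22` with parameters `A, B, C > 0`. With `a = √A`, `b = √B`,
`c = √C`, it is generated by the three period 2 screw motions
`(x, y, z) ↦ (x + a, b - y, -z)`, `(x, y, z) ↦ (-x, y + b, c - z)`,
`(x, y, z) ↦ (a - x, -y, z + c)`, whose screw vectors are orthogonal and have norms
(squared lengths) `A, B, C`; its translation lattice is generated by the doubles of these. -/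
def didicosm (A B C : ℝ) : Subgroup (Isom 3) :=
  Subgroup.closure
    {motion !₂[√A, √B, 0] halfTurnX, motion !₂[0, √B, √C] halfTurnY, motion !₂[√A, 0, √C] halfTurnZ}

/-- The space group of the tetracosm `c4` with upper parameter `D > 0` and lower parameters
`A, A` with `A > 0`: it is generated by the translations of a square lattice spanned by two orthogonal
vectors of norm (squared length) `A`, and a period 4 screw motion through a perpendicular
vector of norm `D`. -/
def tetracosm (D A : ℝ) : Subgroup (Isom 3) :=
  Subgroup.closure
    {translation !₂[√A, 0, 0], translation !₂[0, √A, 0], motion !₂[0, 0, √D] quarterTurnZ}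

end FlatManifold

end

set_option linter.unusedSectionVars false

noncomputable section

namespace FlatManifold

open MeasureTheory

/-! ### Periodic functions: Fourier series, translation invariance, unfolding -/

section Torus

/-! Dimension formula. An eigenfunction on the quotient lifts to a smooth function periodic under
the translation lattice `L`. By Green's identity its Fourier coefficient at a dual vector `w`
vanishes unless `4π²‖w‖² = μ`, so the lift is a finite trigonometric polynomial
(`eigenfunction_eq_sum`), and the eigenspace is the space of `Γ`-invariant ones. On coefficients `Γ`
acts through its finite holonomy, since lattice translations act trivially. The trace of the
averaging projection then gives the dimension as the mean, over holonomy classes `x ↦ hx + t`, of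
the sums of `exp(2πi⟪w, t⟫)` over the frequencies `w` with `hw = w` (`finrank_laplaceEigenspace`).

Isospectrality. For both families `L` is a box lattice and every nontrivial holonomy element is a
rotation about a coordinate axis, so four times the dimension is a count of dual box points plus
three one-dimensional sums. The boxes agree up to a permutation of their edges. The tetracosm's two
quarter-turn sums cancel at odd frequencies and combine at even ones into twice a half-turn sum with
half the period (`axisSum_quarter_add`), which matches the didicosm.

Lengths. The multiplicities determine the heat trace. Poisson summation on the fixed space of each
holonomy element turns it into a series of terms `c r^d exp(-π r² ℓ²)` with `c > 0`, where `ℓ` runs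
over the norms of the axial parts of the elements of `Γ` (`exists_tsum_heatTerm`,
`exists_fixedSpace_bases`). Positivity excludes cancellation, so letting `r → ∞` recovers all
exponents (`range_eq_of_hasSum_eq`). The positive values of `ℓ` are exactly the lengths of closed
geodesics (`geodesicLengths_eq`): a countability argument shows that a closed geodesic of length `ℓ`
is the image of a line that one element of `Γ` moves along itself by `ℓ`.

Multiplicities. In Didi and Tetra the elements of displacement `1` are screw motions whose axes have
explicit coordinates; counting these axes modulo the group gives four and two. -/

lemma isOpenQuotientMap_torus (ι : Type*) :
    IsOpenQuotientMap (fun (x : ι → ℝ) (i : ι) => (x i : UnitAddCircle)) :=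
  IsOpenQuotientMap.piMap fun _ => QuotientAddGroup.isOpenQuotientMap_mk

variable {ι : Type*} [Fintype ι]

/-- The half-open unit cube. -/
def unitCube (ι : Type*) : Set (ι → ℝ) := {x | ∀ i, x i ∈ Set.Ioc (0 : ℝ) 1}

/-- Invariance under translation by integer vectors. -/
def IntPeriodic {α : Type*} (F : (ι → ℝ) → α) : Prop :=
  ∀ (k : ι → ℤ) (x : ι → ℝ), F (x + fun i => (k i : ℝ)) = F x

/-- The standard character `x ↦ exp (2πi m·x)`. -/
def intChar (m : ι → ℤ) (x : ι → ℝ) : ℂ :=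
  Complex.exp (2 * Real.pi * Complex.I * ((∑ i, (m i : ℝ) * x i : ℝ) : ℂ))

lemma mFourier_coe (m : ι → ℤ) (x : ι → ℝ) :
    UnitAddTorus.mFourier m (fun i => (x i : UnitAddCircle)) = intChar m x := by
  simp only [UnitAddTorus.mFourier, ContinuousMap.coe_mk, fourier_coe_apply, intChar]
  rw [← Complex.exp_sum]
  congr 1
  push_cast
  rw [Finset.mul_sum]
  refine Finset.sum_congr rfl fun i _ => ?_
  simp; ring

/-- Points with the same image on the torus differ by an integer vector, so `F` factors through the
torus; the factor is continuous because the covering is a quotient map. -/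
lemma IntPeriodic.exists_lift {F : (ι → ℝ) → ℂ} (hF : IntPeriodic F) (hc : Continuous F) :
    ∃ G : C(UnitAddTorus ι, ℂ), ∀ x : ι → ℝ, G (fun i => (x i : UnitAddCircle)) = F x := by
  have hq := (isOpenQuotientMap_torus ι).isQuotientMap
  have hfac : ∀ x y : ι → ℝ, (fun i => (x i : UnitAddCircle)) = (fun i => (y i : UnitAddCircle)) →
      F x = F y := by
    intro x y h
    have h1 : ∀ i, ∃ k : ℤ, y i = x i + k := by
      intro i
      have h0 : ((y i - x i : ℝ) : UnitAddCircle) = 0 := by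
        rw [AddCircle.coe_sub, sub_eq_zero]; exact (congrFun h i).symm
      obtain ⟨k, hk⟩ := AddCircle.coe_eq_zero_iff 1 |>.1 h0
      exact ⟨k, by simp at hk; linarith⟩
    choose k hk using h1
    have : y = x + fun i => (k i : ℝ) := funext hk
    rw [this, hF]
  refine ⟨⟨fun t => F (Function.surjInv hq.surjective t), ?_⟩, fun x => ?_⟩
  · rw [hq.continuous_iff]
    convert hc using 1
    ext x
    exact hfac _ _ (Function.surjInv_eq hq.surjective _)
  · exact hfac _ _ (Function.surjInv_eq hq.surjective _)

lemma mem_unitCube_iff_add_one : unitCube ι =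
    {x : ι → ℝ | ∀ i, x i ∈ Set.Ioc ((0 : ι → ℝ) i) ((0 : ι → ℝ) i + 1)} := by
  simp [unitCube]

lemma measurableSet_unitCube : MeasurableSet (unitCube ι) :=
  MeasurableSet.univ_pi' fun _ => measurableSet_Ioc

lemma unitCube_subset_Icc : unitCube ι ⊆ Set.Icc 0 1 :=
  fun _ hx => ⟨fun i => (hx i).1.le, fun i => (hx i).2⟩

lemma volume_unitCube_lt_top : volume (unitCube ι) < ⊤ :=
  (measure_mono unitCube_subset_Icc).trans_lt isCompact_Icc.measure_lt_top

lemma integrableOn_unitCube {F : (ι → ℝ) → ℂ} (hc : Continuous F) :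
    IntegrableOn F (unitCube ι) :=
  (hc.continuousOn.integrableOn_compact isCompact_Icc).mono_set unitCube_subset_Icc

theorem IntPeriodic.hasSum_fourier {F : (ι → ℝ) → ℂ} (hF : IntPeriodic F) (hc : Continuous F)
    (hs : Summable fun m : ι → ℤ => ∫ y in unitCube ι, intChar (-m) y * F y) (x : ι → ℝ) :
    HasSum (fun m : ι → ℤ => (∫ y in unitCube ι, intChar (-m) y * F y) * intChar m x) (F x) := by
  obtain ⟨G, hG⟩ := hF.exists_lift hc
  have h : ∀ m : ι → ℤ, UnitAddTorus.mFourierCoeff G m =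
      ∫ y in unitCube ι, intChar (-m) y * F y := by
    intro m
    rw [UnitAddTorus.mFourierCoeff_eq_integral G m 0, mem_unitCube_iff_add_one]
    simp only [mFourier_coe, hG, smul_eq_mul]
  have h2 := UnitAddTorus.hasSum_mFourier_series_apply_of_summable (f := G)
    (by simpa only [funext h] using hs) (fun i => (x i : UnitAddCircle))
  simpa only [h, mFourier_coe, hG, smul_eq_mul] using h2

/-- Both sides are the zeroth Fourier coefficient of the lift to the torus, which may be computed
over any translate of the cube. -/
theorem IntPeriodic.setIntegral_add_right {F : (ι → ℝ) → ℂ} (hF : IntPeriodic F)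
    (hc : Continuous F) (v : ι → ℝ) :
    ∫ x in unitCube ι, F (x + v) = ∫ x in unitCube ι, F x := by
  obtain ⟨G, hG⟩ := hF.exists_lift hc
  have h : ∀ a : ι → ℝ, UnitAddTorus.mFourierCoeff G 0 =
      ∫ x in {x : ι → ℝ | ∀ i, x i ∈ Set.Ioc (a i) (a i + 1)}, F x := by
    intro a
    rw [UnitAddTorus.mFourierCoeff_eq_integral G 0 a]
    simp only [hG, neg_zero, UnitAddTorus.mFourier_zero, ContinuousMap.one_apply, one_smul]
  have h1 := (h 0).symm.trans (h v)
  rw [← mem_unitCube_iff_add_one] at h1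
  rw [h1, ← (measurePreserving_add_right volume v).setIntegral_preimage_emb
    (MeasurableEquiv.addRight v).measurableEmbedding F {x | ∀ i, x i ∈ Set.Ioc (v i) (v i + 1)}]
  congr 2
  ext x
  simp only [unitCube, Set.mem_ofPred_eq, Set.mem_preimage, Pi.add_apply, Set.mem_Ioc]
  refine forall_congr' fun i => and_congr ?_ ?_ <;> constructor <;> intro _ <;> linarith

/-- The integral of `F (x + t • v)` over the cube does not depend on `t`; differentiate under the
integral sign at `t = 0`. This takes the place of integration by parts with its boundary terms. -/
theorem IntPeriodic.setIntegral_fderiv {F : (ι → ℝ) → ℂ} (hF : IntPeriodic F)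
    (hc : ContDiff ℝ 1 F) (v : ι → ℝ) :
    ∫ x in unitCube ι, fderiv ℝ F x v = 0 := by
  have hc' : Continuous fun p : ℝ × (ι → ℝ) => fderiv ℝ F (p.2 + p.1 • v) v :=
    ((hc.continuous_fderiv one_ne_zero).comp (by fun_prop)).clm_apply continuous_const
  obtain ⟨C, hC⟩ := (isCompact_Icc.prod (isCompact_Icc (a := (0 : ι → ℝ)) (b := 1))
    |>.exists_bound_of_continuousOn (s := Set.Icc (-1 : ℝ) 1 ×ˢ Set.Icc (0 : ι → ℝ) 1)
      hc'.continuousOn)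
  have hd := hasDerivAt_integral_of_dominated_loc_of_deriv_le
    (μ := volume.restrict (unitCube ι)) (F := fun (t : ℝ) x => F (x + t • v))
    (F' := fun t x => fderiv ℝ F (x + t • v) v) (x₀ := 0) (s := Metric.ball 0 1)
    (bound := fun _ => C) (Metric.ball_mem_nhds 0 one_pos)
    (Filter.Eventually.of_forall fun t =>
      (hc.continuous.comp (by fun_prop : Continuous fun x : ι → ℝ => x + t • v)).aestronglyMeasurable)
    (integrableOn_unitCube (hc.continuous.comp (by fun_prop)))
    (hc'.comp (by fun_prop : Continuous fun x : ι → ℝ => ((0 : ℝ), x))).aestronglyMeasurable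
    (by
      filter_upwards [ae_restrict_mem measurableSet_unitCube] with x hx t ht
      refine hC (t, x) ⟨?_, unitCube_subset_Icc hx⟩
      rw [Metric.mem_ball, dist_zero_right, Real.norm_eq_abs, abs_lt] at ht
      exact ⟨ht.1.le, ht.2.le⟩)
    (integrable_const_iff.2 (Or.inr ⟨by simpa using volume_unitCube_lt_top⟩))
    (Filter.Eventually.of_forall fun x t _ => by
      have h1 : HasDerivAt (fun t : ℝ => x + t • v) v t := by
        simpa using ((hasDerivAt_id t).smul_const v).const_add x
      exact ((hc.differentiable one_ne_zero) _).hasFDerivAt.comp_hasDerivAt t h1)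
  have hconst : (fun t : ℝ => ∫ x in unitCube ι, F (x + t • v)) =
      fun _ => ∫ x in unitCube ι, F x :=
    funext fun t => hF.setIntegral_add_right hc.continuous _
  have h2 := hd.2
  rw [hconst] at h2
  simpa using h2.unique (hasDerivAt_const 0 _)

/-- The translate of the unit cube by an integer vector. -/
def intCube (k : ι → ℤ) : Set (ι → ℝ) := {x | x - (fun i => (k i : ℝ)) ∈ unitCube ι}

lemma measurableSet_intCube (k : ι → ℤ) : MeasurableSet (intCube k) :=
  measurableSet_unitCube.preimage (measurable_id.sub_const _)

lemma iUnion_intCube : ⋃ k : ι → ℤ, intCube k = Set.univ := by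
  refine Set.eq_univ_of_forall fun x => Set.mem_iUnion.2 ⟨fun i => ⌈x i⌉ - 1, fun i => ?_⟩
  have h1 := Int.ceil_lt_add_one (x i)
  have h2 := Int.le_ceil (x i)
  simp only [Pi.sub_apply, Int.cast_sub, Int.cast_one, Set.mem_Ioc]
  constructor <;> linarith

lemma pairwise_disjoint_intCube : Pairwise (Function.onFun Disjoint (intCube (ι := ι))) := by
  intro k l hkl
  refine Set.disjoint_left.2 fun x hk hl => hkl (funext fun i => ?_)
  have h1 := hk i
  have h2 := hl i
  simp only [Pi.sub_apply, Set.mem_Ioc] at h1 h2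
  have h3 : ((k i - l i : ℤ) : ℝ) < 1 := by push_cast; linarith
  have h4 : ((l i - k i : ℤ) : ℝ) < 1 := by push_cast; linarith
  have h5 : k i - l i < 1 := by exact_mod_cast h3
  have h6 : l i - k i < 1 := by exact_mod_cast h4
  omega

lemma setIntegral_intCube {M : Type*} [NormedAddCommGroup M] [NormedSpace ℝ M] (F : (ι → ℝ) → M)
    (k : ι → ℤ) :
    ∫ x in intCube k, F x = ∫ x in unitCube ι, F (x + fun i => (k i : ℝ)) := by
  rw [← (measurePreserving_add_right volume (fun i => (k i : ℝ))).setIntegral_preimage_emb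
    (MeasurableEquiv.addRight _).measurableEmbedding F]
  congr 2
  ext x
  simp [intCube]

/-- Unfolding: the integer translates of the half-open cube partition the space. -/
theorem integral_eq_setIntegral_tsum {F : (ι → ℝ) → ℂ} (hF : Integrable F) :
    ∫ x, F x = ∫ x in unitCube ι, ∑' k : ι → ℤ, F (x + fun i => (k i : ℝ)) := by
  have h1 := hasSum_integral_iUnion (f := F) (measurableSet_intCube (ι := ι))
    pairwise_disjoint_intCube hF.integrableOn
  have h2 := hasSum_integral_iUnion (f := fun x => ‖F x‖) (measurableSet_intCube (ι := ι))
    pairwise_disjoint_intCube hF.norm.integrableOn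
  rw [iUnion_intCube, Measure.restrict_univ] at h1
  simp only [setIntegral_intCube] at h1 h2
  rw [← h1.tsum_eq]
  refine integral_tsum_of_summable_integral_norm (fun k => ?_) h2.summable
  exact (hF.comp_add_right _).integrableOn

end Torus

/-! ### Characters of a lattice and vanishing of Fourier coefficients -/

section Lattice

variable {V : Type*} [NormedAddCommGroup V] [InnerProductSpace ℝ V] {ι : Type*} [Fintype ι]

/-- Two families of vectors are dual to each other. -/
def DualFamilies (b' b : ι → V) : Prop :=
  (∀ i, inner ℝ (b' i) (b i) = 1) ∧ ∀ i j, i ≠ j → inner ℝ (b' i) (b j) = 0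

/-- The integer combination of the vectors `b i` with coefficients `k i`. -/
def latticePoint (b : ι → V) (k : ι → ℤ) : V := ∑ i, (k i : ℝ) • b i

/-- The character `x ↦ exp (2πi ⟪w, x⟫)`. -/
def character (w x : V) : ℂ := Complex.exp (2 * Real.pi * Complex.I * ((inner ℝ w x : ℝ) : ℂ))

lemma DualFamilies.symm {b' b : ι → V} (h : DualFamilies b' b) : DualFamilies b b' :=
  ⟨fun i => by rw [real_inner_comm]; exact h.1 i,
    fun i j hij => by rw [real_inner_comm]; exact h.2 j i hij.symm⟩

lemma DualFamilies.inner_sum {b' b : ι → V} (h : DualFamilies b' b) (x y : ι → ℝ) :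
    inner ℝ (∑ i, x i • b' i) (∑ i, y i • b i) = ∑ i, x i * y i := by
  classical
  rw [sum_inner]
  refine Finset.sum_congr rfl fun i _ => ?_
  rw [_root_.inner_sum, Finset.sum_eq_single i]
  · rw [inner_smul_left, inner_smul_right, h.1 i]; simp
  · intro j _ hj
    rw [inner_smul_left, inner_smul_right, h.2 i j hj.symm]; simp
  · simp

lemma latticePoint_add (b : ι → V) (k l : ι → ℤ) :
    latticePoint b (k + l) = latticePoint b k + latticePoint b l := by
  simp [latticePoint, add_smul, Finset.sum_add_distrib]

lemma latticePoint_neg (b : ι → V) (k : ι → ℤ) :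
    latticePoint b (-k) = -latticePoint b k := by
  simp [latticePoint]

lemma character_add_right (w x y : V) : character w (x + y) = character w x * character w y := by
  simp only [character, inner_add_right, ← Complex.exp_add]
  congr 1; push_cast; ring

@[simp] lemma character_zero_right (w : V) : character w 0 = 1 := by simp [character]

lemma norm_character (w x : V) : ‖character w x‖ = 1 := by
  rw [character, show 2 * Real.pi * Complex.I * ((inner ℝ w x : ℝ) : ℂ) =
    ((2 * Real.pi * inner ℝ w x : ℝ) : ℂ) * Complex.I by push_cast; ring]
  exact Complex.norm_exp_ofReal_mul_I _

lemma contDiff_character (w : V) {n : WithTop ℕ∞} : ContDiff ℝ n (character w) := by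
  unfold character
  exact (contDiff_const.mul (Complex.ofRealCLM.contDiff.comp
    (contDiff_const.inner ℝ contDiff_id))).cexp

lemma hasFDerivAt_character (w x : V) : HasFDerivAt (character w)
    ((2 * Real.pi * Complex.I * character w x) • (Complex.ofRealCLM.comp (innerSL ℝ w))) x := by
  have h1 : HasFDerivAt (fun y : V => ((inner ℝ w y : ℝ) : ℂ))
      (Complex.ofRealCLM.comp (innerSL ℝ w)) x :=
    (Complex.ofRealCLM.comp (innerSL ℝ w)).hasFDerivAt
  have h2 := (h1.const_mul (2 * Real.pi * Complex.I)).cexp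
  rw [smul_smul] at h2
  rw [mul_comm (2 * (Real.pi : ℂ) * Complex.I) (character w x)]
  exact h2

lemma fderiv_character (w x v : V) : fderiv ℝ (character w) x v =
    2 * Real.pi * Complex.I * ((inner ℝ w v : ℝ) : ℂ) * character w x := by
  rw [(hasFDerivAt_character w x).fderiv]
  simp
  ring

lemma DualFamilies.character_latticePoint {b' : ι → V} {b : Module.Basis ι ℝ V}
    (h : DualFamilies b' b) (m : ι → ℤ) (x : ι → ℝ) :
    character (latticePoint b' m) (b.equivFun.symm x) = intChar m x := by
  rw [character, intChar, Module.Basis.equivFun_symm_apply, latticePoint, h.inner_sum]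

lemma equivFun_symm_intCast (b : Module.Basis ι ℝ V) (k : ι → ℤ) :
    b.equivFun.symm (fun i => (k i : ℝ)) = latticePoint b k := by
  rw [Module.Basis.equivFun_symm_apply, latticePoint]

variable [FiniteDimensional ℝ V]

lemma laplacian_eq_sum_fderiv {f : V → ℂ} (x : V) :
    (Δ f) x = ∑ i, fderiv ℝ (fderiv ℝ f) x (stdOrthonormalBasis ℝ V i)
      (stdOrthonormalBasis ℝ V i) := by
  rw [InnerProductSpace.laplacian_eq_iteratedFDeriv_stdOrthonormalBasis]
  simp [iteratedFDeriv_two_apply]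

lemma setIntegral_fderiv_of_periodic (b : Module.Basis ι ℝ V) {f : V → ℂ} (hf : ContDiff ℝ 1 f)
    (hp : ∀ k x, f (x + latticePoint b k) = f x) (v : V) :
    ∫ y in unitCube ι, fderiv ℝ f (b.equivFun.symm y) v = 0 := by
  let φ : (ι → ℝ) →L[ℝ] V := (b.equivFun.symm : (ι → ℝ) ≃ₗ[ℝ] V).toContinuousLinearEquiv
  have hφ : ∀ y, φ y = b.equivFun.symm y := fun _ => rfl
  have hper : IntPeriodic (f ∘ φ) := by
    intro k x
    simp only [Function.comp_apply, map_add]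
    rw [hφ (fun i => (k i : ℝ)), equivFun_symm_intCast, hp]
  have h := hper.setIntegral_fderiv (hf.comp φ.contDiff) (b.equivFun v)
  rw [← h]
  congr 1
  ext y
  rw [fderiv_comp _ (hf.differentiable one_ne_zero _) φ.differentiableAt]
  simp [hφ]

/-- Green's identity for `f` and `χ = character (-w)`: the integral of `Δf χ - f Δχ = (4π²‖w‖² - μ)
f χ` over a period is zero, and the factor in front is nonzero by `hm`. -/
theorem integral_character_mul_eigenfunction {b' : ι → V} {b : Module.Basis ι ℝ V}
    (hb : DualFamilies b' b) {f : V → ℂ} (hf : ContDiff ℝ ∞ f)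
    (hp : ∀ k x, f (x + latticePoint b k) = f x) {μ : ℝ}
    (hμ : ∀ x, -(Δ f) x = (μ : ℂ) * f x) (m : ι → ℤ)
    (hm : 4 * Real.pi ^ 2 * ‖latticePoint b' m‖ ^ 2 ≠ μ) :
    ∫ y in unitCube ι, intChar (-m) y * f (b.equivFun.symm y) = 0 := by
  set w := latticePoint b' m with hw
  have hper : ∀ k x, character (-w) (x + latticePoint b k) = character (-w) x := by
    intro k x
    have h1 : character (-w) (latticePoint b k) = 1 := by
      rw [hw, ← latticePoint_neg, latticePoint, latticePoint, character, hb.inner_sum]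
      rw [show (2 * Real.pi * Complex.I * ((∑ i, (((-m) i : ℤ) : ℝ) * (k i : ℝ) : ℝ) : ℂ)) =
        ((∑ i, (-m) i * k i : ℤ) : ℂ) * (2 * Real.pi * Complex.I) by push_cast; ring]
      exact Complex.exp_int_mul_two_pi_mul_I _
    rw [character_add_right, h1, mul_one]
  set e := stdOrthonormalBasis ℝ V
  have hf1 : ContDiff ℝ 1 (fderiv ℝ f) := hf.fderiv_right (by norm_cast)
  let c : V → ℂ := fun v => 2 * Real.pi * Complex.I * ((inner ℝ w v : ℝ) : ℂ)
  -- As `∂_v χ = -c v * χ`, this is `∂_v f χ - f ∂_v χ`. Summing `∂_v (G v)` over an orthonormal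
  -- basis gives its divergence `Δf χ - f Δχ`.
  let G : V → V → ℂ := fun v x => fderiv ℝ f x v * character (-w) x +
    c v * (f x * character (-w) x)
  have hG1 : ∀ v, ContDiff ℝ 1 (G v) := fun v =>
    ((hf1.clm_apply contDiff_const).mul (contDiff_character _)).add
      (contDiff_const.mul ((hf.of_le (by norm_cast)).mul (contDiff_character _)))
  have hfp : ∀ k x, fderiv ℝ f (x + latticePoint b k) = fderiv ℝ f x := by
    intro k x
    rw [← fderiv_comp_add_right]
    congr 1
    exact funext (hp k)
  have hGp : ∀ v k x, G v (x + latticePoint b k) = G v x := by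
    intro v k x
    simp only [G, hper, hfp, hp]
  have hGd : ∀ v x, fderiv ℝ (G v) x v =
      fderiv ℝ (fderiv ℝ f) x v v * character (-w) x - c v ^ 2 * (f x * character (-w) x) := by
    intro v x
    have d1 : HasFDerivAt (fun y => fderiv ℝ f y v)
        ((fderiv ℝ (fderiv ℝ f) x).flip v) x := by
      have := (hf1.differentiable one_ne_zero x).hasFDerivAt.clm_apply
        (hasFDerivAt_const v x)
      simpa using this
    have d2 := (hf.differentiable (by norm_cast) x).hasFDerivAt
    have d3 := ((contDiff_character (-w) (n := 1)).differentiable one_ne_zero x).hasFDerivAt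
    have d4 := (d1.mul d3).add ((d2.mul d3).const_mul (c v))
    rw [HasFDerivAt.fderiv (f := G v) d4]
    simp only [add_apply, smul_apply, ContinuousLinearMap.flip_apply, fderiv_character, smul_eq_mul, inner_neg_left, c]
    push_cast
    ring
  have hsum : ∀ x, ∑ i, fderiv ℝ (G (e i)) x (e i) =
      (((4 * Real.pi ^ 2 * ‖w‖ ^ 2 - μ : ℝ)) : ℂ) * (character (-w) x * f x) := by
    intro x
    simp only [hGd]
    rw [Finset.sum_sub_distrib, ← Finset.sum_mul, ← Finset.sum_mul, ← laplacian_eq_sum_fderiv]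
    have h1 : (Δ f) x = -(μ * f x) := by rw [← hμ x, neg_neg]
    have h2 : ∑ i, c (e i) ^ 2 = -((4 * Real.pi ^ 2 * ‖w‖ ^ 2 : ℝ) : ℂ) := by
      rw [← e.sum_sq_inner_left w]
      push_cast
      rw [Finset.mul_sum, ← Finset.sum_neg_distrib]
      refine Finset.sum_congr rfl fun i _ => ?_
      simp only [c]
      ring_nf
      rw [Complex.I_sq]; ring
    rw [h1, h2]; push_cast; ring
  have hzero : ∫ y in unitCube ι, ∑ i, fderiv ℝ (G (e i)) (b.equivFun.symm y) (e i) = 0 := by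
    rw [integral_finsetSum]
    · exact Finset.sum_eq_zero fun i _ =>
        setIntegral_fderiv_of_periodic b (hG1 _) (hGp _) _
    · intro i _
      refine integrableOn_unitCube ?_
      exact (((hG1 (e i)).continuous_fderiv one_ne_zero).comp
        (b.equivFun.symm.toContinuousLinearEquiv.continuous)).clm_apply continuous_const
  simp only [hsum] at hzero
  rw [integral_const_mul, mul_eq_zero] at hzero
  rcases hzero with h | h
  · exact absurd (sub_eq_zero.1 (by exact_mod_cast h)) hm
  · rw [← h]
    congr 1
    ext y
    rw [hw, ← latticePoint_neg, hb.character_latticePoint]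

end Lattice

/-! ### Eigenfunctions as finite Fourier sums, and Poisson summation -/

section Lattice

variable {V : Type*} [NormedAddCommGroup V] [InnerProductSpace ℝ V] {ι : Type*} [Fintype ι]

lemma latticePoint_mem_span (b : ι → V) (k : ι → ℤ) :
    latticePoint b k ∈ Submodule.span ℤ (Set.range b) :=
  Submodule.sum_mem _ fun i _ => by
    rw [Int.cast_smul_eq_zsmul]
    exact Submodule.smul_mem _ _ (Submodule.subset_span ⟨i, rfl⟩)

lemma mem_span_iff_exists_latticePoint (b : ι → V) (v : V) :
    v ∈ Submodule.span ℤ (Set.range b) ↔ ∃ k, latticePoint b k = v := by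
  rw [Submodule.mem_span_range_iff_exists_fun]
  simp only [latticePoint, Int.cast_smul_eq_zsmul]

lemma latticePoint_injective (b : Module.Basis ι ℝ V) :
    Function.Injective (latticePoint (b : ι → V)) := by
  intro k l h
  rw [← equivFun_symm_intCast, ← equivFun_symm_intCast] at h
  have := b.equivFun.symm.injective h
  exact funext fun i => by exact_mod_cast congrFun this i

variable [FiniteDimensional ℝ V]

lemma finite_norm_latticePoint_le (b : Module.Basis ι ℝ V) (R : ℝ) :
    {k : ι → ℤ | ‖latticePoint b k‖ ≤ R}.Finite := by
  have h := ZSpan.setFinite_inter b (Metric.isBounded_closedBall (x := (0 : V)) (r := R))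
  refine (h.preimage (latticePoint_injective b).injOn).subset fun k hk => ?_
  exact ⟨by simpa using hk, latticePoint_mem_span _ _⟩

/-- Only finitely many Fourier coefficients survive, so the series is trivially summable and
represents the continuous function `f` at every point. -/
theorem eigenfunction_eq_sum {b' : ι → V} {b : Module.Basis ι ℝ V}
    (hb : DualFamilies b' b) {f : V → ℂ} (hf : ContDiff ℝ ∞ f)
    (hp : ∀ k x, f (x + latticePoint b k) = f x) {μ : ℝ}
    (hμ : ∀ x, -(Δ f) x = (μ : ℂ) * f x) (S : Finset (ι → ℤ))
    (hS : ∀ m, 4 * Real.pi ^ 2 * ‖latticePoint b' m‖ ^ 2 = μ → m ∈ S) :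
    ∃ c : (ι → ℤ) → ℂ, (∀ m, 4 * Real.pi ^ 2 * ‖latticePoint b' m‖ ^ 2 ≠ μ → c m = 0) ∧
      ∀ x, f x = ∑ m ∈ S, c m * character (latticePoint b' m) x := by
  refine ⟨fun m => ∫ y in unitCube ι, intChar (-m) y * f (b.equivFun.symm y),
    fun m hm => integral_character_mul_eigenfunction hb hf hp hμ m hm, fun x => ?_⟩
  have h0 : ∀ m ∉ S, ∫ y in unitCube ι, intChar (-m) y * f (b.equivFun.symm y) = 0 :=
    fun m hm => integral_character_mul_eigenfunction hb hf hp hμ m fun h => hm (hS m h)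
  have hper : IntPeriodic (fun y => f (b.equivFun.symm y)) := by
    intro k y
    simp only [map_add, equivFun_symm_intCast, hp]
  have h1 := hper.hasSum_fourier
    (hf.continuous.comp b.equivFun.symm.toContinuousLinearEquiv.continuous)
    (summable_of_ne_finset_zero (s := S) h0) (b.equivFun x)
  have h2 := h1.unique (hasSum_sum_of_ne_finset_zero (s := S) fun m hm => by rw [h0 m hm, zero_mul])
  rw [LinearEquiv.symm_apply_apply] at h2
  rw [h2]
  refine Finset.sum_congr rfl fun m _ => ?_
  rw [← hb.character_latticePoint, LinearEquiv.symm_apply_apply]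

/-! ### Poisson summation for Gaussians -/

/-- Compare with `‖v‖^(-2n)` through `t^n / n! ≤ exp t`. Taking `n` to be the rank plus one makes
the exponent `2n` exceed the rank; the origin is set aside as the one exceptional index. -/
lemma summable_exp_neg_sq_latticePoint (b : Module.Basis ι ℝ V) {s : ℝ} (hs : 0 < s) :
    Summable fun k : ι → ℤ => Real.exp (-s * ‖latticePoint b k‖ ^ 2) := by
  obtain ⟨n, h2⟩ : ∃ n : ℕ, Summable fun k : ι → ℤ => (‖latticePoint b k‖ ^ (2 * n))⁻¹ := by
    refine ⟨Module.finrank ℤ (Submodule.span ℤ (Set.range b)) + 1, ?_⟩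
    have h1 := ZLattice.summable_norm_pow_inv (L := Submodule.span ℤ (Set.range b))
      (2 * (Module.finrank ℤ (Submodule.span ℤ (Set.range b)) + 1)) (by omega)
    simp only [← inv_pow] at h1 ⊢
    exact h1.comp_injective (i := fun k : ι → ℤ =>
      (⟨latticePoint b k, latticePoint_mem_span _ _⟩ : Submodule.span ℤ (Set.range b)))
      fun k l h => latticePoint_injective b (congrArg Subtype.val h)
  refine Summable.of_norm_bounded_eventually (h2.mul_left ((n.factorial : ℝ) / s ^ n)) ?_
  refine (Set.finite_singleton (0 : ι → ℤ)).subset fun k hk => ?_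
  by_contra hk0
  apply hk
  have hpos : 0 < ‖latticePoint b k‖ := by
    rw [norm_pos_iff]
    intro h
    apply hk0
    apply latticePoint_injective b
    rw [h]; simp [latticePoint]
  change ‖Real.exp (-s * ‖latticePoint b k‖ ^ 2)‖ ≤
    n.factorial / s ^ n * (‖latticePoint b k‖ ^ (2 * n))⁻¹
  rw [Real.norm_eq_abs, abs_of_pos (Real.exp_pos _), neg_mul, Real.exp_neg]
  have h3 := Real.pow_div_factorial_le_exp (s * ‖latticePoint b k‖ ^ 2) (by positivity) n
  have h4 : (n.factorial : ℝ) / s ^ n * (‖latticePoint b k‖ ^ (2 * n))⁻¹ =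
      ((s * ‖latticePoint b k‖ ^ 2) ^ n / n.factorial)⁻¹ := by
    rw [mul_pow, ← pow_mul, inv_div]; field_simp
  rw [h4]
  exact inv_anti₀ (by positivity) h3

lemma norm_sq_le_two_mul (x v : V) : ‖v‖ ^ 2 / 2 - ‖x‖ ^ 2 ≤ ‖x + v‖ ^ 2 := by
  have h : ‖v‖ ≤ ‖x + v‖ + ‖x‖ := by
    have := norm_sub_le (x + v) x
    rwa [add_sub_cancel_left] at this
  nlinarith [sq_nonneg (‖x + v‖ - ‖x‖), norm_nonneg v, norm_nonneg x, norm_nonneg (x + v)]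

/-- Halving the rate `s` buys a bound uniform for `x` in a ball, which is what continuity of the
theta series requires. -/
lemma exp_neg_sq_add_le {s R : ℝ} (hs : 0 < s) {x : V} (hx : ‖x‖ ≤ R) (v : V) :
    Real.exp (-s * ‖x + v‖ ^ 2) ≤ Real.exp (s * R ^ 2) * Real.exp (-(s / 2) * ‖v‖ ^ 2) := by
  rw [← Real.exp_add, Real.exp_le_exp]
  have h1 := norm_sq_le_two_mul x v
  have h2 : ‖x‖ ^ 2 ≤ R ^ 2 := pow_le_pow_left₀ (norm_nonneg _) hx 2
  nlinarith [mul_le_mul_of_nonneg_left h1 hs.le, mul_le_mul_of_nonneg_left h2 hs.le]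

lemma summable_exp_neg_sq_add_latticePoint (b : Module.Basis ι ℝ V) {s : ℝ} (hs : 0 < s) (x : V) :
    Summable fun k : ι → ℤ => Real.exp (-s * ‖x + latticePoint b k‖ ^ 2) :=
  Summable.of_nonneg_of_le (fun _ => (Real.exp_pos _).le)
    (fun k => exp_neg_sq_add_le hs le_rfl (latticePoint b k))
    ((summable_exp_neg_sq_latticePoint b (half_pos hs)).mul_left _)

/-- The Gaussian sum over the translate by `x` of the lattice with basis `b`. -/
def gaussianSum (b : ι → V) (s : ℝ) (x : V) : ℝ :=
  ∑' k : ι → ℤ, Real.exp (-s * ‖x + latticePoint b k‖ ^ 2)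

lemma continuous_gaussianSum (b : Module.Basis ι ℝ V) {s : ℝ} (hs : 0 < s) :
    Continuous (gaussianSum b s) := by
  rw [continuous_iff_continuousAt]
  intro x₀
  have h : ContinuousOn (gaussianSum b s) (Metric.ball 0 (‖x₀‖ + 1)) := by
    refine continuousOn_tsum (fun k => Continuous.continuousOn (by fun_prop))
      ((summable_exp_neg_sq_latticePoint b (half_pos hs)).mul_left
        (Real.exp (s * (‖x₀‖ + 1) ^ 2))) fun k x hx => ?_
    rw [Real.norm_eq_abs, abs_of_pos (Real.exp_pos _)]
    exact exp_neg_sq_add_le hs (by simpa using (Metric.mem_ball.1 hx).le) _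
  exact h.continuousAt (Metric.isOpen_ball.mem_nhds (by simp))

lemma gaussianSum_add_latticePoint (b : ι → V) (s : ℝ) (x : V) (l : ι → ℤ) :
    gaussianSum b s (x + latticePoint b l) = gaussianSum b s x := by
  unfold gaussianSum
  rw [← (Equiv.addLeft l).tsum_eq (fun k => Real.exp (-s * ‖x + latticePoint b k‖ ^ 2))]
  simp [latticePoint_add, add_assoc]

/-- Lebesgue measure in the coordinates of a basis is a multiple of the volume. -/
lemma exists_integral_equivFun_symm [MeasurableSpace V] [BorelSpace V] (b : Module.Basis ι ℝ V) :
    ∃ c : ℝ, 0 < c ∧ ∀ g : V → ℂ, ∫ y, g (b.equivFun.symm y) = c * ∫ x, g x := by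
  let e : (ι → ℝ) ≃L[ℝ] V := b.equivFun.symm.toContinuousLinearEquiv
  have : (Measure.map e volume).IsAddHaarMeasure := e.isAddHaarMeasure_map volume
  refine ⟨Measure.addHaarScalarFactor (Measure.map e volume) volume, NNReal.coe_pos.2
    (Measure.addHaarScalarFactor_pos_of_isAddHaarMeasure _ _), fun g => ?_⟩
  have h := integral_map_equiv (μ := volume) e.toHomeomorph.toMeasurableEquiv g
  change ∫ y, g y ∂(Measure.map e volume) = ∫ y, g (b.equivFun.symm y) at h
  rw [← h]
  conv_lhs => rw [Measure.isAddLeftInvariant_eq_smul (Measure.map e volume) volume]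
  rw [integral_smul_nnreal_measure, NNReal.smul_def, Complex.real_smul]

/-- Poisson summation: the Fourier coefficients of the periodized Gaussian, unfolded, are Fourier
transforms of the Gaussian. `C` is the inverse of the factor relating coordinate measure to volume;
only its positivity and its independence of `r` and `x` matter. -/
theorem hasSum_character_mul_exp_neg_sq {b' b : Module.Basis ι ℝ V}
    (hb : DualFamilies b' b) : ∃ C : ℝ, 0 < C ∧ ∀ r : ℝ, 0 < r → ∀ x : V,
      HasSum (fun m : ι → ℤ => character (latticePoint b' m) x *
          (Real.exp (-(Real.pi / r ^ 2) * ‖latticePoint b' m‖ ^ 2) : ℂ))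
        ((C * (r ^ Fintype.card ι * gaussianSum b (Real.pi * r ^ 2) x) : ℝ) : ℂ) := by
  borelize V
  obtain ⟨c, hc, hint⟩ := exists_integral_equivFun_symm b
  refine ⟨c⁻¹, inv_pos.2 hc, fun r hr x => ?_⟩
  set s := Real.pi * r ^ 2 with hs_def
  have hs : 0 < s := by positivity
  set φ := b.equivFun.symm
  have hφ : Continuous φ := b.equivFun.symm.toContinuousLinearEquiv.continuous
  set d := Fintype.card ι
  set E : (ι → ℤ) → ℝ := fun m => Real.exp (-(Real.pi / r ^ 2) * ‖latticePoint b' m‖ ^ 2)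
  have hper : IntPeriodic (fun y => (gaussianSum b s (φ y) : ℂ)) := by
    intro k y
    simp only [φ, map_add, equivFun_symm_intCast, gaussianSum_add_latticePoint]
  have hcont : Continuous (fun y => (gaussianSum b s (φ y) : ℂ)) :=
    Complex.continuous_ofReal.comp ((continuous_gaussianSum b hs).comp hφ)
  have hfr : Module.finrank ℝ V = d := Module.finrank_eq_card_basis b
  have hcoef : ∀ m : ι → ℤ, ∫ y in unitCube ι, intChar (-m) y * (gaussianSum b s (φ y) : ℂ) =
      ((c * (r ^ d)⁻¹ : ℝ) : ℂ) * (E m : ℂ) := by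
    intro m
    set w := latticePoint b' m
    -- A Gaussian times the character of `-w`. That character is constant along the lattice, so
    -- summing translates of `g` gives `intChar (-m)` times `gaussianSum`.
    let g : V → ℂ := fun v => Complex.exp (-(s : ℂ) * ‖v‖ ^ 2 +
      (-(2 * Real.pi * Complex.I)) * ((inner ℝ w v : ℝ) : ℂ))
    have hre : 0 < (s : ℂ).re := by simpa using hs
    have hg : Integrable (fun y => g (φ y)) := by
      let e : (ι → ℝ) ≃L[ℝ] V := b.equivFun.symm.toContinuousLinearEquiv
      have : (Measure.map e volume).IsAddHaarMeasure := e.isAddHaarMeasure_map volume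
      have h1 : Integrable g (Measure.map e volume) := by
        rw [Measure.isAddLeftInvariant_eq_smul (Measure.map e volume) volume]
        exact (GaussianFourier.integrable_cexp_neg_mul_sq_norm_add hre _ w).smul_measure
          ENNReal.coe_ne_top
      exact (integrable_map_equiv e.toHomeomorph.toMeasurableEquiv g).1 h1
    have hgk : ∀ (y : ι → ℝ) (k : ι → ℤ), g (φ (y + fun i => (k i : ℝ))) =
        intChar (-m) y * (Real.exp (-s * ‖φ y + latticePoint b k‖ ^ 2) : ℂ) := by
      intro y k
      have h1 : g (φ (y + fun i => (k i : ℝ))) =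
          character (latticePoint b' (-m)) (φ (y + fun i => (k i : ℝ))) *
            (Real.exp (-s * ‖φ (y + fun i => (k i : ℝ))‖ ^ 2) : ℂ) := by
        simp only [g, character, latticePoint_neg, Complex.ofReal_exp, ← Complex.exp_add,
          inner_neg_left, w]
        congr 1; push_cast; ring
      have h2 : intChar (-m) (y + fun i => (k i : ℝ)) = intChar (-m) y := by
        rw [intChar, intChar, Complex.exp_eq_exp_iff_exists_int]
        refine ⟨∑ i, (-m) i * k i, ?_⟩
        simp only [Pi.add_apply, mul_add, Finset.sum_add_distrib]
        push_cast; ring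
      rw [h1, hb.character_latticePoint, h2, map_add]
      simp only [φ, equivFun_symm_intCast]
    have h3 : ∫ y, g (φ y) = ∫ y in unitCube ι, intChar (-m) y * (gaussianSum b s (φ y) : ℂ) := by
      rw [integral_eq_setIntegral_tsum hg]
      simp only [hgk, tsum_mul_left, gaussianSum, Complex.ofReal_tsum]
    rw [← h3, hint, GaussianFourier.integral_cexp_neg_mul_sq_norm_add hre, hfr]
    -- The choice `s = π r²` turns the half-integral power `(π / s)^(d/2)` into `r^(-d)`; later this
    -- makes the coefficients genuine polynomials in `r`.
    have h4 : ((Real.pi : ℂ) / s) ^ ((d : ℂ) / 2) = (((r ^ d)⁻¹ : ℝ) : ℂ) := by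
      have h5 : (Real.pi : ℂ) / s = ((r⁻¹ ^ 2 : ℝ) : ℂ) := by
        rw [hs_def]; push_cast
        have : (r : ℂ) ≠ 0 := by exact_mod_cast hr.ne'
        have : (Real.pi : ℂ) ≠ 0 := by exact_mod_cast Real.pi_ne_zero
        field_simp
      rw [h5, show ((d : ℂ) / 2) = ((d / 2 : ℝ) : ℂ) by push_cast; rfl,
        ← Complex.ofReal_cpow (by positivity), ← Real.rpow_natCast_mul (by positivity)]
      rw [show ((2 : ℕ) : ℝ) * ((d : ℝ) / 2) = d by push_cast; ring, Real.rpow_natCast, inv_pow]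
    rw [h4]
    simp only [E]
    push_cast
    rw [← mul_assoc]
    congr 2
    rw [hs_def]; push_cast
    have h6 : (r : ℂ) ≠ 0 := by exact_mod_cast hr.ne'
    have h7 : (Real.pi : ℂ) ≠ 0 := by exact_mod_cast Real.pi_ne_zero
    field_simp
    ring_nf
    rw [Complex.I_sq]; ring
  have hE : Summable E := summable_exp_neg_sq_latticePoint b' (by positivity)
  have h8 := hper.hasSum_fourier hcont (by
    simp only [hcoef]
    exact (Complex.ofRealCLM.summable hE).mul_left _) (b.equivFun x)
  simp only [hcoef] at h8
  have h9 := h8.mul_left ((c⁻¹ * r ^ d : ℝ) : ℂ)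
  have hc' : (c : ℂ) ≠ 0 := by exact_mod_cast hc.ne'
  have hr' : (r : ℂ) ≠ 0 := by exact_mod_cast hr.ne'
  have hval : ((c⁻¹ * (r ^ d * gaussianSum b s x) : ℝ) : ℂ) =
      ((c⁻¹ * r ^ d : ℝ) : ℂ) * (gaussianSum b s (φ (b.equivFun x)) : ℂ) := by
    rw [LinearEquiv.symm_apply_apply]
    push_cast
    ring
  rw [hval]
  refine h9.congr_fun fun m => ?_
  rw [← hb.character_latticePoint, LinearEquiv.symm_apply_apply]
  simp only [E]
  push_cast
  field_simp

end Lattice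

/-! ### Dual bases and dual lattices -/

section Dual

variable {V : Type*} [NormedAddCommGroup V] [InnerProductSpace ℝ V] [FiniteDimensional ℝ V]
  {ι : Type*} [Fintype ι]

lemma exists_dualFamilies (b : Module.Basis ι ℝ V) :
    ∃ b' : Module.Basis ι ℝ V, DualFamilies b' b := by
  classical
  have hB : (innerₗ V).Nondegenerate :=
    ⟨fun x hx => inner_self_eq_zero.1 (hx x), fun x hx => inner_self_eq_zero.1 (hx x)⟩
  refine ⟨LinearMap.BilinForm.dualBasis (innerₗ V) hB b, fun i => ?_, fun i j hij => ?_⟩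
  · have := LinearMap.BilinForm.apply_dualBasis_left hB b i i
    simpa using this
  · have := LinearMap.BilinForm.apply_dualBasis_left hB b i j
    simpa [hij.symm] using this

/-- The dual of a lattice. -/
def dualLattice (L : Submodule ℤ V) : Set V := {w | ∀ v ∈ L, ∃ k : ℤ, inner ℝ w v = k}

lemma mem_dualLattice_span_iff {b' b : Module.Basis ι ℝ V} (h : DualFamilies b' b) (w : V) :
    w ∈ dualLattice (Submodule.span ℤ (Set.range b)) ↔ ∃ m, latticePoint b' m = w := by
  constructor
  · intro hw
    choose m hm using fun i => hw (b i) (Submodule.subset_span ⟨i, rfl⟩)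
    refine ⟨m, ?_⟩
    classical
    refine InnerProductSpace.ext_inner_right_basis b fun i => ?_
    have h1 := h.inner_sum (fun j => (m j : ℝ)) (Pi.single i 1)
    simp only [Pi.single_apply, ite_smul, one_smul, zero_smul, Finset.sum_ite_eq',
      Finset.mem_univ, if_true, mul_ite, mul_one, mul_zero] at h1
    rw [latticePoint, h1, hm]
  · rintro ⟨m, rfl⟩ v hv
    obtain ⟨k, rfl⟩ := (mem_span_iff_exists_latticePoint _ _).1 hv
    exact ⟨∑ i, m i * k i, by rw [latticePoint, latticePoint, h.inner_sum]; push_cast; rfl⟩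

lemma exists_basis_span_eq (L : Submodule ℤ V) [DiscreteTopology L]
    (hL : Submodule.span ℝ (L : Set V) = ⊤) :
    ∃ b : Module.Basis (Fin (Module.finrank ℝ V)) ℝ V, Submodule.span ℤ (Set.range b) = L := by
  have : IsZLattice ℝ L := ⟨hL⟩
  let c := (Module.Free.chooseBasis ℤ L).ofZLatticeBasis ℝ L
  let e := Fintype.equivFinOfCardEq (Module.finrank_eq_card_basis c).symm
  refine ⟨c.reindex e, ?_⟩
  rw [Module.Basis.range_reindex]
  exact Module.Basis.ofZLatticeBasis_span ℝ L _

end Dual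

/-! ### Linear parts, lattice translations and eigenfunctions on Euclidean space -/

section Eigenfunctions

variable {n : ℕ}

lemma isom_apply (g : Isom n) (x : E n) : g x = g.linearIsometryEquiv x + g 0 := by
  have := g.map_vadd 0 x
  simpa using this

lemma isom_ext {g g' : Isom n} (h : g.linearIsometryEquiv = g'.linearIsometryEquiv)
    (h0 : g 0 = g' 0) : g = g' := by
  ext1 x
  rw [isom_apply g, isom_apply g', h, h0]

lemma linearIsometryEquiv_mul (g g' : Isom n) : (g * g').linearIsometryEquiv =
    g.linearIsometryEquiv * g'.linearIsometryEquiv := rfl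

@[simp] lemma linearIsometryEquiv_translation (v : E n) :
    (translation v).linearIsometryEquiv = 1 := rfl

lemma mem_translationLattice {Γ : Subgroup (Isom n)} {v : E n} :
    v ∈ translationLattice Γ ↔ translation v ∈ Γ := Iff.rfl

/-- Conjugating the translation by `v` with `g` gives the translation by the linear part of `g`
applied to `v`. -/
lemma linear_mem_translationLattice {Γ : Subgroup (Isom n)} {g : Isom n} (hg : g ∈ Γ) {v : E n}
    (hv : v ∈ translationLattice Γ) : g.linearIsometryEquiv v ∈ translationLattice Γ := by
  rw [mem_translationLattice] at hv ⊢
  have h : translation (g.linearIsometryEquiv v) = g * translation v * g⁻¹ := by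
    rw [eq_mul_inv_iff_mul_eq]
    ext1 x
    change g.linearIsometryEquiv v + g x = g (v + x)
    rw [isom_apply g (v + x), isom_apply g x, map_add, add_assoc]
  rw [h]
  exact Γ.mul_mem (Γ.mul_mem hg hv) (Γ.inv_mem hg)

lemma sub_mem_translationLattice {Γ : Subgroup (Isom n)} {g g' : Isom n} (hg : g ∈ Γ)
    (hg' : g' ∈ Γ) (h : g.linearIsometryEquiv = g'.linearIsometryEquiv) :
    g 0 - g' 0 ∈ translationLattice Γ := by
  rw [mem_translationLattice]
  have h1 : translation (g 0 - g' 0) = g * g'⁻¹ := by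
    rw [eq_mul_inv_iff_mul_eq]
    ext1 x
    change g 0 - g' 0 + g' x = g x
    rw [isom_apply g x, isom_apply g' x, h]; abel
  rw [h1]
  exact Γ.mul_mem hg (Γ.inv_mem hg')

/-- Smooth solutions of `-Δ f = μ f` on Euclidean space. -/
def eigenfunctions (n : ℕ) (μ : ℝ) : Submodule ℂ (E n → ℂ) where
  carrier := {f | ContDiff ℝ ∞ f ∧ ∀ x, -(Δ f) x = (μ : ℂ) * f x}
  zero_mem' := by
    have h : (0 : E n → ℂ) = fun _ => (0 : ℂ) := rfl
    refine ⟨by rw [h]; exact contDiff_const, fun x => ?_⟩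
    rw [h, InnerProductSpace.laplacian_const]
    simp
  add_mem' := by
    rintro f g ⟨hf, hf'⟩ ⟨hg, hg'⟩
    refine ⟨hf.add hg, fun x => ?_⟩
    have h2 : (2 : WithTop ℕ∞) ≤ ∞ := by norm_cast
    rw [(hf.contDiffAt.of_le h2).laplacian_add (hg.contDiffAt.of_le h2)]
    rw [neg_add, hf' x, hg' x, Pi.add_apply, mul_add]
  smul_mem' := by
    rintro c f ⟨hf, hf'⟩
    refine ⟨contDiff_const.smul hf, fun x => ?_⟩
    have h2 : (2 : WithTop ℕ∞) ≤ ∞ := by norm_cast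
    rw [InnerProductSpace.laplacian_smul c (hf.contDiffAt.of_le h2), ← smul_neg, hf' x,
      Pi.smul_apply, smul_eq_mul, smul_eq_mul]
    ring

lemma mem_laplaceEigenspace {Γ : Subgroup (Isom n)} {μ : ℝ} {f : FlatQuot Γ → ℂ} :
    f ∈ laplaceEigenspace Γ μ ↔ f ∘ proj Γ ∈ eigenfunctions n μ := Iff.rfl

lemma character_mem_eigenfunctions {w : E n} {μ : ℝ} (h : 4 * Real.pi ^ 2 * ‖w‖ ^ 2 = μ) :
    character w ∈ eigenfunctions n μ := by
  refine ⟨contDiff_character w, fun x => ?_⟩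
  rw [laplacian_eq_sum_fderiv, ← h]
  set e := stdOrthonormalBasis ℝ (E n)
  have h1 : ∀ v, fderiv ℝ (fderiv ℝ (character w)) x v v =
      (2 * Real.pi * Complex.I * ((inner ℝ w v : ℝ) : ℂ)) ^ 2 * character w x := by
    intro v
    have d : DifferentiableAt ℝ (fderiv ℝ (character w)) x :=
      ((contDiff_character w (n := 2)).fderiv_right (m := 1) (by norm_num)).differentiable
        one_ne_zero x
    have h2 : fderiv ℝ (fun y => fderiv ℝ (character w) y v) x v =
        fderiv ℝ (fderiv ℝ (character w)) x v v := by
      rw [fderiv_clm_apply d (differentiableAt_const v)]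
      simp
    rw [← h2]
    simp only [fderiv_character]
    rw [fderiv_const_mul ((contDiff_character w (n := 1)).differentiable one_ne_zero x)]
    rw [smul_apply, fderiv_character, smul_eq_mul]
    ring
  simp only [h1, ← Finset.sum_mul]
  rw [← e.sum_sq_inner_left w, ← neg_mul]
  congr 1
  push_cast
  rw [Finset.mul_sum, ← Finset.sum_neg_distrib]
  refine Finset.sum_congr rfl fun i _ => ?_
  ring_nf
  rw [Complex.I_sq]; ring

lemma character_left_injective : Function.Injective (character : E n → E n → ℂ) := by
  intro w w' h
  refine ext_inner_right ℝ fun v => ?_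
  have h1 := fderiv_character w 0 v
  rw [h, fderiv_character w' 0 v] at h1
  simpa [Real.pi_ne_zero] using h1.symm

/-- Dedekind's theorem on distinct homomorphisms into a field; distinct frequencies are told apart
by the derivative at the origin. -/
lemma linearIndependent_character : LinearIndependent ℂ (character : E n → E n → ℂ) := by
  let χ : E n → (Multiplicative (E n) →* ℂ) := fun w =>
    { toFun := fun x => character w x.toAdd
      map_one' := character_zero_right w
      map_mul' := fun x y => character_add_right w _ _ }
  have hχ : Function.Injective χ := fun w w' h =>
    character_left_injective (funext fun x => DFunLike.congr_fun h (Multiplicative.ofAdd x))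
  exact (linearIndependent_monoidHom (Multiplicative (E n)) ℂ).comp χ hχ

end Eigenfunctions

/-! ### Eigenspace dimensions as averages over the holonomy -/

section DimensionFormula

variable {n : ℕ}

/-- The frequencies in the dual of the translation lattice that contribute to the
eigenvalue `μ`. -/
def frequencies (Γ : Subgroup (Isom n)) (μ : ℝ) : Set (E n) :=
  {w | w ∈ dualLattice (translationLattice Γ) ∧ 4 * Real.pi ^ 2 * ‖w‖ ^ 2 = μ}

lemma IsFlatManifoldGroup.exists_basis {Γ : Subgroup (Isom n)} (hΓ : IsFlatManifoldGroup Γ) :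
    ∃ b b' : Module.Basis (Fin n) ℝ (E n), DualFamilies b' b ∧
      Submodule.span ℤ (Set.range b) = translationLattice Γ := by
  have := hΓ.discrete
  obtain ⟨b, hb⟩ := exists_basis_span_eq (translationLattice Γ) hΓ.span_eq_top
  let e : Fin (Module.finrank ℝ (E n)) ≃ Fin n := finCongr (by simp)
  obtain ⟨b', hb'⟩ := exists_dualFamilies (b.reindex e)
  exact ⟨b.reindex e, b', hb', by rw [Module.Basis.range_reindex, hb]⟩

lemma IsFlatManifoldGroup.finite_frequencies {Γ : Subgroup (Isom n)}
    (hΓ : IsFlatManifoldGroup Γ) (μ : ℝ) : (frequencies Γ μ).Finite := by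
  obtain ⟨b, b', hbb, hb⟩ := hΓ.exists_basis
  refine ((finite_norm_latticePoint_le b' (|μ| + 1)).image (latticePoint b')).subset ?_
  rintro w ⟨hw, hwμ⟩
  rw [← hb, mem_dualLattice_span_iff hbb] at hw
  obtain ⟨m, rfl⟩ := hw
  refine ⟨m, ?_, rfl⟩
  have h1 : ‖latticePoint b' m‖ ^ 2 ≤ |μ| := by
    rw [← hwμ, abs_of_nonneg (by positivity)]
    have : 1 ≤ 4 * Real.pi ^ 2 := by nlinarith [Real.pi_gt_three]
    nlinarith [sq_nonneg ‖latticePoint b' m‖]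
  change ‖latticePoint b' m‖ ≤ |μ| + 1
  nlinarith [norm_nonneg (latticePoint b' m), abs_nonneg μ]

lemma inner_map_eq_inner_inv {V : Type*} [NormedAddCommGroup V] [InnerProductSpace ℝ V]
    (h : V ≃ₗᵢ[ℝ] V) (w x : V) : inner ℝ (h w) x = inner ℝ w (h⁻¹ x) := by
  conv_lhs => rw [← h.apply_symm_apply x]
  rw [h.inner_map_map]; rfl

lemma linear_mem_dualLattice {Γ : Subgroup (Isom n)} {g : Isom n} (hg : g ∈ Γ) {w : E n}
    (hw : w ∈ dualLattice (translationLattice Γ)) :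
    g.linearIsometryEquiv w ∈ dualLattice (translationLattice Γ) := by
  intro v hv
  rw [inner_map_eq_inner_inv]
  exact hw _ (linear_mem_translationLattice (Γ.inv_mem hg) hv)

lemma linear_mem_frequencies {Γ : Subgroup (Isom n)} {g : Isom n} (hg : g ∈ Γ) {μ : ℝ} {w : E n}
    (hw : w ∈ frequencies Γ μ) : g.linearIsometryEquiv w ∈ frequencies Γ μ :=
  ⟨linear_mem_dualLattice hg hw.1, by rw [LinearIsometryEquiv.norm_map]; exact hw.2⟩

lemma character_eq_one_of_mem {L : Submodule ℤ (E n)} {w v : E n} (hw : w ∈ dualLattice L)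
    (hv : v ∈ L) : character w v = 1 := by
  obtain ⟨k, hk⟩ := hw v hv
  rw [character, hk, Complex.ofReal_intCast, mul_comm]
  exact Complex.exp_int_mul_two_pi_mul_I k

/-- The action of an element of `Γ` on the frequencies of an eigenvalue. -/
def frequencyMap {Γ : Subgroup (Isom n)} {g : Isom n} (hg : g ∈ Γ) (μ : ℝ)
    (w : frequencies Γ μ) : frequencies Γ μ :=
  ⟨g.linearIsometryEquiv w, linear_mem_frequencies hg w.2⟩

/-- Composition with an element of `Γ`, on the coefficients of trigonometric polynomials. -/
def coeffAction {Γ : Subgroup (Isom n)} {g : Isom n} (hg : g ∈ Γ) (μ : ℝ) :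
    (frequencies Γ μ → ℂ) →ₗ[ℂ] (frequencies Γ μ → ℂ) where
  toFun c w := character (g.linearIsometryEquiv w : E n) (g 0) * c (frequencyMap hg μ w)
  map_add' c d := by ext w; simp [mul_add]
  map_smul' a c := by ext w; simp; ring

/-- The action comes from precomposition, hence reverses the order of products. -/
lemma coeffAction_mul {Γ : Subgroup (Isom n)} {g g' : Isom n} (hg : g ∈ Γ) (hg' : g' ∈ Γ)
    (μ : ℝ) (c : frequencies Γ μ → ℂ) :
    coeffAction hg μ (coeffAction hg' μ c) = coeffAction (Γ.mul_mem hg' hg) μ c := by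
  ext w
  simp only [coeffAction, LinearMap.coe_mk, AddHom.coe_mk, frequencyMap, ← mul_assoc]
  congr 1
  have h1 : (g' * g) 0 = g'.linearIsometryEquiv (g 0) + g' 0 := isom_apply g' (g 0)
  have h2 : character (g'.linearIsometryEquiv (g.linearIsometryEquiv w))
      (g'.linearIsometryEquiv (g 0)) = character (g.linearIsometryEquiv (w : E n)) (g 0) := by
    rw [character, character, LinearIsometryEquiv.inner_map_map]
  rw [h1, linearIsometryEquiv_mul]
  change _ = character (g'.linearIsometryEquiv (g.linearIsometryEquiv w)) _
  rw [character_add_right, h2]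

/-- Two such elements differ by a lattice translation, on which every dual frequency has character
value `1`. Thus the action depends only on the holonomy class, and a finite average is available. -/
lemma coeffAction_eq_of_linear_eq {Γ : Subgroup (Isom n)} {g g' : Isom n} (hg : g ∈ Γ)
    (hg' : g' ∈ Γ) (h : g.linearIsometryEquiv = g'.linearIsometryEquiv) (μ : ℝ) :
    coeffAction hg μ = coeffAction hg' μ := by
  ext c w
  simp only [coeffAction, LinearMap.coe_mk, AddHom.coe_mk, frequencyMap, h]
  congr 1
  have h1 : g 0 = (g 0 - g' 0) + g' 0 := by abel
  rw [h1, character_add_right, character_eq_one_of_mem (linear_mem_dualLattice hg' w.2.1)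
    (sub_mem_translationLattice hg hg' h), one_mul]

/-- The coefficients of the trigonometric polynomials that are invariant under `Γ`. -/
def invariantCoeffs (Γ : Subgroup (Isom n)) (μ : ℝ) : Submodule ℂ (frequencies Γ μ → ℂ) where
  carrier := {c | ∀ g (hg : g ∈ Γ), coeffAction hg μ c = c}
  zero_mem' g hg := map_zero _
  add_mem' := by
    intro c d hc hd g hg
    rw [map_add, hc, hd]
  smul_mem' := by
    intro a c hc g hg
    rw [map_smul, hc]

/-- Trigonometric polynomials with given coefficients. -/
def trigPoly (Γ : Subgroup (Isom n)) (μ : ℝ) [Fintype (frequencies Γ μ)] :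
    (frequencies Γ μ → ℂ) →ₗ[ℂ] (E n → ℂ) :=
  Fintype.linearCombination ℂ (fun w : frequencies Γ μ => character (w : E n))

lemma trigPoly_apply {Γ : Subgroup (Isom n)} {μ : ℝ} [Fintype (frequencies Γ μ)]
    (c : frequencies Γ μ → ℂ) (x : E n) :
    trigPoly Γ μ c x = ∑ w, c w * character (w : E n) x := by
  simp [trigPoly, Fintype.linearCombination_apply]

lemma trigPoly_injective (Γ : Subgroup (Isom n)) (μ : ℝ) [Fintype (frequencies Γ μ)] :
    Function.Injective (trigPoly Γ μ) :=
  (linearIndependent_character.comp _ Subtype.val_injective).fintypeLinearCombination_injective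

lemma trigPoly_coeffAction {Γ : Subgroup (Isom n)} {g : Isom n} (hg : g ∈ Γ) (μ : ℝ)
    [Fintype (frequencies Γ μ)] (c : frequencies Γ μ → ℂ) (x : E n) :
    trigPoly Γ μ (coeffAction hg μ c) x = trigPoly Γ μ c (g x) := by
  rw [trigPoly_apply, trigPoly_apply]
  refine Fintype.sum_bijective (frequencyMap hg μ) ?_ _ _ fun w => ?_
  · refine Finite.injective_iff_bijective.1 fun w w' h => ?_
    exact Subtype.ext (g.linearIsometryEquiv.injective (congrArg Subtype.val h))
  · rw [isom_apply g x, character_add_right]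
    have h2 : character (frequencyMap hg μ w : E n) (g.linearIsometryEquiv x) =
        character (w : E n) x := by
      rw [character, character, frequencyMap, LinearIsometryEquiv.inner_map_map]
    rw [h2]
    simp only [coeffAction, LinearMap.coe_mk, AddHom.coe_mk, frequencyMap]
    ring

lemma mem_invariantCoeffs_iff {Γ : Subgroup (Isom n)} {μ : ℝ} [Fintype (frequencies Γ μ)]
    {c : frequencies Γ μ → ℂ} :
    c ∈ invariantCoeffs Γ μ ↔ ∀ g ∈ Γ, ∀ x, trigPoly Γ μ c (g x) = trigPoly Γ μ c x := by
  constructor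
  · intro hc g hg x
    rw [← trigPoly_coeffAction hg, hc g hg]
  · intro hc g hg
    apply trigPoly_injective
    ext x
    rw [trigPoly_coeffAction hg, hc g hg]

lemma proj_apply_eq {Γ : Subgroup (Isom n)} {g : Isom n} (hg : g ∈ Γ) (x : E n) :
    proj Γ (g x) = proj Γ x :=
  (Quotient.sound (s := orbitSetoid Γ) ⟨g, hg, rfl⟩).symm

lemma proj_surjective (Γ : Subgroup (Isom n)) : Function.Surjective (proj Γ) :=
  Quotient.mk_surjective

/-- Lattice periodicity makes a lifted eigenfunction a trigonometric polynomial on the frequencies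
of `μ`, and descending to the quotient is the same as invariance of the coefficients. -/
theorem map_funLeft_laplaceEigenspace {Γ : Subgroup (Isom n)} (hΓ : IsFlatManifoldGroup Γ)
    (μ : ℝ) [Fintype (frequencies Γ μ)] :
    (laplaceEigenspace Γ μ).map (LinearMap.funLeft ℂ ℂ (proj Γ)) =
      (invariantCoeffs Γ μ).map (trigPoly Γ μ) := by
  classical
  ext f
  simp only [Submodule.mem_map]
  constructor
  · rintro ⟨f, hf, rfl⟩
    obtain ⟨b, b', hbb, hb⟩ := hΓ.exists_basis
    have hper : ∀ k x, f (proj Γ (x + latticePoint b k)) = f (proj Γ x) := by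
      intro k x
      have h1 : latticePoint b k ∈ translationLattice Γ := hb ▸ latticePoint_mem_span b k
      rw [add_comm]
      exact congrArg f (proj_apply_eq h1 x)
    have hfin : {m : Fin n → ℤ | 4 * Real.pi ^ 2 * ‖latticePoint b' m‖ ^ 2 = μ}.Finite := by
      refine ((hΓ.finite_frequencies μ).preimage (latticePoint_injective b').injOn).subset ?_
      intro m hm
      exact ⟨by rw [← hb, mem_dualLattice_span_iff hbb]; exact ⟨m, rfl⟩, hm⟩
    obtain ⟨c, -, hc⟩ := eigenfunction_eq_sum hbb (f := f ∘ proj Γ) hf.1 hper hf.2 hfin.toFinset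
      (fun m hm => by simpa using hm)
    have hex : ∀ w : frequencies Γ μ, ∃ m, latticePoint b' m = (w : E n) := fun w => by
      rw [← mem_dualLattice_span_iff hbb, hb]; exact w.2.1
    choose k hk using hex
    have hsum : ∀ x, trigPoly Γ μ (fun w => c (k w)) x = f (proj Γ x) := by
      intro x
      change _ = (f ∘ proj Γ) x
      rw [hc x, trigPoly_apply]
      refine Finset.sum_bij (fun w _ => k w) (fun w _ => ?_) (fun w _ w' _ h => ?_)
        (fun m hm => ?_) (fun w _ => by rw [hk])
      · simp only [Set.Finite.mem_toFinset]
        change 4 * Real.pi ^ 2 * ‖latticePoint b' (k w)‖ ^ 2 = μ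
        rw [hk]; exact w.2.2
      · exact Subtype.ext (by rw [← hk, ← hk, h])
      · simp only [Set.Finite.mem_toFinset] at hm
        refine ⟨⟨latticePoint b' m,
          by rw [← hb, mem_dualLattice_span_iff hbb]; exact ⟨m, rfl⟩, hm⟩, Finset.mem_univ _, ?_⟩
        exact latticePoint_injective b' (hk _)
    refine ⟨fun w => c (k w), ?_, funext hsum⟩
    rw [mem_invariantCoeffs_iff]
    intro g hg x
    rw [hsum, hsum, proj_apply_eq hg]
  · rintro ⟨c, hc, rfl⟩
    rw [mem_invariantCoeffs_iff] at hc
    have hlift : ∀ x y, (orbitSetoid Γ).r x y → trigPoly Γ μ c x = trigPoly Γ μ c y := by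
      intro x y h
      obtain ⟨g, hg, rfl⟩ := h
      exact (hc g hg x).symm
    refine ⟨Quotient.lift (s := orbitSetoid Γ) (trigPoly Γ μ c) hlift, ?_, ?_⟩
    · refine mem_laplaceEigenspace.2 ?_
      change trigPoly Γ μ c ∈ eigenfunctions n μ
      rw [trigPoly, Fintype.linearCombination_apply]
      exact Submodule.sum_mem _ fun w _ =>
        Submodule.smul_mem _ _ (character_mem_eigenfunctions w.2.2)
    · ext x; rfl

theorem nonempty_equiv_invariantCoeffs {Γ : Subgroup (Isom n)} (hΓ : IsFlatManifoldGroup Γ)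
    (μ : ℝ) : Nonempty (laplaceEigenspace Γ μ ≃ₗ[ℂ] invariantCoeffs Γ μ) := by
  have : Fintype (frequencies Γ μ) := (hΓ.finite_frequencies μ).fintype
  exact ⟨(Submodule.equivMapOfInjective _
    (LinearMap.funLeft_injective_of_surjective ℂ ℂ _ (proj_surjective Γ)) _).trans
    ((LinearEquiv.ofEq _ _ (map_funLeft_laplaceEigenspace hΓ μ)).trans
    (Submodule.equivMapOfInjective _ (trigPoly_injective Γ μ) _).symm)⟩

theorem finite_laplaceEigenspace {Γ : Subgroup (Isom n)} (hΓ : IsFlatManifoldGroup Γ)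
    (μ : ℝ) : Module.Finite ℂ (laplaceEigenspace Γ μ) := by
  have : Fintype (frequencies Γ μ) := (hΓ.finite_frequencies μ).fintype
  obtain ⟨e⟩ := nonempty_equiv_invariantCoeffs hΓ μ
  exact Module.Finite.equiv e.symm

/-- The action permutes the coordinates up to phases, so the diagonal sees only the fixed
frequencies. -/
lemma trace_coeffAction {Γ : Subgroup (Isom n)} {g : Isom n} (hg : g ∈ Γ) (μ : ℝ)
    [Fintype (frequencies Γ μ)] [DecidableEq (E n)] :
    LinearMap.trace ℂ _ (coeffAction hg μ) = ∑ w : frequencies Γ μ,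
      if g.linearIsometryEquiv (w : E n) = w then character (w : E n) (g 0) else 0 := by
  rw [LinearMap.trace_eq_matrix_trace ℂ (Pi.basisFun ℂ (frequencies Γ μ)), Matrix.trace]
  refine Finset.sum_congr rfl fun w _ => ?_
  rw [Matrix.diag_apply, LinearMap.toMatrix_apply, Pi.basisFun_apply, Pi.basisFun_repr]
  simp only [coeffAction, LinearMap.coe_mk, AddHom.coe_mk, Pi.single_apply]
  by_cases h : g.linearIsometryEquiv (w : E n) = w
  · rw [if_pos h, if_pos (Subtype.ext h), h, mul_one]
  · rw [if_neg h, if_neg (fun h' => h (congrArg Subtype.val h')), mul_zero]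

/-- A finite family of elements of `Γ` that represents each linear part exactly once. -/
structure HolonomyReps (Γ : Subgroup (Isom n)) {H : Type*} (rep : H → Isom n) : Prop where
  mem : ∀ η, rep η ∈ Γ
  exists_eq : ∀ g ∈ Γ, ∃ η, g.linearIsometryEquiv = (rep η).linearIsometryEquiv
  inj : ∀ η η', (rep η).linearIsometryEquiv = (rep η').linearIsometryEquiv → η = η'

/-- The average `P` over holonomy representatives projects onto the invariant coefficients, and the
rank of a projection is its trace. -/
theorem finrank_laplaceEigenspace {Γ : Subgroup (Isom n)} (hΓ : IsFlatManifoldGroup Γ)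
    {H : Type*} [Fintype H] {rep : H → Isom n} (hrep : HolonomyReps Γ rep) (μ : ℝ)
    [DecidableEq (E n)] :
    (Module.finrank ℂ (laplaceEigenspace Γ μ) : ℂ) = (Fintype.card H : ℂ)⁻¹ *
      ∑ η, ∑ w ∈ (hΓ.finite_frequencies μ).toFinset,
        if (rep η).linearIsometryEquiv w = w then character w (rep η 0) else 0 := by
  have : Fintype (frequencies Γ μ) := (hΓ.finite_frequencies μ).fintype
  obtain ⟨e⟩ := nonempty_equiv_invariantCoeffs hΓ μ
  have hne : Nonempty H := ⟨(hrep.exists_eq 1 Γ.one_mem).choose⟩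
  have hcard : (Fintype.card H : ℂ) ≠ 0 := by exact_mod_cast Fintype.card_ne_zero
  let P : (frequencies Γ μ → ℂ) →ₗ[ℂ] (frequencies Γ μ → ℂ) :=
    (Fintype.card H : ℂ)⁻¹ • ∑ η, coeffAction (hrep.mem η) μ
  have hP : LinearMap.IsProj (invariantCoeffs Γ μ) P := by
    constructor
    · intro c g hg
      -- The representatives need not form a group, but right multiplication by `g` permutes their
      -- holonomy classes, and the action sees no more than the class.
      choose σ hσ using fun η => hrep.exists_eq (rep η * g) (Γ.mul_mem (hrep.mem η) hg)
      have hbij : Function.Bijective σ := by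
        refine Finite.injective_iff_bijective.1 fun η η' h => hrep.inj _ _ ?_
        have h1 : (rep η * g).linearIsometryEquiv = (rep η' * g).linearIsometryEquiv := by
          rw [hσ, hσ, h]
        rw [linearIsometryEquiv_mul, linearIsometryEquiv_mul] at h1
        exact mul_right_cancel h1
      simp only [P, LinearMap.smul_apply, LinearMap.sum_apply, map_smul, map_sum]
      congr 1
      refine Fintype.sum_bijective σ hbij _ _ fun η => ?_
      rw [coeffAction_mul, coeffAction_eq_of_linear_eq _ (hrep.mem (σ η)) (hσ η)]
    · intro c hc
      simp only [P, LinearMap.smul_apply, LinearMap.sum_apply, hc _ (hrep.mem _)]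
      rw [Finset.sum_const, Finset.card_univ, ← Nat.cast_smul_eq_nsmul ℂ, smul_smul,
        inv_mul_cancel₀ hcard, one_smul]
  rw [e.finrank_eq, ← hP.trace]
  simp only [P, map_smul, map_sum, trace_coeffAction, smul_eq_mul]
  congr 1
  refine Finset.sum_congr rfl fun η _ => ?_
  exact Finset.sum_bij (fun w _ => (w : E n)) (fun w _ => by simp)
    (fun w _ w' _ h => Subtype.ext h) (fun w hw => ⟨⟨w, by simpa using hw⟩, Finset.mem_univ _, rfl⟩)
    (fun w _ => rfl)

theorem isospectral_iff_finrank {Γ Γ' : Subgroup (Isom n)} (hΓ : IsFlatManifoldGroup Γ)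
    (hΓ' : IsFlatManifoldGroup Γ') : Isospectral Γ Γ' ↔ ∀ μ : ℝ,
      Module.finrank ℂ (laplaceEigenspace Γ μ) = Module.finrank ℂ (laplaceEigenspace Γ' μ) := by
  refine forall_congr' fun μ => ?_
  have := finite_laplaceEigenspace hΓ μ
  have := finite_laplaceEigenspace hΓ' μ
  rw [← Module.finrank_eq_rank, ← Module.finrank_eq_rank, Nat.cast_inj]

end DimensionFormula

/-! ### Recovering exponents from a Gaussian series -/

section Uniqueness

open Filter Topology

variable {I : Type*}

/-- The polynomial that multiplies `exp (-q₀ r ^ 2)` in the sum of `c i * r ^ d i * exp (-q i r ^ 2)`. -/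
def levelPolynomial (c : I → ℝ) (d : I → ℕ) (q : I → ℝ) (hq : ∀ R, {i | q i ≤ R}.Finite)
    (q₀ : ℝ) : Polynomial ℝ := by
  classical
  exact ∑ i ∈ (hq q₀).toFinset with q i = q₀, Polynomial.C (c i) * Polynomial.X ^ d i

/-- At the smallest exponent `q₀` with nonzero polynomial, multiply the vanishing series by `exp(q₀
r²)`. Everything above `q₀` decays as `r → ∞`, so the polynomial tends to `0` and must be zero. -/
theorem levelPolynomial_eq_zero {c : I → ℝ} {d : I → ℕ} {q : I → ℝ} {N : ℕ}
    (hd : ∀ i, d i ≤ N) (hq : ∀ R, {i | q i ≤ R}.Finite)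
    (hc : Summable fun i => |c i| * Real.exp (-q i))
    (hs : ∀ r : ℝ, 1 ≤ r → HasSum (fun i => c i * r ^ d i * Real.exp (-(r ^ 2) * q i)) 0)
    (q₁ : ℝ) : levelPolynomial c d q hq q₁ = 0 := by
  classical
  by_contra hne
  set P := levelPolynomial c d q hq with hP
  have heval : ∀ y r, (P y).eval r = ∑ i ∈ (hq y).toFinset with q i = y, c i * r ^ d i := by
    intro y r
    simp [hP, levelPolynomial, Polynomial.eval_finsetSum]
  -- Only finitely many indices have exponent at most `q₁`, so the bad exponent can be taken
  -- minimal.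
  let B := (hq q₁).toFinset.filter fun i => P (q i) ≠ 0
  have hB : B.Nonempty := by
    by_contra hB
    rw [Finset.not_nonempty_iff_eq_empty, Finset.filter_eq_empty_iff] at hB
    apply hne
    rw [hP, levelPolynomial]
    refine Finset.sum_eq_zero fun i hi => ?_
    rw [Finset.mem_filter] at hi
    exact absurd (hi.2 ▸ hne) (hB hi.1)
  obtain ⟨i₀, hi₀, hmin⟩ := B.exists_min_image q hB
  set q₀ := q i₀ with hq₀
  have hP0 : P q₀ ≠ 0 := (Finset.mem_filter.1 hi₀).2
  have hi₀1 : q₀ ≤ q₁ := by simpa using (Finset.mem_filter.1 hi₀).1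
  have hlow : ∀ i, q i < q₀ → P (q i) = 0 := by
    intro i hi
    by_contra h
    exact absurd (hmin i (Finset.mem_filter.2 ⟨by simpa using hi.le.trans hi₀1, h⟩)) (not_le.2 hi)
  set Low := (hq q₀).toFinset with hLow
  have hmemLow : ∀ i, i ∈ Low ↔ q i ≤ q₀ := by simp [hLow]
  have hsumLow : ∀ r, ∑ i ∈ Low, c i * r ^ d i * Real.exp (-(r ^ 2) * q i) =
      (P q₀).eval r * Real.exp (-(r ^ 2) * q₀) := by
    intro r
    rw [← Finset.sum_fiberwise_of_maps_to (t := Low.image q) (g := q)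
      (fun i hi => Finset.mem_image_of_mem q hi)]
    have h1 : ∀ y ∈ Low.image q, ∑ i ∈ Low with q i = y, c i * r ^ d i *
        Real.exp (-(r ^ 2) * q i) = (P y).eval r * Real.exp (-(r ^ 2) * y) := by
      intro y hy
      obtain ⟨j, hj, rfl⟩ := Finset.mem_image.1 hy
      rw [heval, Finset.sum_mul]
      refine Finset.sum_congr ?_ ?_
      · ext i
        simp only [Finset.mem_filter, hmemLow, Set.Finite.mem_toFinset]
        refine and_congr_left fun h => ⟨fun _ => h.le, fun _ => h ▸ (hmemLow j).1 hj⟩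
      · intro i hi
        rw [(Finset.mem_filter.1 hi).2]
    rw [Finset.sum_congr rfl h1]
    refine Finset.sum_eq_single_of_mem q₀ (Finset.mem_image_of_mem q ((hmemLow i₀).2 le_rfl)) ?_
    intro y hy hyne
    obtain ⟨j, hj, rfl⟩ := Finset.mem_image.1 hy
    rw [hlow j (lt_of_le_of_ne ((hmemLow j).1 hj) hyne), Polynomial.eval_zero, zero_mul]
  -- Local finiteness gives a gap above `q₀`: look at the indices with exponent at most `q₀ + 1` and
  -- take the nearest one, if any.
  obtain ⟨δ, hδ, hgap⟩ : ∃ δ > 0, ∀ i ∉ Low, q₀ + δ ≤ q i := by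
    let G := (hq (q₀ + 1)).toFinset.filter fun i => i ∉ Low
    by_cases hG : G.Nonempty
    · obtain ⟨j, hj, hjm⟩ := G.exists_min_image q hG
      have hj2 : q₀ < q j := not_le.1 fun h => (Finset.mem_filter.1 hj).2 ((hmemLow j).2 h)
      refine ⟨min 1 (q j - q₀), lt_min one_pos (by linarith), fun i hi => ?_⟩
      by_cases h1 : q i ≤ q₀ + 1
      · have := hjm i (Finset.mem_filter.2 ⟨by simpa using h1, hi⟩)
        linarith [min_le_right 1 (q j - q₀)]
      · linarith [min_le_left 1 (q j - q₀)]
    · refine ⟨1, one_pos, fun i hi => ?_⟩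
      by_contra h
      exact hG ⟨i, Finset.mem_filter.2 ⟨by simpa using (not_le.1 h).le, hi⟩⟩
  set M := ∑' i, |c i| * Real.exp (-q i) with hM
  have hM0 : 0 ≤ M := tsum_nonneg fun i => by positivity
  have hbound : ∀ r : ℝ, 1 ≤ r → |(P q₀).eval r| ≤
      Real.exp q₀ * M * Real.exp δ * (r ^ N * Real.exp (-δ * r)) := by
    intro r hr
    have h1 := (hs r hr).summable.sum_add_tsum_compl (s := Low)
    rw [(hs r hr).tsum_eq, hsumLow] at h1
    -- The series at `r = 1` serves as majorant: passing from `1` to `r` costs each tail term a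
    -- factor of at most `K`, since its exponent is at least `q₀ + δ`.
    set K := r ^ N * Real.exp (-(δ * (r ^ 2 - 1))) * Real.exp (-((r ^ 2 - 1) * q₀)) with hK
    have hK0 : 0 ≤ K := by positivity
    have h2 : ∀ i : ((Low : Set I)ᶜ : Set I), ‖c i * r ^ d i * Real.exp (-(r ^ 2) * q i)‖ ≤
        K * (|c i| * Real.exp (-q i)) := by
      rintro ⟨i, hi⟩
      have hi' := hgap i (by simpa using hi)
      rw [norm_mul, norm_mul, Real.norm_eq_abs, Real.norm_eq_abs, Real.norm_eq_abs,
        Real.abs_exp, abs_of_nonneg (by positivity : (0 : ℝ) ≤ r ^ d i)]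
      have h3 : r ^ d i ≤ r ^ N := pow_le_pow_right₀ hr (hd i)
      have h4 : Real.exp (-(r ^ 2) * q i) ≤ Real.exp (-(δ * (r ^ 2 - 1))) *
          Real.exp (-((r ^ 2 - 1) * q₀)) * Real.exp (-q i) := by
        rw [← Real.exp_add, ← Real.exp_add, Real.exp_le_exp]
        have : 0 ≤ r ^ 2 - 1 := by nlinarith
        nlinarith [mul_nonneg this (sub_nonneg.2 hi')]
      calc |c i| * r ^ d i * Real.exp (-(r ^ 2) * q i)
          ≤ |c i| * r ^ N * (Real.exp (-(δ * (r ^ 2 - 1))) *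
              Real.exp (-((r ^ 2 - 1) * q₀)) * Real.exp (-q i)) := by gcongr
        _ = K * (|c i| * Real.exp (-q i)) := by rw [hK]; ring
    have h5 : |∑' i : ((Low : Set I)ᶜ : Set I), c i * r ^ d i * Real.exp (-(r ^ 2) * q i)| ≤
        K * M := by
      have h6 := tsum_of_norm_bounded ((hc.subtype _).mul_left K).hasSum h2
      refine h6.trans ?_
      rw [tsum_mul_left]
      exact mul_le_mul_of_nonneg_left
        (hc.tsum_subtype_le _ _ (fun i => by positivity)) hK0
    have h7 : |(P q₀).eval r| * Real.exp (-(r ^ 2) * q₀) ≤ K * M := by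
      rw [← abs_of_pos (Real.exp_pos (-(r ^ 2) * q₀)), ← abs_mul, eq_neg_of_add_eq_zero_left h1,
        abs_neg]
      exact h5
    have h8 : |(P q₀).eval r| ≤ K * M * Real.exp (r ^ 2 * q₀) := by
      have := mul_le_mul_of_nonneg_right h7 (Real.exp_pos (r ^ 2 * q₀)).le
      rwa [mul_assoc, ← Real.exp_add, neg_mul, neg_add_cancel, Real.exp_zero, mul_one] at this
    refine h8.trans ?_
    have h9 : K * M * Real.exp (r ^ 2 * q₀) = Real.exp q₀ * M *
        (r ^ N * Real.exp (-(δ * (r ^ 2 - 1)))) := by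
      have : Real.exp q₀ = Real.exp (-((r ^ 2 - 1) * q₀)) * Real.exp (r ^ 2 * q₀) := by
        rw [← Real.exp_add]; congr 1; ring
      rw [this, hK]; ring
    rw [h9, mul_assoc _ (Real.exp δ)]
    refine mul_le_mul_of_nonneg_left ?_ (by positivity)
    rw [mul_left_comm]
    refine mul_le_mul_of_nonneg_left ?_ (by positivity)
    -- As `r² ≥ r`, the Gaussian decay may be weakened to `exp δ * exp(-δ r)`, which suffices
    -- against `r ^ N`.
    rw [← Real.exp_add, Real.exp_le_exp]
    nlinarith [mul_nonneg hδ.le (mul_nonneg (by linarith : 0 ≤ r) (sub_nonneg.2 hr))]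
  have hlim : Tendsto (fun r => (P q₀).eval r) atTop (𝓝 0) := by
    have h1 := (tendsto_rpow_mul_exp_neg_mul_atTop_nhds_zero N δ hδ).const_mul
      (Real.exp q₀ * M * Real.exp δ)
    rw [mul_zero] at h1
    refine squeeze_zero_norm' ?_ h1
    filter_upwards [eventually_ge_atTop 1] with r hr
    rw [Real.rpow_natCast]
    exact hbound r hr
  exact hP0 (Polynomial.leadingCoeff_eq_zero.1 ((Polynomial.tendsto_nhds_iff _).1 hlim).1)

/-- Two positive Gaussian series with the same sum have the same exponents. -/
theorem range_eq_of_hasSum_eq {I' : Type*} {c : I → ℝ} {d : I → ℕ} {q : I → ℝ}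
    {c' : I' → ℝ} {d' : I' → ℕ} {q' : I' → ℝ} {N : ℕ} (hd : ∀ i, d i ≤ N) (hd' : ∀ i, d' i ≤ N)
    (hq : ∀ R, {i | q i ≤ R}.Finite) (hq' : ∀ R, {i | q' i ≤ R}.Finite)
    (hc : ∀ i, 0 < c i) (hc' : ∀ i, 0 < c' i) {Z : ℝ → ℝ}
    (hs : ∀ r : ℝ, 1 ≤ r → HasSum (fun i => c i * r ^ d i * Real.exp (-(r ^ 2) * q i)) (Z r))
    (hs' : ∀ r : ℝ, 1 ≤ r → HasSum (fun i => c' i * r ^ d' i * Real.exp (-(r ^ 2) * q' i)) (Z r)) :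
    Set.range q = Set.range q' := by
  classical
  -- Subtract the two series, as one signed series with sum zero over the disjoint union of the
  -- index sets.
  set C : I ⊕ I' → ℝ := Sum.elim c (fun i => -c' i) with hC
  set D : I ⊕ I' → ℕ := Sum.elim d d'
  set Q : I ⊕ I' → ℝ := Sum.elim q q'
  have hQ : ∀ R, {i | Q i ≤ R}.Finite := by
    intro R
    refine (((hq R).image Sum.inl).union ((hq' R).image Sum.inr)).subset ?_
    rintro (i | i) hi
    · exact Or.inl ⟨i, hi, rfl⟩
    · exact Or.inr ⟨i, hi, rfl⟩
  have hsum1 : Summable fun i => |C i| * Real.exp (-Q i) := by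
    have h1 := (hs 1 le_rfl).summable
    have h2 := (hs' 1 le_rfl).summable
    simp only [one_pow, mul_one, neg_mul, one_mul] at h1 h2
    refine (Summable.hasSum ?_).sum (Summable.hasSum ?_) |>.summable
    · simpa [hC, Q, Function.comp_def, abs_of_pos (hc _)] using h1
    · simpa [hC, Q, Function.comp_def, abs_of_pos (hc' _)] using h2
  have hzero := levelPolynomial_eq_zero (c := C) (d := D) (q := Q) (N := N)
    (by rintro (i | i); exacts [hd i, hd' i]) hQ hsum1 (by
      intro r hr
      have h2 := (hs' r hr).neg
      rw [← add_neg_cancel (Z r)]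
      refine HasSum.sum ?_ ?_
      · exact hs r hr
      · simpa [hC, D, Q, Function.comp_def] using h2)
  have key : ∀ y, ∑ i ∈ (hQ y).toFinset with Q i = y, C i = 0 := by
    intro y
    -- At `r = 1` the degrees disappear and the coefficients of one level sum to zero. If an
    -- exponent occurred in one series only, all of these coefficients would have the same strict
    -- sign.
    have := congrArg (Polynomial.eval 1) (hzero y)
    simpa [levelPolynomial, Polynomial.eval_finsetSum] using this
  refine Set.Subset.antisymm ?_ ?_
  · rintro _ ⟨i, rfl⟩
    by_contra hn
    refine absurd (key (q i)) (ne_of_gt ?_)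
    refine Finset.sum_pos ?_ ⟨Sum.inl i, by simp [Q]⟩
    rintro (j | j) hj
    · exact hc j
    · exact absurd ⟨j, (Finset.mem_filter.1 hj).2⟩ hn
  · rintro _ ⟨i, rfl⟩
    by_contra hn
    refine absurd (key (q' i)) (ne_of_lt ?_)
    refine Finset.sum_neg ?_ ⟨Sum.inr i, by simp [Q]⟩
    rintro (j | j) hj
    · exact absurd ⟨j, (Finset.mem_filter.1 hj).2⟩ hn
    · exact neg_neg_of_pos (hc' j)

end Uniqueness

/-! ### Finiteness of the holonomy, and fixed sublattices -/

section Holonomy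

variable {n : ℕ}

/-- The linear parts of the elements of `Γ`. -/
def holonomy (Γ : Subgroup (Isom n)) : Set (E n ≃ₗᵢ[ℝ] E n) :=
  {h | ∃ g ∈ Γ, g.linearIsometryEquiv = h}

/-- A linear part is determined by the images of a lattice basis; these are lattice vectors of
bounded norm, so there are finitely many choices. -/
lemma IsFlatManifoldGroup.finite_holonomy {Γ : Subgroup (Isom n)} (hΓ : IsFlatManifoldGroup Γ) :
    (holonomy Γ).Finite := by
  obtain ⟨b, -, -, hb⟩ := hΓ.exists_basis
  have hfin : ∀ i, {v : E n | v ∈ translationLattice Γ ∧ ‖v‖ ≤ ‖b i‖}.Finite := by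
    intro i
    refine ((finite_norm_latticePoint_le b ‖b i‖).image (latticePoint b)).subset ?_
    rintro v ⟨hv, hvn⟩
    rw [← hb, mem_span_iff_exists_latticePoint] at hv
    obtain ⟨k, rfl⟩ := hv
    exact ⟨k, hvn, rfl⟩
  refine Set.Finite.of_finite_image
    ((Set.Finite.pi' hfin).subset ?_ : ((fun h i => h (b i)) '' holonomy Γ).Finite) ?_
  · rintro _ ⟨_, ⟨g, hg, rfl⟩, rfl⟩ i
    refine ⟨linear_mem_translationLattice hg ?_, by simp⟩
    rw [← hb]
    exact Submodule.subset_span ⟨i, rfl⟩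
  · intro h _ h' _ heq
    have h1 : h.toLinearEquiv = h'.toLinearEquiv := b.ext' fun i => congrFun heq i
    exact LinearIsometryEquiv.toLinearEquiv_injective h1

lemma IsFlatManifoldGroup.exists_holonomyReps {Γ : Subgroup (Isom n)}
    (hΓ : IsFlatManifoldGroup Γ) :
    ∃ (H : Type) (_ : Fintype H) (rep : H → Isom n), HolonomyReps Γ rep := by
  have := hΓ.finite_holonomy.fintype
  choose rep hrep hlin using fun h : holonomy Γ => h.2
  refine ⟨holonomy Γ, this, rep, hrep, fun g hg => ⟨⟨_, g, hg, rfl⟩, by rw [hlin]⟩, ?_⟩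
  intro η η' h
  rw [hlin, hlin] at h
  exact Subtype.ext h

lemma IsFlatManifoldGroup.countable {Γ : Subgroup (Isom n)} (hΓ : IsFlatManifoldGroup Γ) :
    Countable Γ := by
  obtain ⟨H, _, rep, hrep⟩ := hΓ.exists_holonomyReps
  obtain ⟨b, -, -, hb⟩ := hΓ.exists_basis
  have hc : Countable (translationLattice Γ) := by
    refine ((Set.countable_range (latticePoint b)).mono fun v hv => ?_).to_subtype
    rw [SetLike.mem_coe, ← hb, mem_span_iff_exists_latticePoint] at hv
    exact hv
  choose σ hσ using fun g : Γ => hrep.exists_eq g g.2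
  let f : Γ → H × translationLattice Γ := fun g =>
    (σ g, ⟨(g : Isom n) 0 - rep (σ g) 0, sub_mem_translationLattice g.2 (hrep.mem _) (hσ g)⟩)
  have hf : Function.Injective f := by
    intro g g' h
    have h1 : σ g = σ g' := congrArg Prod.fst h
    have h2 : (g : Isom n) 0 - rep (σ g) 0 = (g' : Isom n) 0 - rep (σ g') 0 :=
      congrArg (fun x => ((x.2 : translationLattice Γ) : E n)) h
    refine Subtype.ext (isom_ext (by rw [hσ, hσ, h1]) ?_)
    rw [h1] at h2
    exact sub_left_injective h2
  exact hf.countable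

lemma IsFlatManifoldGroup.exists_pow_eq_one {Γ : Subgroup (Isom n)}
    (hΓ : IsFlatManifoldGroup Γ) {g : Isom n} (hg : g ∈ Γ) :
    ∃ m : ℕ, 0 < m ∧ g.linearIsometryEquiv ^ m = 1 := by
  have hpow : ∀ k : ℕ, (g ^ k).linearIsometryEquiv = g.linearIsometryEquiv ^ k := by
    intro k
    induction k with
    | zero => rfl
    | succ k ih => rw [pow_succ, pow_succ, linearIsometryEquiv_mul, ih]
  have h : (Submonoid.powers g.linearIsometryEquiv : Set (E n ≃ₗᵢ[ℝ] E n)).Finite := by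
    refine hΓ.finite_holonomy.subset ?_
    rintro _ ⟨k, rfl⟩
    exact ⟨g ^ k, Γ.pow_mem hg k, hpow k⟩
  obtain ⟨m, hm, h1⟩ := (isOfFinOrder_iff_pow_eq_one).1 (finite_powers.1 h)
  exact ⟨m, hm, h1⟩

/-- The subspace of vectors fixed by a linear isometry. -/
def fixedSpace (h : E n ≃ₗᵢ[ℝ] E n) : Submodule ℝ (E n) where
  carrier := {x | h x = x}
  zero_mem' := map_zero h
  add_mem' := by
    intro x y hx hy
    change h (x + y) = x + y
    rw [map_add, hx, hy]
  smul_mem' := by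
    intro a x hx
    change h (a • x) = a • x
    rw [map_smul, hx]

lemma mem_fixedSpace {h : E n ≃ₗᵢ[ℝ] E n} {x : E n} : x ∈ fixedSpace h ↔ h x = x := Iff.rfl

/-- The orthogonal projection of the translation part of `g` to the fixed space of its linear
part. -/
def axialPart (g : Isom n) : fixedSpace g.linearIsometryEquiv :=
  (fixedSpace g.linearIsometryEquiv).orthogonalProjectionOnto (g 0)

/-- For `U` the fixed space of the linear part `h`, the sublattice `L* ∩ U` has full rank in `U`,
and its dual in `U` is the orthogonal projection of `L`. Hence Poisson summation over the fixed
frequencies yields a sum over the projected lattice, whose points are the differences of axial parts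
within one holonomy class. -/
theorem exists_fixedSpace_bases {Γ : Subgroup (Isom n)} (hΓ : IsFlatManifoldGroup Γ)
    {g : Isom n} (hg : g ∈ Γ) :
    ∃ B B' : Module.Basis (Fin (Module.finrank ℝ (fixedSpace g.linearIsometryEquiv))) ℝ
        (fixedSpace g.linearIsometryEquiv), DualFamilies B B' ∧
      (∀ w : E n, w ∈ dualLattice (translationLattice Γ) ∧ g.linearIsometryEquiv w = w ↔
        ∃ k, ((latticePoint B k : fixedSpace g.linearIsometryEquiv) : E n) = w) ∧
      (∀ u : fixedSpace g.linearIsometryEquiv, (∃ k, latticePoint B' k = u) ↔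
        ∃ v ∈ translationLattice Γ,
          (fixedSpace g.linearIsometryEquiv).orthogonalProjectionOnto v = u) := by
  obtain ⟨b, b', hbb, hb⟩ := hΓ.exists_basis
  obtain ⟨m, hm, hpow⟩ := hΓ.exists_pow_eq_one hg
  set h := g.linearIsometryEquiv with hh
  set U := fixedSpace h with hU
  set D : Submodule ℤ (E n) := Submodule.span ℤ (Set.range b') with hD
  have hmemD : ∀ w, w ∈ D ↔ w ∈ dualLattice (translationLattice Γ) := by
    intro w
    rw [← hb, mem_dualLattice_span_iff hbb, hD, mem_span_iff_exists_latticePoint]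
  have hhD : ∀ w ∈ D, h w ∈ D := fun w hw =>
    (hmemD _).2 (linear_mem_dualLattice hg ((hmemD _).1 hw))
  let Λ : Submodule ℤ U := ZLattice.comap ℝ D U.subtype
  have hmemΛ : ∀ u : U, u ∈ Λ ↔ (u : E n) ∈ D := fun u => Iff.rfl
  have hdisc : DiscreteTopology Λ :=
    ZLattice.comap_discreteTopology ℝ D continuous_subtype_val U.injective_subtype
  have hspan : Submodule.span ℝ (Λ : Set U) = ⊤ := by
    -- Full rank comes from orbit sums: since `h ^ m = 1`, the sum of the `h ^ k` maps `L*` into `L*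
    -- ∩ U` and is multiplication by `m` on `U`.
    have hfix : ∀ x : E n, ∑ k ∈ Finset.range m, (h ^ k) x ∈ U := by
      intro x
      rw [hU, mem_fixedSpace, map_sum]
      have h1 : ∀ k, h ((h ^ k) x) = (h ^ (k + 1)) x := fun k => by rw [pow_succ']; rfl
      simp only [h1]
      have h2 := Finset.sum_range_succ (fun k => (h ^ k) x) m
      rw [Finset.sum_range_succ'] at h2
      rw [hpow, pow_zero] at h2
      exact add_right_cancel h2
    let A : E n →ₗ[ℝ] U := LinearMap.codRestrict U
      (∑ k ∈ Finset.range m, ((h ^ k).toLinearEquiv : E n →ₗ[ℝ] E n)) (by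
        intro x
        rw [LinearMap.sum_apply]
        exact hfix x)
    have hA : ∀ x, ((A x : U) : E n) = ∑ k ∈ Finset.range m, (h ^ k) x := by
      intro x
      simp only [A, LinearMap.codRestrict_apply, LinearMap.sum_apply]
      rfl
    have hpowD : ∀ (k : ℕ) w, w ∈ D → (h ^ k) w ∈ D := by
      intro k
      induction k with
      | zero => intro w hw; exact hw
      | succ k ih =>
        intro w hw
        rw [pow_succ']
        exact hhD _ (ih w hw)
    have hAD : ∀ w ∈ D, A w ∈ Λ := by
      intro w hw
      rw [hmemΛ, hA]
      exact Submodule.sum_mem _ fun k _ => hpowD k w hw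
    have hDtop : Submodule.span ℝ (D : Set (E n)) = ⊤ := by
      rw [hD, Submodule.span_span_of_tower, b'.span_eq]
    rw [eq_top_iff]
    rintro u -
    have h1 : A u = (m : ℝ) • u := by
      apply Subtype.ext
      rw [hA]
      have h2 : ∀ k : ℕ, (h ^ k) (u : E n) = u := by
        intro k
        induction k with
        | zero => rfl
        | succ k ih =>
          rw [pow_succ]
          change (h ^ k) (h u) = u
          rw [show h (u : E n) = u from u.2, ih]
      rw [Finset.sum_congr rfl fun k _ => h2 k, Finset.sum_const, Finset.card_range,
        ← Nat.cast_smul_eq_nsmul ℝ]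
      rfl
    have h3 : A u ∈ Submodule.span ℝ (Λ : Set U) := by
      have h4 : (u : E n) ∈ Submodule.span ℝ (D : Set (E n)) := hDtop ▸ Submodule.mem_top
      have h5 := Submodule.mem_map_of_mem (f := A) h4
      rw [Submodule.map_span] at h5
      refine Submodule.span_mono ?_ h5
      rintro _ ⟨w, hw, rfl⟩
      exact hAD w hw
    have h6 := Submodule.smul_mem _ ((m : ℝ)⁻¹) h3
    rwa [h1, smul_smul, inv_mul_cancel₀ (by exact_mod_cast hm.ne'), one_smul] at h6
  obtain ⟨B, hB⟩ := exists_basis_span_eq Λ hspan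
  obtain ⟨B', hBB⟩ := exists_dualFamilies B
  refine ⟨B, B', hBB.symm, fun w => ?_, fun u => ?_⟩
  · rw [← hmemD]
    constructor
    · rintro ⟨hw, hfw⟩
      have : (⟨w, hfw⟩ : U) ∈ Λ := hw
      rw [← hB, mem_span_iff_exists_latticePoint] at this
      obtain ⟨k, hk⟩ := this
      exact ⟨k, by rw [hk]⟩
    · rintro ⟨k, rfl⟩
      exact ⟨(hmemΛ _).1 (hB ▸ latticePoint_mem_span B k), (latticePoint B k).2⟩
  · rw [← mem_dualLattice_span_iff hBB, hB]
    constructor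
    · intro hu
      let f : D →ₗ[ℤ] E n := (((h.toLinearEquiv : E n →ₗ[ℝ] E n) -
        LinearMap.id).restrictScalars ℤ) ∘ₗ D.subtype
      have hf : ∀ w : D, f w = h w - w := fun w => rfl
      have hDfin : Module.Finite ℤ D := Module.Finite.span_of_finite ℤ (Set.finite_range b')
      have hrfin : Module.Finite ℤ (LinearMap.range f) := inferInstance
      have ht : Module.IsTorsionFree ℤ (E n) := Module.IsTorsionFree.trans_faithfulSMul ℤ ℝ _
      have ht' : Module.IsTorsionFree ℤ (LinearMap.range f) := inferInstance
      have hfree : Module.Free ℤ (LinearMap.range f) := inferInstance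
      -- The image of `h - 1` on `L*` is finitely generated and torsion-free, hence free, so the map
      -- onto it splits. Then `L* ∩ U` is a direct summand with projection `π`.
      obtain ⟨s, hs⟩ := Module.projective_lifting_property f.rangeRestrict LinearMap.id
        f.surjective_rangeRestrict
      let π : D →ₗ[ℤ] D := LinearMap.id - s ∘ₗ f.rangeRestrict
      have hπ : ∀ w, f (π w) = 0 := by
        intro w
        have h1 : f (s (f.rangeRestrict w)) = f w :=
          congrArg Subtype.val (LinearMap.congr_fun hs (f.rangeRestrict w))
        simp only [π, LinearMap.sub_apply, LinearMap.id_apply, LinearMap.comp_apply, map_sub, h1,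
          sub_self]
      have hπU : ∀ w, ((π w : D) : E n) ∈ U := fun w => sub_eq_zero.1 ((hf _).symm.trans (hπ w))
      have hπid : ∀ w : D, (w : E n) ∈ U → π w = w := by
        intro w hw
        have h1 : f.rangeRestrict w = 0 := Subtype.ext (sub_eq_zero.2 hw)
        simp only [π, LinearMap.sub_apply, LinearMap.id_apply, LinearMap.comp_apply, h1, map_zero,
          sub_zero]
      let b'D : Fin n → D := fun i => ⟨b' i, Submodule.subset_span ⟨i, rfl⟩⟩
      have hint : ∀ w : D, ∃ k : ℤ, inner ℝ ((π w : D) : E n) (u : E n) = k := by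
        intro w
        obtain ⟨k, hk⟩ := hu ⟨π w, hπU w⟩ ((hmemΛ _).2 (π w).2)
        exact ⟨k, by rw [real_inner_comm, ← hk]; rfl⟩
      -- Through `π` the integral functional `⟪·, u⟫` on `L* ∩ U` extends to all of `L*`. Its values
      -- on the dual basis are the coordinates of a lattice vector, which is shown to project to
      -- `u`.
      choose ν hν using fun i => hint (b'D i)
      have hy : ∀ w : D, inner ℝ (w : E n) (latticePoint b ν) =
          inner ℝ ((π w : D) : E n) (u : E n) := by
        intro w
        obtain ⟨k, hk⟩ := (mem_span_iff_exists_latticePoint _ _).1 w.2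
        have h1 : w = ∑ i, k i • b'D i := by
          apply Subtype.ext
          rw [← hk, latticePoint]
          simp [b'D, Int.cast_smul_eq_zsmul]
        have h2 : ((π w : D) : E n) = ∑ i, (k i : ℝ) • ((π (b'D i) : D) : E n) := by
          rw [h1, map_sum]
          simp [Int.cast_smul_eq_zsmul]
        rw [h2, ← hk, latticePoint, latticePoint, hbb.inner_sum, sum_inner]
        refine Finset.sum_congr rfl fun i _ => ?_
        rw [inner_smul_left, hν]; simp
      refine ⟨latticePoint b ν, hb ▸ latticePoint_mem_span b ν, ?_⟩
      refine (InnerProductSpace.ext_inner_left_basis B fun i => ?_)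
      have hBi : (B i : E n) ∈ D := (hmemΛ _).1 (hB ▸ Submodule.subset_span ⟨i, rfl⟩)
      rw [Submodule.inner_orthogonalProjectionOnto_eq_of_mem_left, hy ⟨_, hBi⟩,
        hπid ⟨_, hBi⟩ (B i).2]
      rfl
    · rintro ⟨v, hv, rfl⟩ w hw
      obtain ⟨k, hk⟩ := (hmemD _).1 ((hmemΛ w).1 hw) v hv
      exact ⟨k, by rw [real_inner_comm, Submodule.inner_orthogonalProjectionOnto_eq_of_mem_left, hk]⟩

end Holonomy

/-! ### Closed geodesics as axes of group elements -/

section Lengths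

variable {n : ℕ}

lemma proj_eq_iff {Γ : Subgroup (Isom n)} {x y : E n} :
    proj Γ x = proj Γ y ↔ ∃ g ∈ Γ, g x = y :=
  ⟨fun h => Quotient.exact (s := orbitSetoid Γ) h, fun h => Quotient.sound (s := orbitSetoid Γ) h⟩

lemma isom_apply_add_smul (g : Isom n) (p v : E n) (t : ℝ) :
    g (p + t • v) = g p + t • g.linearIsometryEquiv v := by
  rw [isom_apply g (p + t • v), isom_apply g p, map_add, map_smul]
  abel

/-- Periodicity gives, for each time, some element of `Γ` advancing that point of the line by `ℓ`.
The content is that a single element does it for all times. -/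
theorem isClosedGeodesic_iff {Γ : Subgroup (Isom n)} (hΓ : IsFlatManifoldGroup Γ) {ℓ : ℝ}
    {c : ℝ → FlatQuot Γ} : IsClosedGeodesic Γ ℓ c ↔ 0 < ℓ ∧ ∃ p v : E n, ‖v‖ = 1 ∧
      (∀ t, c t = proj Γ (p + t • v)) ∧
      ∃ g ∈ Γ, g.linearIsometryEquiv v = v ∧ g p = p + ℓ • v := by
  constructor
  · rintro ⟨hℓ, ⟨p, v, hv, hc⟩, hper⟩
    refine ⟨hℓ, p, v, hv, hc, ?_⟩
    have h1 : ∀ t : ℝ, ∃ g : Γ, (g : Isom n) (p + t • v) = p + (t + ℓ) • v := by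
      intro t
      have h2 := hper t
      rw [hc, hc] at h2
      obtain ⟨g, hg, hgt⟩ := proj_eq_iff.1 h2.symm
      exact ⟨⟨g, hg⟩, hgt⟩
    choose γ hγ using h1
    have hΓc := hΓ.countable
    -- Uncountably many times and countably many elements: some `g` serves two distinct times.
    -- Subtracting the two equations shows that `g` fixes the direction `v`.
    have hni : ¬ Function.Injective γ := fun hi =>
      not_countable (α := ℝ) hi.countable
    simp only [Function.Injective, not_forall] at hni
    obtain ⟨s, t, hst, hne⟩ := hni
    have h3 := hγ s
    have h4 := hγ t
    rw [← hst] at h4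
    set g := (γ s : Isom n)
    rw [isom_apply_add_smul] at h3 h4
    have h5 : (s - t) • g.linearIsometryEquiv v = (s - t) • v := by
      have := congrArg₂ (· - ·) h3 h4
      simp only [add_sub_add_left_eq_sub, ← sub_smul] at this
      rwa [show s + ℓ - (t + ℓ) = s - t by ring] at this
    have h6 : g.linearIsometryEquiv v = v := smul_right_injective _ (sub_ne_zero.2 hne) h5
    refine ⟨g, (γ s).2, h6, ?_⟩
    rw [h6, add_smul, add_comm (s • v), ← add_assoc] at h3
    exact add_right_cancel h3
  · rintro ⟨hℓ, p, v, hv, hc, g, hg, hgv, hgp⟩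
    refine ⟨hℓ, ⟨p, v, hv, hc⟩, fun t => ?_⟩
    rw [hc, hc]
    refine (proj_eq_iff.2 ⟨g, hg, ?_⟩).symm
    rw [isom_apply_add_smul, hgv, hgp, add_smul]
    abel

theorem mem_geodesicLengths_iff {Γ : Subgroup (Isom n)} (hΓ : IsFlatManifoldGroup Γ) {ℓ : ℝ} :
    ℓ ∈ geodesicLengths Γ ↔ 0 < ℓ ∧ ∃ g ∈ Γ, ∃ p v : E n, ‖v‖ = 1 ∧
      g.linearIsometryEquiv v = v ∧ g p = p + ℓ • v := by
  constructor
  · rintro ⟨c, hc⟩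
    obtain ⟨hℓ, p, v, hv, -, g, hg, h⟩ := (isClosedGeodesic_iff hΓ).1 hc
    exact ⟨hℓ, g, hg, p, v, hv, h⟩
  · rintro ⟨hℓ, g, hg, p, v, hv, h⟩
    exact ⟨_, (isClosedGeodesic_iff hΓ).2 ⟨hℓ, p, v, hv, fun t => rfl, g, hg, h⟩⟩

/-- For an isometry `h`, the vectors `h x - x` are orthogonal to fixed vectors; rank–nullity gives
equality. -/
lemma orthogonal_fixedSpace (h : E n ≃ₗᵢ[ℝ] E n) :
    (fixedSpace h)ᗮ = LinearMap.range ((h.toLinearEquiv : E n →ₗ[ℝ] E n) - LinearMap.id) := by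
  set f := (h.toLinearEquiv : E n →ₗ[ℝ] E n) - LinearMap.id with hf
  have hfa : ∀ x, f x = h x - x := fun x => rfl
  have hker : LinearMap.ker f = fixedSpace h := by
    ext x
    rw [LinearMap.mem_ker, hfa, sub_eq_zero, mem_fixedSpace]
  symm
  refine Submodule.eq_of_le_of_finrank_eq ?_ ?_
  · rintro _ ⟨x, rfl⟩
    rw [Submodule.mem_orthogonal]
    intro u hu
    rw [hfa, inner_sub_right]
    conv_lhs => enter [1]; rw [← mem_fixedSpace.1 hu]
    rw [LinearIsometryEquiv.inner_map_map, sub_self]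
  · have h1 := LinearMap.finrank_range_add_finrank_ker f
    have h2 := (fixedSpace h).finrank_add_finrank_orthogonal
    rw [hker] at h1
    omega

/-- Projecting `g p = p + ℓ v` to the fixed space kills `h p - p` and leaves axial part `ℓ v`.
Conversely, `g 0` minus its axial part has the form `h p - p`, and then `-p` lies on the axis. -/
theorem exists_axis_iff (g : Isom n) {ℓ : ℝ} (hℓ : 0 < ℓ) :
    (∃ p v : E n, ‖v‖ = 1 ∧ g.linearIsometryEquiv v = v ∧ g p = p + ℓ • v) ↔
      ‖axialPart g‖ = ℓ := by
  set h := g.linearIsometryEquiv with hh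
  have hP : ∀ x, (fixedSpace h).orthogonalProjectionOnto (h x - x) = 0 := by
    intro x
    rw [Submodule.orthogonalProjectionOnto_eq_zero_iff, orthogonal_fixedSpace]
    exact ⟨x, rfl⟩
  constructor
  · rintro ⟨p, v, hv, hgv, hgp⟩
    have h1 : g 0 = ℓ • v - (h p - p) := by
      rw [isom_apply g p] at hgp
      rw [eq_sub_iff_add_eq, ← sub_eq_iff_eq_add'.2 hgp]
      abel
    have h2 : axialPart g = ℓ • ⟨v, hgv⟩ := by
      rw [axialPart, h1, map_sub]
      erw [hP p]
      rw [sub_zero, map_smul]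
      congr 1
      exact (fixedSpace h).orthogonalProjectionOnto_mem_subspace_eq_self ⟨v, hgv⟩
    rw [h2, norm_smul, Real.norm_eq_abs, abs_of_pos hℓ]
    change ℓ * ‖v‖ = ℓ
    rw [hv, mul_one]
  · intro hn
    have h1 : g 0 - axialPart g ∈ (fixedSpace h)ᗮ :=
      (fixedSpace h).sub_starProjection_mem_orthogonal (g 0)
    rw [orthogonal_fixedSpace] at h1
    obtain ⟨p, hp⟩ := h1
    have hp' : h p - p = g 0 - axialPart g := hp
    refine ⟨-p, ℓ⁻¹ • (axialPart g : E n), ?_, ?_, ?_⟩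
    · rw [norm_smul, norm_inv, Real.norm_eq_abs, abs_of_pos hℓ]
      change ℓ⁻¹ * ‖axialPart g‖ = 1
      rw [hn, inv_mul_cancel₀ hℓ.ne']
    · rw [map_smul]
      congr 1
      exact (axialPart g).2
    · rw [smul_smul, mul_inv_cancel₀ hℓ.ne', one_smul, isom_apply g, map_neg,
        show h p = g 0 - axialPart g + p from sub_eq_iff_eq_add.1 hp']
      abel

theorem geodesicLengths_eq {Γ : Subgroup (Isom n)} (hΓ : IsFlatManifoldGroup Γ) :
    geodesicLengths Γ = {ℓ | 0 < ℓ ∧ ∃ g ∈ Γ, ‖axialPart g‖ = ℓ} := by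
  ext ℓ
  rw [mem_geodesicLengths_iff hΓ]
  refine and_congr_right fun hℓ => exists_congr fun g => and_congr_right fun _ => ?_
  exact exists_axis_iff g hℓ

end Lengths

/-! ### The heat trace and the audibility of lengths -/

section HeatTrace

variable {n : ℕ}

/-- The heat trace at time `1 / (4 π r ^ 2)`. -/
def heatTrace (Γ : Subgroup (Isom n)) (r : ℝ) : ℂ :=
  ∑' μ : ℝ, (Module.finrank ℂ (laplaceEigenspace Γ μ) : ℂ) *
    (Real.exp (-(μ / (4 * Real.pi * r ^ 2))) : ℂ)

/-- The contribution of a frequency and an isometry to the heat trace. -/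
def heatTerm (g : Isom n) (r : ℝ) (w : E n) : ℂ := by
  classical
  exact (if g.linearIsometryEquiv w = w then character w (g 0) else 0) *
    (Real.exp (-(Real.pi / r ^ 2) * ‖w‖ ^ 2) : ℂ)

lemma summable_heatTerm (g : Isom n) {r : ℝ} (hr : 0 < r) (b : Module.Basis (Fin n) ℝ (E n)) :
    Summable fun m : Fin n → ℤ => heatTerm g r (latticePoint b m) := by
  refine Summable.of_norm_bounded
    (summable_exp_neg_sq_latticePoint b (s := Real.pi / r ^ 2) (by positivity)) fun m => ?_
  rw [heatTerm, norm_mul, Complex.norm_real, Real.norm_eq_abs, Real.abs_exp]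
  refine mul_le_of_le_one_left (Real.exp_pos _).le ?_
  split_ifs
  · rw [norm_character]
  · simp

/-- Group the dual lattice points by norm: the fibre over `μ` contributes `Fintype.card H` times the
dimension of the eigenspace, by `finrank_laplaceEigenspace`. -/
theorem hasSum_heatTrace {Γ : Subgroup (Isom n)} (hΓ : IsFlatManifoldGroup Γ)
    {H : Type*} [Fintype H] {rep : H → Isom n} (hrep : HolonomyReps Γ rep)
    {b b' : Module.Basis (Fin n) ℝ (E n)} (hbb : DualFamilies b' b)
    (hb : Submodule.span ℤ (Set.range b) = translationLattice Γ) {r : ℝ} (hr : 0 < r) :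
    ∑ η, ∑' m : Fin n → ℤ, heatTerm (rep η) r (latticePoint b' m) =
      Fintype.card H * heatTrace Γ r := by
  classical
  have hne : Nonempty H := ⟨(hrep.exists_eq 1 Γ.one_mem).choose⟩
  have hcard : (Fintype.card H : ℂ) ≠ 0 := by exact_mod_cast Fintype.card_ne_zero
  have h1 : HasSum (fun m : Fin n → ℤ => ∑ η, heatTerm (rep η) r (latticePoint b' m))
      (∑ η, ∑' m : Fin n → ℤ, heatTerm (rep η) r (latticePoint b' m)) :=
    hasSum_sum fun η _ => (summable_heatTerm (rep η) hr b').hasSum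
  let f : (Fin n → ℤ) → ℝ := fun m => 4 * Real.pi ^ 2 * ‖latticePoint b' m‖ ^ 2
  have h2 := (Equiv.sigmaFiberEquiv f).hasSum_iff.2 h1
  have h3 : ∀ μ : ℝ, HasSum (fun m : {m // f m = μ} =>
      ∑ η, heatTerm (rep η) r (latticePoint b' m)) (Fintype.card H *
        ((Module.finrank ℂ (laplaceEigenspace Γ μ) : ℂ) *
          (Real.exp (-(μ / (4 * Real.pi * r ^ 2))) : ℂ))) := by
    intro μ
    have hfin : {m | f m = μ}.Finite := by
      refine ((hΓ.finite_frequencies μ).preimage (latticePoint_injective b').injOn).subset ?_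
      intro m hm
      exact ⟨by rw [← hb, mem_dualLattice_span_iff hbb]; exact ⟨m, rfl⟩, hm⟩
    have : Fintype {m // f m = μ} := hfin.fintype
    have h4 : ∑ m : {m // f m = μ}, ∑ η, heatTerm (rep η) r (latticePoint b' m) =
        Fintype.card H * ((Module.finrank ℂ (laplaceEigenspace Γ μ) : ℂ) *
          (Real.exp (-(μ / (4 * Real.pi * r ^ 2))) : ℂ)) := by
      rw [finrank_laplaceEigenspace hΓ hrep, ← mul_assoc, mul_inv_cancel_left₀ hcard,
        Finset.sum_comm, Finset.sum_mul]
      refine Finset.sum_congr rfl fun η _ => ?_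
      rw [Finset.sum_mul]
      refine Finset.sum_bij (fun m _ => latticePoint b' m) (fun m _ => ?_) (fun m _ m' _ h => ?_)
        (fun w hw => ?_) (fun m _ => ?_)
      · rw [Set.Finite.mem_toFinset]
        exact ⟨by rw [← hb, mem_dualLattice_span_iff hbb]; exact ⟨m, rfl⟩, m.2⟩
      · exact Subtype.ext (latticePoint_injective b' h)
      · rw [Set.Finite.mem_toFinset] at hw
        have hw1 := hw.1
        rw [← hb, mem_dualLattice_span_iff hbb] at hw1
        obtain ⟨m, rfl⟩ := hw1
        exact ⟨⟨m, hw.2⟩, Finset.mem_univ _, rfl⟩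
      · rw [heatTerm]
        have h5 : -(μ / (4 * Real.pi * r ^ 2)) =
            -(Real.pi / r ^ 2) * ‖latticePoint b' (m : Fin n → ℤ)‖ ^ 2 := by
          have hm : 4 * Real.pi ^ 2 * ‖latticePoint b' (m : Fin n → ℤ)‖ ^ 2 = μ := m.2
          generalize latticePoint b' (m : Fin n → ℤ) = x at hm ⊢
          rw [← hm]
          field_simp
        rw [h5]
    rw [← h4]
    exact hasSum_fintype _
  have h6 := h2.sigma h3
  rw [heatTrace, ← tsum_mul_left]
  exact h6.tsum_eq.symm

lemma norm_orthogonalProjectionOnto_fixedSpace {h h' : E n ≃ₗᵢ[ℝ] E n} (hh : h = h') (x : E n) :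
    ‖(fixedSpace h).orthogonalProjectionOnto x‖ = ‖(fixedSpace h').orthogonalProjectionOnto x‖ := by
  subst hh
  rfl

/-- Poisson summation in the fixed space of the linear part of `g`, evaluated at the axial part of
`g`. The phases on the spectral side become translations on the other side, so all resulting
coefficients are positive. -/
theorem exists_tsum_heatTerm {Γ : Subgroup (Isom n)} (hΓ : IsFlatManifoldGroup Γ)
    {b b' : Module.Basis (Fin n) ℝ (E n)} (hbb : DualFamilies b' b)
    (hb : Submodule.span ℤ (Set.range b) = translationLattice Γ) {g : Isom n} (hg : g ∈ Γ) :
    ∃ (d : ℕ) (C : ℝ) (q : (Fin d → ℤ) → ℝ), 0 < C ∧ (∀ R, {k | q k ≤ R}.Finite) ∧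
      Set.range q = {y | ∃ g' ∈ Γ, g'.linearIsometryEquiv = g.linearIsometryEquiv ∧
        y = Real.pi * ‖axialPart g'‖ ^ 2} ∧
      ∀ r : ℝ, 0 < r → ∃ S : ℝ, HasSum (fun k => C * r ^ d * Real.exp (-(r ^ 2) * q k)) S ∧
        ∑' m : Fin n → ℤ, heatTerm g r (latticePoint b' m) = S := by
  classical
  obtain ⟨B, B', hBB, hB, hB'⟩ := exists_fixedSpace_bases hΓ hg
  obtain ⟨C, hC, hP⟩ := hasSum_character_mul_exp_neg_sq hBB
  refine ⟨Module.finrank ℝ (fixedSpace g.linearIsometryEquiv), C,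
    fun k => Real.pi * ‖axialPart g + latticePoint B' k‖ ^ 2, hC, fun R => ?_, ?_, fun r hr => ?_⟩
  · refine (finite_norm_latticePoint_le B' (|R| + 1 + ‖axialPart g‖)).subset fun k hk => ?_
    have hk' : Real.pi * ‖axialPart g + latticePoint B' k‖ ^ 2 ≤ R := hk
    have h1 : ‖axialPart g + latticePoint B' k‖ ≤ |R| + 1 := by
      have : ‖axialPart g + latticePoint B' k‖ ^ 2 ≤ |R| := by
        nlinarith [Real.pi_gt_three, sq_nonneg ‖axialPart g + latticePoint B' k‖, le_abs_self R]
      nlinarith [norm_nonneg (axialPart g + latticePoint B' k), abs_nonneg R]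
    have h2 := norm_sub_le (axialPart g + latticePoint B' k) (axialPart g)
    rw [add_sub_cancel_left] at h2
    change ‖latticePoint B' k‖ ≤ _
    linarith
  · ext y
    simp only [Set.mem_range, Set.mem_ofPred_eq]
    constructor
    · rintro ⟨k, rfl⟩
      obtain ⟨v, hv, hvk⟩ := (hB' _).1 ⟨k, rfl⟩
      refine ⟨translation v * g, Γ.mul_mem hv hg, rfl, ?_⟩
      have h1 : (translation v * g : Isom n) 0 = v + g 0 := rfl
      have h2 : axialPart (translation v * g) = axialPart g + latticePoint B' k := by
        rw [add_comm, ← hvk]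
        change (fixedSpace g.linearIsometryEquiv).orthogonalProjectionOnto _ = _ + (fixedSpace g.linearIsometryEquiv).orthogonalProjectionOnto _
        rw [← map_add]
        rfl
      rw [← h2]
      rfl
    · rintro ⟨g', hg', hlin, rfl⟩
      obtain ⟨k, hk⟩ := (hB' _).2 ⟨_, sub_mem_translationLattice hg' hg hlin, rfl⟩
      refine ⟨k, ?_⟩
      have h2 : axialPart g + latticePoint B' k = (fixedSpace g.linearIsometryEquiv).orthogonalProjectionOnto (g' 0) := by
        rw [hk]
        change (fixedSpace g.linearIsometryEquiv).orthogonalProjectionOnto _ + _ = _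
        rw [← map_add]
        congr 1
        abel
      rw [h2, axialPart, norm_orthogonalProjectionOnto_fixedSpace hlin]
  · have h1 := hP r hr (axialPart g)
    rw [Fintype.card_fin] at h1
    refine ⟨C * (r ^ Module.finrank ℝ (fixedSpace g.linearIsometryEquiv) * gaussianSum B' (Real.pi * r ^ 2) (axialPart g)), ?_, ?_⟩
    · rw [← mul_assoc]
      have h2 := (summable_exp_neg_sq_add_latticePoint B' (s := Real.pi * r ^ 2) (by positivity)
        (axialPart g)).hasSum.mul_left (C * r ^ Module.finrank ℝ (fixedSpace g.linearIsometryEquiv))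
      refine h2.congr_fun fun k => ?_
      congr 2
      ring
    · refine HasSum.tsum_eq ?_
      choose j hj using fun k : Fin (Module.finrank ℝ (fixedSpace g.linearIsometryEquiv)) → ℤ => by
        have h3 := ((hB _).2 ⟨k, rfl⟩).1
        rw [← hb, mem_dualLattice_span_iff hbb] at h3
        exact h3
      have hjinj : Function.Injective j := by
        intro k l h
        apply latticePoint_injective B
        apply Subtype.ext
        rw [← hj, ← hj, h]
      -- Frequencies not fixed by `g` contribute zero, so the sum reduces to the image of the fixed
      -- sublattice under the injection `j`.
      refine (hjinj.hasSum_iff fun m hm => ?_).1 (h1.congr_fun fun k => ?_)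
      · rw [heatTerm, if_neg, zero_mul]
        intro hfix
        have h4 : latticePoint b' m ∈ dualLattice (translationLattice Γ) := by
          rw [← hb, mem_dualLattice_span_iff hbb]; exact ⟨m, rfl⟩
        obtain ⟨k, hk⟩ := (hB _).1 ⟨h4, hfix⟩
        exact hm ⟨k, latticePoint_injective b' (by rw [hj, hk])⟩
      · rw [Function.comp_apply, heatTerm, hj, if_pos (mem_fixedSpace.1 (latticePoint B k).2)]
        congr 1
        -- A fixed frequency pairs with `g 0` only through its projection to the fixed space.
        rw [character, character, axialPart,
          Submodule.inner_orthogonalProjectionOnto_eq_of_mem_left]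

/-- Isospectral groups have the same heat trace; apply uniqueness of exponents to its two
expansions, each indexed by pairs of a holonomy class and a point of the corresponding projected
lattice. -/
theorem range_axialPart_eq_of_isospectral {Γ Γ' : Subgroup (Isom n)} (hΓ : IsFlatManifoldGroup Γ)
    (hΓ' : IsFlatManifoldGroup Γ') (h : Isospectral Γ Γ') :
    {y | ∃ g ∈ Γ, y = Real.pi * ‖axialPart g‖ ^ 2} =
      {y | ∃ g ∈ Γ', y = Real.pi * ‖axialPart g‖ ^ 2} := by
  have key : ∀ Γ : Subgroup (Isom n), IsFlatManifoldGroup Γ → ∃ (I : Type) (c : I → ℝ) (d : I → ℕ)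
      (q : I → ℝ) (N : ℕ), (∀ i, d i ≤ N) ∧ (∀ R, {i | q i ≤ R}.Finite) ∧ (∀ i, 0 < c i) ∧
      (∀ r : ℝ, 1 ≤ r → HasSum (fun i => c i * r ^ d i * Real.exp (-(r ^ 2) * q i))
        (heatTrace Γ r).re) ∧ Set.range q = {y | ∃ g ∈ Γ, y = Real.pi * ‖axialPart g‖ ^ 2} := by
    intro Γ hΓ
    obtain ⟨b, b', hbb, hb⟩ := hΓ.exists_basis
    obtain ⟨H, _, rep, hrep⟩ := hΓ.exists_holonomyReps
    have hne : Nonempty H := ⟨(hrep.exists_eq 1 Γ.one_mem).choose⟩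
    have hcard : (0 : ℝ) < Fintype.card H := by exact_mod_cast Fintype.card_pos
    choose d C q hC hq hrange hsum using fun η => exists_tsum_heatTerm hΓ hbb hb (hrep.mem η)
    refine ⟨Σ η, (Fin (d η) → ℤ), fun i => C i.1 / Fintype.card H, fun i => d i.1,
      fun i => q i.1 i.2, ∑ η, d η, fun i => ?_, fun R => ?_, fun i => ?_, fun r hr => ?_, ?_⟩
    · exact Finset.single_le_sum (f := d) (fun _ _ => Nat.zero_le _) (Finset.mem_univ i.1)
    · refine (Set.finite_iUnion fun η => (hq η R).image (Sigma.mk η)).subset ?_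
      rintro ⟨η, k⟩ hk
      exact Set.mem_iUnion.2 ⟨η, k, hk, rfl⟩
    · exact div_pos (hC _) hcard
    · have hr0 : 0 < r := one_pos.trans_le hr
      choose S hS hS' using fun η => hsum η r hr0
      have h1 := hasSum_heatTrace hΓ hrep hbb hb hr0
      simp only [hS'] at h1
      have h2 : (heatTrace Γ r).re = ∑ η, S η / Fintype.card H := by
        rw [← Finset.sum_div, eq_div_iff hcard.ne', mul_comm]
        have := congrArg Complex.re h1
        rw [← Complex.ofReal_sum, Complex.ofReal_re] at this
        rw [this]
        simp
      rw [h2]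
      have h3 : ∀ η, HasSum (fun k => C η / Fintype.card H * r ^ d η *
          Real.exp (-(r ^ 2) * q η k)) (S η / Fintype.card H) := fun η =>
        ((hS η).div_const _).congr_fun fun k => by ring
      refine HasSum.sigma_of_hasSum (hasSum_fintype _) h3 ?_
      rw [summable_sigma_of_nonneg]
      · exact ⟨fun η => (h3 η).summable, Summable.of_finite⟩
      · rintro ⟨η, k⟩
        have := (hC η).le
        positivity
    · ext y
      constructor
      · rintro ⟨⟨η, k⟩, rfl⟩
        have h1 : q η k ∈ Set.range (q η) := ⟨k, rfl⟩
        rw [hrange] at h1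
        obtain ⟨g, hg, -, hy⟩ := h1
        exact ⟨g, hg, hy⟩
      · rintro ⟨g, hg, rfl⟩
        obtain ⟨η, hη⟩ := hrep.exists_eq g hg
        have h1 : Real.pi * ‖axialPart g‖ ^ 2 ∈ Set.range (q η) := by
          rw [hrange]; exact ⟨g, hg, hη, rfl⟩
        obtain ⟨k, hk⟩ := h1
        exact ⟨⟨η, k⟩, hk⟩
  obtain ⟨I, c, d, q, N, hd, hq, hc, hs, hr⟩ := key Γ hΓ
  obtain ⟨I', c', d', q', N', hd', hq', hc', hs', hr'⟩ := key Γ' hΓ'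
  rw [← hr, ← hr']
  have hZ : heatTrace Γ = heatTrace Γ' := by
    ext r
    rw [heatTrace, heatTrace]
    simp only [(isospectral_iff_finrank hΓ hΓ').1 h]
  rw [← hZ] at hs'
  exact range_eq_of_hasSum_eq (fun i => (hd i).trans (le_max_left N N'))
    (fun i => (hd' i).trans (le_max_right N N')) hq hq' hc hc' hs hs'

theorem geodesicLengths_eq_of_isospectral {Γ Γ' : Subgroup (Isom n)}
    (hΓ : IsFlatManifoldGroup Γ) (hΓ' : IsFlatManifoldGroup Γ') (h : Isospectral Γ Γ') :
    geodesicLengths Γ = geodesicLengths Γ' := by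
  have h1 := range_axialPart_eq_of_isospectral hΓ hΓ' h
  have key : ∀ Γ Γ' : Subgroup (Isom n), {y | ∃ g ∈ Γ, y = Real.pi * ‖axialPart g‖ ^ 2} =
      {y | ∃ g ∈ Γ', y = Real.pi * ‖axialPart g‖ ^ 2} → ∀ ℓ : ℝ, 0 < ℓ →
      (∃ g ∈ Γ, ‖axialPart g‖ = ℓ) → ∃ g ∈ Γ', ‖axialPart g‖ = ℓ := by
    rintro Γ Γ' h ℓ - ⟨g, hg, rfl⟩
    have h2 : Real.pi * ‖axialPart g‖ ^ 2 ∈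
        {y | ∃ g ∈ Γ', y = Real.pi * ‖axialPart g‖ ^ 2} := h ▸ ⟨g, hg, rfl⟩
    obtain ⟨g', hg', h3⟩ := h2
    refine ⟨g', hg', ?_⟩
    have h4 := mul_left_cancel₀ Real.pi_ne_zero h3
    exact ((pow_left_inj₀ (norm_nonneg _) (norm_nonneg _) two_ne_zero).1 h4).symm
  rw [geodesicLengths_eq hΓ, geodesicLengths_eq hΓ']
  ext ℓ
  exact and_congr_right fun hℓ => ⟨key Γ Γ' h1 ℓ hℓ, key Γ' Γ h1.symm ℓ hℓ⟩

end HeatTrace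

/-! ### Dimension formula for box lattices with axial rotations -/

section BoxLattice

/-- The orthogonal basis of Euclidean space consisting of multiples of the standard basis. -/
def diagBasis (ℓ : Fin 3 → ℝ) (hℓ : ∀ i, 0 < ℓ i) : Module.Basis (Fin 3) ℝ (E 3) :=
  (EuclideanSpace.basisFun (Fin 3) ℝ).toBasis.isUnitSMul (w := ℓ) fun i => (hℓ i).ne'.isUnit

lemma diagBasis_apply (ℓ : Fin 3 → ℝ) (hℓ : ∀ i, 0 < ℓ i) (i : Fin 3) :
    diagBasis ℓ hℓ i = ℓ i • EuclideanSpace.single i (1 : ℝ) := by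
  simp [diagBasis, Module.Basis.isUnitSMul_apply]

lemma latticePoint_diagBasis (ℓ : Fin 3 → ℝ) (hℓ : ∀ i, 0 < ℓ i) (k : Fin 3 → ℤ) (i : Fin 3) :
    latticePoint (diagBasis ℓ hℓ) k i = k i * ℓ i := by
  simp [latticePoint, diagBasis_apply, Finset.sum_apply, Pi.single_apply]

lemma inv_pos_of_pos {ℓ : Fin 3 → ℝ} (hℓ : ∀ i, 0 < ℓ i) (i : Fin 3) : 0 < (ℓ i)⁻¹ :=
  inv_pos.2 (hℓ i)

lemma dualFamilies_diagBasis (ℓ : Fin 3 → ℝ) (hℓ : ∀ i, 0 < ℓ i) :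
    DualFamilies (diagBasis (fun i => (ℓ i)⁻¹) (inv_pos_of_pos hℓ)) (diagBasis ℓ hℓ) := by
  constructor
  · intro i
    simp [diagBasis_apply, inner_smul_left, inner_smul_right, (hℓ i).ne']
  · intro i j hij
    have h : inner ℝ (EuclideanSpace.single i (1 : ℝ)) (EuclideanSpace.single j (1 : ℝ)) = 0 := by
      rw [EuclideanSpace.inner_single_left]
      simp [hij]
    simp [diagBasis_apply, inner_smul_left, inner_smul_right, h]

/-- The translation lattice is the lattice of boxes with edge lengths `ℓ`. -/
def HasBoxLattice (Γ : Subgroup (Isom 3)) (ℓ : Fin 3 → ℝ) : Prop :=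
  ∀ v : E 3, v ∈ translationLattice Γ ↔ ∃ k : Fin 3 → ℤ, ∀ i, v i = k i * ℓ i

lemma HasBoxLattice.span_eq {Γ : Subgroup (Isom 3)} {ℓ : Fin 3 → ℝ} (h : HasBoxLattice Γ ℓ)
    (hℓ : ∀ i, 0 < ℓ i) :
    Submodule.span ℤ (Set.range (diagBasis ℓ hℓ)) = translationLattice Γ := by
  ext v
  rw [mem_span_iff_exists_latticePoint, h v]
  refine exists_congr fun k => ⟨?_, fun hk => ?_⟩
  · rintro rfl i
    exact latticePoint_diagBasis ℓ hℓ k i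
  · ext i
    rw [latticePoint_diagBasis, hk]

lemma HasBoxLattice.isFlatManifoldGroup {Γ : Subgroup (Isom 3)} {ℓ : Fin 3 → ℝ}
    (h : HasBoxLattice Γ ℓ) (hℓ : ∀ i, 0 < ℓ i)
    (hfree : ∀ g ∈ Γ, ∀ x : E 3, g x = x → g = 1) : IsFlatManifoldGroup Γ where
  discrete := by
    rw [← h.span_eq hℓ]
    infer_instance
  span_eq_top := by
    rw [← h.span_eq hℓ, Submodule.span_span_of_tower, Module.Basis.span_eq]
  free := hfree

lemma HasBoxLattice.mem_frequencies {Γ : Subgroup (Isom 3)} {ℓ : Fin 3 → ℝ}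
    (h : HasBoxLattice Γ ℓ) (hℓ : ∀ i, 0 < ℓ i) {μ : ℝ} {w : E 3} :
    w ∈ frequencies Γ μ ↔ (∃ m : Fin 3 → ℤ, ∀ i, w i = m i / ℓ i) ∧
      4 * Real.pi ^ 2 * ∑ i, w i ^ 2 = μ := by
  rw [frequencies, Set.mem_ofPred_eq, ← h.span_eq hℓ,
    mem_dualLattice_span_iff (dualFamilies_diagBasis ℓ hℓ), EuclideanSpace.real_norm_sq_eq]
  refine and_congr_left fun _ => exists_congr fun m => ⟨?_, fun hm => ?_⟩
  · rintro rfl i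
    rw [latticePoint_diagBasis, div_eq_mul_inv]
  · ext i
    rw [latticePoint_diagBasis, hm, div_eq_mul_inv]

/-- The number of points of the dual of a box lattice on a sphere. -/
def boxCount (ℓ : Fin 3 → ℝ) (μ : ℝ) : ℂ :=
  ∑ᶠ _w ∈ {w : E 3 | (∃ m : Fin 3 → ℤ, ∀ i, w i = m i / ℓ i) ∧
    4 * Real.pi ^ 2 * ∑ i, w i ^ 2 = μ}, (1 : ℂ)

/-- The contribution to the spectrum of a rotation with phase `θ` about an axis. -/
def axisSum (p θ μ : ℝ) : ℂ :=
  ∑ᶠ i ∈ {i : ℤ | 4 * Real.pi ^ 2 * ((i : ℝ) / p) ^ 2 = μ},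
    Complex.exp (2 * Real.pi * Complex.I * ((i * θ : ℝ) : ℂ))

lemma boxCount_comp_perm (ℓ : Fin 3 → ℝ) (μ : ℝ) (σ : Equiv.Perm (Fin 3)) :
    boxCount (ℓ ∘ σ) μ = boxCount ℓ μ := by
  let e := LinearIsometryEquiv.piLpCongrLeft 2 ℝ ℝ σ
  have he : ∀ (w : E 3) i, e w i = w (σ.symm i) := fun w i => rfl
  refine finsum_mem_eq_of_bijOn e ⟨?_, e.injective.injOn, ?_⟩ fun _ _ => rfl
  · rintro w ⟨⟨m, hm⟩, hμ⟩
    refine ⟨⟨m ∘ σ.symm, fun i => by rw [he, hm]; simp⟩, ?_⟩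
    rw [← hμ]
    congr 1
    simp only [he]
    exact Equiv.sum_comp σ.symm (fun i => w i ^ 2)
  · rintro w ⟨⟨m, hm⟩, hμ⟩
    refine ⟨WithLp.toLp 2 (w ∘ σ), ⟨⟨m ∘ σ, fun i => hm (σ i)⟩, ?_⟩, ?_⟩
    · rw [← hμ]
      congr 1
      exact Equiv.sum_comp σ (fun i => w i ^ 2)
    · ext i
      rw [he]
      simp

lemma finsum_mem_ite {α : Type*} (s : Set α) (P : α → Prop) [DecidablePred P] (f : α → ℂ) :
    ∑ᶠ x ∈ s, (if P x then f x else 0) = ∑ᶠ x ∈ {x | x ∈ s ∧ P x}, f x := by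
  rw [finsum_mem_def, finsum_mem_def]
  congr 1
  ext x
  by_cases h1 : x ∈ s <;> by_cases h2 : P x <;> simp [h1, h2]

/-- The fixed frequencies lie on the coordinate axis `t`, at the points `i / ℓ t`, so only the
displacement along that axis, as a fraction of the period, enters the phase. -/
lemma HasBoxLattice.finsum_axis {Γ : Subgroup (Isom 3)} {ℓ : Fin 3 → ℝ}
    (h : HasBoxLattice Γ ℓ) (hℓ : ∀ i, 0 < ℓ i) (μ : ℝ) {g : Isom 3} {t : Fin 3}
    (hg : ∀ w, g.linearIsometryEquiv w = w ↔ ∀ s, s ≠ t → w s = 0) [DecidableEq (E 3)] :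
    ∑ᶠ w ∈ frequencies Γ μ, (if g.linearIsometryEquiv w = w then character w (g 0) else 0) =
      axisSum (ℓ t) (g 0 t / ℓ t) μ := by
  rw [finsum_mem_ite, axisSum]
  symm
  have hsq : ∀ x : ℝ, ∑ i, (EuclideanSpace.single t x : E 3) i ^ 2 = x ^ 2 := by
    intro x
    rw [Finset.sum_eq_single t]
    · simp
    · intro s _ hs; simp [hs]
    · simp
  refine finsum_mem_eq_of_bijOn (fun i : ℤ => EuclideanSpace.single t ((i : ℝ) / ℓ t))
    ⟨?_, ?_, ?_⟩ ?_
  · intro i hi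
    refine ⟨(h.mem_frequencies hℓ).2 ⟨⟨Pi.single t i, fun s => ?_⟩, by rw [hsq]; exact hi⟩,
      (hg _).2 fun s hs => by simp [hs]⟩
    by_cases hs : s = t
    · subst hs; simp
    · simp [hs]
  · intro i _ j _ hij
    have h1 := congrArg (fun w : E 3 => w t) hij
    simp only [PiLp.single_apply, if_true] at h1
    rw [div_left_inj' (hℓ t).ne'] at h1
    exact_mod_cast h1
  · rintro w ⟨hw, hfix⟩
    obtain ⟨⟨m, hm⟩, hμ⟩ := (h.mem_frequencies hℓ).1 hw
    have hwt : EuclideanSpace.single t ((m t : ℝ) / ℓ t) = w := by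
      ext s
      by_cases hs : s = t
      · subst hs; simp [hm]
      · simp [hs, (hg w).1 hfix s hs]
    refine ⟨m t, ?_, hwt⟩
    rw [← hwt, hsq] at hμ
    exact hμ
  · intro i _
    rw [character]
    congr 3
    rw [EuclideanSpace.inner_single_left]
    simp
    ring

lemma HasBoxLattice.finsum_one {Γ : Subgroup (Isom 3)} {ℓ : Fin 3 → ℝ}
    (h : HasBoxLattice Γ ℓ) (hℓ : ∀ i, 0 < ℓ i) (μ : ℝ) [DecidableEq (E 3)] :
    ∑ᶠ w ∈ frequencies Γ μ, (if (1 : Isom 3).linearIsometryEquiv w = w then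
      character w ((1 : Isom 3) 0) else 0) = boxCount ℓ μ := by
  have h1 : frequencies Γ μ = {w : E 3 | (∃ m : Fin 3 → ℤ, ∀ i, w i = m i / ℓ i) ∧
      4 * Real.pi ^ 2 * ∑ i, w i ^ 2 = μ} := by
    ext w
    exact h.mem_frequencies hℓ
  rw [boxCount, ← h1]
  refine finsum_mem_congr rfl fun w _ => ?_
  rw [if_pos (show (1 : Isom 3).linearIsometryEquiv w = w from rfl)]
  exact character_zero_right w

lemma mem_translationLattice_of_single {Γ : Subgroup (Isom 3)} {ℓ : Fin 3 → ℝ}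
    (h : ∀ i, (EuclideanSpace.single i (ℓ i) : E 3) ∈ translationLattice Γ) {v : E 3}
    {k : Fin 3 → ℤ} (hv : ∀ i, v i = k i * ℓ i) : v ∈ translationLattice Γ := by
  have h1 : v = ∑ i, k i • (EuclideanSpace.single i (ℓ i) : E 3) := by
    ext i
    simp [hv, Finset.sum_apply, Pi.single_apply]
  rw [h1]
  exact Submodule.sum_mem _ fun i _ => Submodule.smul_mem _ _ (h i)

theorem card_mul_finrank_laplaceEigenspace {n : ℕ} {Γ : Subgroup (Isom n)}
    (hΓ : IsFlatManifoldGroup Γ) {H : Type*} [Fintype H] [Nonempty H] {rep : H → Isom n}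
    (hrep : HolonomyReps Γ rep) (μ : ℝ) [DecidableEq (E n)] :
    (Fintype.card H : ℂ) * (Module.finrank ℂ (laplaceEigenspace Γ μ) : ℂ) =
      ∑ η, ∑ᶠ w ∈ frequencies Γ μ,
        if (rep η).linearIsometryEquiv w = w then character w (rep η 0) else 0 := by
  rw [finrank_laplaceEigenspace hΓ hrep μ, mul_inv_cancel_left₀ (by simp)]
  exact Finset.sum_congr rfl fun η _ =>
    (finsum_mem_eq_finite_toFinset_sum _ (hΓ.finite_frequencies μ)).symm

lemma finite_axis {p : ℝ} (hp : 0 < p) (μ : ℝ) :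
    {i : ℤ | 4 * Real.pi ^ 2 * ((i : ℝ) / p) ^ 2 = μ}.Finite := by
  by_cases h : ∃ i₀ : ℤ, 4 * Real.pi ^ 2 * ((i₀ : ℝ) / p) ^ 2 = μ
  · obtain ⟨i₀, hi₀⟩ := h
    refine (Set.toFinite {i₀, -i₀}).subset fun i hi => ?_
    have h1 : ((i : ℝ) / p) ^ 2 = ((i₀ : ℝ) / p) ^ 2 :=
      mul_left_cancel₀ (by positivity) (hi.trans hi₀.symm)
    rw [div_pow, div_pow, div_left_inj' (by positivity)] at h1
    have h2 : i ^ 2 = i₀ ^ 2 := by exact_mod_cast h1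
    rcases sq_eq_sq_iff_eq_or_eq_neg.1 h2 with h3 | h3 <;> simp [h3]
  · convert Set.finite_empty
    ext i
    simp only [Set.mem_ofPred_eq, Set.mem_empty_iff_false, iff_false]
    exact fun hi => h ⟨i, hi⟩

/-- At odd `i` the phases `i/4` and `3i/4` differ by a half-turn and cancel. At `i = 2k` both give
`(-1)^k`, and `2k / (2p) = k / p`. -/
theorem axisSum_quarter_add {p : ℝ} (hp : 0 < p) (μ : ℝ) :
    axisSum (2 * p) (1 / 4) μ + axisSum (2 * p) (3 / 4) μ = 2 * axisSum p (1 / 2) μ := by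
  have hfin := finite_axis (p := 2 * p) (by positivity) μ
  rw [axisSum, axisSum, ← finsum_mem_add_distrib hfin, axisSum, mul_finsum_mem]
  set F : ℤ → ℂ := fun i => Complex.exp (2 * Real.pi * Complex.I * ((i * (1 / 4) : ℝ) : ℂ)) +
    Complex.exp (2 * Real.pi * Complex.I * ((i * (3 / 4) : ℝ) : ℂ)) with hF
  have hodd : ∀ i : ℤ, Odd i → F i = 0 := by
    rintro i ⟨k, rfl⟩
    have h1 : Complex.exp (2 * Real.pi * Complex.I * (((2 * k + 1 : ℤ) * (3 / 4) : ℝ) : ℂ)) =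
        -Complex.exp (2 * Real.pi * Complex.I * (((2 * k + 1 : ℤ) * (1 / 4) : ℝ) : ℂ)) := by
      rw [show (2 * Real.pi * Complex.I * (((2 * k + 1 : ℤ) * (3 / 4) : ℝ) : ℂ)) =
        2 * Real.pi * Complex.I * (((2 * k + 1 : ℤ) * (1 / 4) : ℝ) : ℂ) +
          (Real.pi * Complex.I + k * (2 * Real.pi * Complex.I)) by push_cast; ring,
        Complex.exp_add, Complex.exp_add, Complex.exp_int_mul_two_pi_mul_I, Complex.exp_pi_mul_I]
      ring
    simp only [F]
    rw [h1, add_neg_cancel]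
  have heven : ∀ k : ℤ, F (2 * k) =
      2 * Complex.exp (2 * Real.pi * Complex.I * ((k * (1 / 2) : ℝ) : ℂ)) := by
    intro k
    simp only [F]
    rw [show (2 * Real.pi * Complex.I * (((2 * k : ℤ) * (3 / 4) : ℝ) : ℂ)) =
      2 * Real.pi * Complex.I * ((k * (1 / 2) : ℝ) : ℂ) +
          k * (2 * Real.pi * Complex.I) by push_cast; ring,
      Complex.exp_add, Complex.exp_int_mul_two_pi_mul_I,
      show (((2 * k : ℤ) * (1 / 4) : ℝ) : ℂ) = ((k * (1 / 2) : ℝ) : ℂ) by push_cast; ring]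
    ring
  have hcond : ∀ k : ℤ, 4 * Real.pi ^ 2 * (((2 * k : ℤ) : ℝ) / (2 * p)) ^ 2 = μ ↔
      4 * Real.pi ^ 2 * ((k : ℝ) / p) ^ 2 = μ := by
    intro k
    rw [show ((2 * k : ℤ) : ℝ) / (2 * p) = (k : ℝ) / p by
      push_cast; rw [mul_div_mul_left _ _ two_ne_zero]]
  have h2 : ∑ᶠ i ∈ {i : ℤ | 4 * Real.pi ^ 2 * ((i : ℝ) / (2 * p)) ^ 2 = μ}, F i =
      ∑ᶠ i ∈ {i : ℤ | 4 * Real.pi ^ 2 * ((i : ℝ) / (2 * p)) ^ 2 = μ ∧ Even i}, F i := by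
    refine finsum_mem_inter_support_eq _ _ _ ?_
    ext i
    constructor
    · rintro ⟨h3, h4⟩
      refine ⟨⟨h3, ?_⟩, h4⟩
      by_contra h5
      exact h4 (hodd i (Int.not_even_iff_odd.1 h5))
    · rintro ⟨⟨h3, -⟩, h4⟩
      exact ⟨h3, h4⟩
  rw [h2]
  symm
  refine finsum_mem_eq_of_bijOn (fun k : ℤ => 2 * k) ⟨?_, ?_, ?_⟩ fun k _ => (heven k).symm
  · intro k hk
    exact ⟨(hcond k).2 hk, even_two_mul k⟩
  · intro k _ l _ hkl
    have : 2 * k = 2 * l := hkl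
    omega
  · rintro i ⟨hi, k, hk⟩
    refine ⟨k, ?_, by simp only; omega⟩
    rw [show i = 2 * k by omega] at hi
    exact (hcond k).1 hi

end BoxLattice

/-! ### The space group and spectrum of a didicosm -/

section Didicosm

lemma motion_apply (b : E 3) (L : E 3 ≃ₗᵢ[ℝ] E 3) (x : E 3) : motion b L x = b + L x := rfl

lemma linearIsometryEquiv_motion (b : E 3) (L : E 3 ≃ₗᵢ[ℝ] E 3) :
    (motion b L).linearIsometryEquiv = L := by
  ext1 v
  have h := isom_apply (motion b L) v
  rw [motion_apply, motion_apply, map_zero, add_zero, add_comm b] at h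
  exact (add_right_cancel h).symm

lemma halfTurnX_apply (x : E 3) : halfTurnX x = !₂[x 0, -x 1, -x 2] := rfl
lemma halfTurnY_apply (x : E 3) : halfTurnY x = !₂[-x 0, x 1, -x 2] := rfl
lemma halfTurnZ_apply (x : E 3) : halfTurnZ x = !₂[-x 0, -x 1, x 2] := rfl
lemma quarterTurnZ_apply (x : E 3) : quarterTurnZ x = !₂[-x 1, x 0, x 2] := rfl

/-- The signs `e` and the shifts `i`, `j`, `k`, in units of the screw vectors, that occur
in the space group of a didicosm. -/
def DidiType (i j k e₁ e₂ e₃ : ℤ) : Prop :=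
  (i % 2 = 0 ∧ j % 2 = 0 ∧ k % 2 = 0 ∧ e₁ = 1 ∧ e₂ = 1 ∧ e₃ = 1) ∨
  (i % 2 = 1 ∧ j % 2 = 1 ∧ k % 2 = 0 ∧ e₁ = 1 ∧ e₂ = -1 ∧ e₃ = -1) ∨
  (i % 2 = 0 ∧ j % 2 = 1 ∧ k % 2 = 1 ∧ e₁ = -1 ∧ e₂ = 1 ∧ e₃ = -1) ∨
  (i % 2 = 1 ∧ j % 2 = 0 ∧ k % 2 = 1 ∧ e₁ = -1 ∧ e₂ = -1 ∧ e₃ = 1)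

lemma DidiType.mul {i j k e₁ e₂ e₃ i' j' k' e₁' e₂' e₃' : ℤ} (h : DidiType i j k e₁ e₂ e₃)
    (h' : DidiType i' j' k' e₁' e₂' e₃') : DidiType (e₁ * i' + i) (e₂ * j' + j) (e₃ * k' + k)
      (e₁ * e₁') (e₂ * e₂') (e₃ * e₃') := by
  unfold DidiType
  rcases h with ⟨h1, h2, h3, rfl, rfl, rfl⟩ | ⟨h1, h2, h3, rfl, rfl, rfl⟩ |
    ⟨h1, h2, h3, rfl, rfl, rfl⟩ | ⟨h1, h2, h3, rfl, rfl, rfl⟩ <;>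
  rcases h' with ⟨h1', h2', h3', rfl, rfl, rfl⟩ | ⟨h1', h2', h3', rfl, rfl, rfl⟩ |
    ⟨h1', h2', h3', rfl, rfl, rfl⟩ | ⟨h1', h2', h3', rfl, rfl, rfl⟩ <;>
  norm_num <;> omega

lemma DidiType.inv {i j k e₁ e₂ e₃ : ℤ} (h : DidiType i j k e₁ e₂ e₃) :
    DidiType (-(e₁ * i)) (-(e₂ * j)) (-(e₃ * k)) e₁ e₂ e₃ := by
  unfold DidiType at *
  rcases h with ⟨h1, h2, h3, rfl, rfl, rfl⟩ | ⟨h1, h2, h3, rfl, rfl, rfl⟩ |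
    ⟨h1, h2, h3, rfl, rfl, rfl⟩ | ⟨h1, h2, h3, rfl, rfl, rfl⟩ <;> omega

lemma DidiType.sq {i j k e₁ e₂ e₃ : ℤ} (h : DidiType i j k e₁ e₂ e₃) :
    (e₁ : ℝ) * e₁ = 1 ∧ (e₂ : ℝ) * e₂ = 1 ∧ (e₃ : ℝ) * e₃ = 1 := by
  rcases h with ⟨-, -, -, rfl, rfl, rfl⟩ | ⟨-, -, -, rfl, rfl, rfl⟩ |
    ⟨-, -, -, rfl, rfl, rfl⟩ | ⟨-, -, -, rfl, rfl, rfl⟩ <;> norm_num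

/-- The isometry `g` acts diagonally with the given signs and shifts. -/
def IsDiagMotion (a b c : ℝ) (i j k e₁ e₂ e₃ : ℤ) (g : Isom 3) : Prop :=
  ∀ x : E 3, g x 0 = e₁ * x 0 + i * a ∧ g x 1 = e₂ * x 1 + j * b ∧ g x 2 = e₃ * x 2 + k * c

lemma didicosm_generatorX (A B C : ℝ) :
    IsDiagMotion √A √B √C 1 1 0 1 (-1) (-1) (motion !₂[√A, √B, 0] halfTurnX) := by
  intro x
  simp [motion_apply, halfTurnX_apply, add_comm]

lemma didicosm_generatorY (A B C : ℝ) :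
    IsDiagMotion √A √B √C 0 1 1 (-1) 1 (-1) (motion !₂[0, √B, √C] halfTurnY) := by
  intro x
  simp [motion_apply, halfTurnY_apply, add_comm]

lemma didicosm_generatorZ (A B C : ℝ) :
    IsDiagMotion √A √B √C 1 0 1 (-1) (-1) 1 (motion !₂[√A, 0, √C] halfTurnZ) := by
  intro x
  simp [motion_apply, halfTurnZ_apply, add_comm]

lemma didicosm_memX (A B C : ℝ) : motion !₂[√A, √B, 0] halfTurnX ∈ didicosm A B C :=
  Subgroup.subset_closure (by simp)

lemma didicosm_memY (A B C : ℝ) : motion !₂[0, √B, √C] halfTurnY ∈ didicosm A B C :=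
  Subgroup.subset_closure (by simp)

lemma didicosm_memZ (A B C : ℝ) : motion !₂[√A, 0, √C] halfTurnZ ∈ didicosm A B C :=
  Subgroup.subset_closure (by simp)

theorem exists_didiType {A B C : ℝ} {g : Isom 3} (hg : g ∈ didicosm A B C) :
    ∃ i j k e₁ e₂ e₃, DidiType i j k e₁ e₂ e₃ ∧ IsDiagMotion √A √B √C i j k e₁ e₂ e₃ g := by
  induction hg using Subgroup.closure_induction with
  | mem g hg =>
    rcases hg with rfl | rfl | rfl
    · exact ⟨_, _, _, _, _, _, by simp [DidiType], didicosm_generatorX A B C⟩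
    · exact ⟨_, _, _, _, _, _, by simp [DidiType], didicosm_generatorY A B C⟩
    · exact ⟨_, _, _, _, _, _, by simp [DidiType], didicosm_generatorZ A B C⟩
  | one => exact ⟨0, 0, 0, 1, 1, 1, by simp [DidiType], fun x => by simp⟩
  | mul g h _ _ ihg ihh =>
    obtain ⟨i, j, k, e₁, e₂, e₃, ht, hd⟩ := ihg
    obtain ⟨i', j', k', e₁', e₂', e₃', ht', hd'⟩ := ihh
    refine ⟨_, _, _, _, _, _, ht.mul ht', fun x => ?_⟩
    obtain ⟨h1, h2, h3⟩ := hd (h x)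
    obtain ⟨h1', h2', h3'⟩ := hd' x
    rw [AffineIsometryEquiv.coe_mul, Function.comp_apply, h1, h2, h3, h1', h2', h3']
    push_cast
    refine ⟨by ring, by ring, by ring⟩
  | inv g _ ih =>
    obtain ⟨i, j, k, e₁, e₂, e₃, ht, hd⟩ := ih
    refine ⟨_, _, _, _, _, _, ht.inv, fun x => ?_⟩
    obtain ⟨h1, h2, h3⟩ := hd (g⁻¹ x)
    obtain ⟨s1, s2, s3⟩ := ht.sq
    rw [show g (g⁻¹ x) = x from g.apply_symm_apply x] at h1 h2 h3
    rw [h1, h2, h3]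
    push_cast
    refine ⟨?_, ?_, ?_⟩
    · linear_combination (-(g⁻¹ x) 0) * s1
    · linear_combination (-(g⁻¹ x) 1) * s2
    · linear_combination (-(g⁻¹ x) 2) * s3

lemma single_mem_translationLattice_didicosm (A B C : ℝ) (t : Fin 3) :
    EuclideanSpace.single t ((![2 * √A, 2 * √B, 2 * √C] : Fin 3 → ℝ) t) ∈
      translationLattice (didicosm A B C) := by
  have key : ∀ {g : Isom 3} {v : E 3}, g ∈ didicosm A B C → (∀ x, g (g x) = v + x) →
      v ∈ translationLattice (didicosm A B C) := by
    intro g v hg h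
    have h1 : translation v = g * g := by
      ext1 x
      exact (h x).symm
    rw [mem_translationLattice, h1]
    exact mul_mem hg hg
  fin_cases t
  · refine key (didicosm_memX A B C) fun x => ?_
    ext s
    fin_cases s <;> simp [motion_apply, halfTurnX_apply, two_mul, add_assoc]
  · refine key (didicosm_memY A B C) fun x => ?_
    ext s
    fin_cases s <;> simp [motion_apply, halfTurnY_apply, two_mul, add_assoc]
  · refine key (didicosm_memZ A B C) fun x => ?_
    ext s
    fin_cases s <;> simp [motion_apply, halfTurnZ_apply, two_mul, add_assoc]

/-- Within each row of `DidiType` the shifts vary by even integers, that is, by lattice translations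
applied after the identity or a generator. -/
theorem exists_mem_didicosm (A B C : ℝ) {i j k e₁ e₂ e₃ : ℤ} (h : DidiType i j k e₁ e₂ e₃) :
    ∃ g ∈ didicosm A B C, IsDiagMotion √A √B √C i j k e₁ e₂ e₃ g := by
  have key : ∀ {i' j' k' : ℤ} {g : Isom 3}, g ∈ didicosm A B C →
      IsDiagMotion √A √B √C i' j' k' e₁ e₂ e₃ g → (i - i') % 2 = 0 → (j - j') % 2 = 0 →
      (k - k') % 2 = 0 → ∃ g ∈ didicosm A B C, IsDiagMotion √A √B √C i j k e₁ e₂ e₃ g := by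
    intro i' j' k' g hg hd hi hj hk
    obtain ⟨i₁, hi₁⟩ := Int.dvd_of_emod_eq_zero hi
    obtain ⟨j₁, hj₁⟩ := Int.dvd_of_emod_eq_zero hj
    obtain ⟨k₁, hk₁⟩ := Int.dvd_of_emod_eq_zero hk
    obtain rfl : i = 2 * i₁ + i' := by omega
    obtain rfl : j = 2 * j₁ + j' := by omega
    obtain rfl : k = 2 * k₁ + k' := by omega
    have hv := mem_translationLattice_of_single (single_mem_translationLattice_didicosm A B C)
      (v := !₂[2 * i₁ * √A, 2 * j₁ * √B, 2 * k₁ * √C]) (k := ![i₁, j₁, k₁]) (fun s => by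
        fin_cases s <;> simp <;> ring)
    refine ⟨_, mul_mem (mem_translationLattice.1 hv) hg, fun x => ?_⟩
    obtain ⟨h1, h2, h3⟩ := hd x
    rw [AffineIsometryEquiv.coe_mul, Function.comp_apply, translation_apply]
    simp only [PiLp.add_apply, h1, h2, h3]
    push_cast
    refine ⟨?_, ?_, ?_⟩ <;> ring
  rcases h with ⟨h1, h2, h3, rfl, rfl, rfl⟩ | ⟨h1, h2, h3, rfl, rfl, rfl⟩ |
    ⟨h1, h2, h3, rfl, rfl, rfl⟩ | ⟨h1, h2, h3, rfl, rfl, rfl⟩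
  · exact key (i' := 0) (j' := 0) (k' := 0) (one_mem _) (fun x => by simp) (by omega) (by omega)
      (by omega)
  · exact key (didicosm_memX A B C) (didicosm_generatorX A B C) (by omega) (by omega) (by omega)
  · exact key (didicosm_memY A B C) (didicosm_generatorY A B C) (by omega) (by omega) (by omega)
  · exact key (didicosm_memZ A B C) (didicosm_generatorZ A B C) (by omega) (by omega) (by omega)

theorem hasBoxLattice_didicosm (A B C : ℝ) :
    HasBoxLattice (didicosm A B C) ![2 * √A, 2 * √B, 2 * √C] := by
  intro v
  constructor
  · intro hv
    obtain ⟨i, j, k, e₁, e₂, e₃, ht, hd⟩ := exists_didiType (mem_translationLattice.1 hv)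
    have h0 := hd 0
    -- Comparing with the value at the origin forces all signs to be `1`, and then the parities are
    -- even.
    have h1 := hd !₂[1, 1, 1]
    simp only [translation_apply, PiLp.add_apply] at h0 h1
    simp at h0 h1
    obtain ⟨h01, h02, h03⟩ := h0
    obtain ⟨h11, h12, h13⟩ := h1
    have e1 : (e₁ : ℝ) = 1 := by linarith
    have e2 : (e₂ : ℝ) = 1 := by linarith
    have e3 : (e₃ : ℝ) = 1 := by linarith
    obtain rfl : e₁ = 1 := by exact_mod_cast e1
    obtain rfl : e₂ = 1 := by exact_mod_cast e2
    obtain rfl : e₃ = 1 := by exact_mod_cast e3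
    obtain ⟨i₁, rfl⟩ : ∃ i₁, i = 2 * i₁ := ⟨i / 2, by unfold DidiType at ht; omega⟩
    obtain ⟨j₁, rfl⟩ : ∃ j₁, j = 2 * j₁ := ⟨j / 2, by unfold DidiType at ht; omega⟩
    obtain ⟨k₁, rfl⟩ : ∃ k₁, k = 2 * k₁ := ⟨k / 2, by unfold DidiType at ht; omega⟩
    refine ⟨![i₁, j₁, k₁], fun s => ?_⟩
    push_cast at h01 h02 h03
    fin_cases s <;> simp [h01, h02, h03] <;> ring
  · rintro ⟨k, hk⟩
    exact mem_translationLattice_of_single (single_mem_translationLattice_didicosm A B C) hk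

lemma int_mul_eq_zero {i : ℤ} {a : ℝ} (ha : 0 < a) (h : i * a = 0) : i = 0 := by
  exact_mod_cast (mul_eq_zero.1 h).resolve_right ha.ne'

lemma two_sqrt_pos {A B C : ℝ} (hA : 0 < A) (hB : 0 < B) (hC : 0 < C) (i : Fin 3) :
    0 < (![2 * √A, 2 * √B, 2 * √C] : Fin 3 → ℝ) i := by
  fin_cases i <;> simpa

theorem isFlatManifoldGroup_didicosm {A B C : ℝ} (hA : 0 < A) (hB : 0 < B) (hC : 0 < C) :
    IsFlatManifoldGroup (didicosm A B C) := by
  refine (hasBoxLattice_didicosm A B C).isFlatManifoldGroup (two_sqrt_pos hA hB hC)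
    fun g hg x hx => ?_
  obtain ⟨i, j, k, e₁, e₂, e₃, ht, hd⟩ := exists_didiType hg
  obtain ⟨h1, h2, h3⟩ := hd x
  rw [hx] at h1 h2 h3
  rcases ht with ⟨hi, hj, hk, rfl, rfl, rfl⟩ | ⟨hi, hj, hk, rfl, rfl, rfl⟩ |
    ⟨hi, hj, hk, rfl, rfl, rfl⟩ | ⟨hi, hj, hk, rfl, rfl, rfl⟩
  · obtain rfl := int_mul_eq_zero (i := i) (Real.sqrt_pos.2 hA) (by push_cast at h1; linarith)
    obtain rfl := int_mul_eq_zero (i := j) (Real.sqrt_pos.2 hB) (by push_cast at h2; linarith)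
    obtain rfl := int_mul_eq_zero (i := k) (Real.sqrt_pos.2 hC) (by push_cast at h3; linarith)
    ext y s
    obtain ⟨h1, h2, h3⟩ := hd y
    fin_cases s <;> simp [h1, h2, h3]
  -- A half-turn type has an odd shift along its own axis, where a fixed point would need shift
  -- zero.
  · have := int_mul_eq_zero (i := i) (Real.sqrt_pos.2 hA) (by push_cast at h1; linarith)
    omega
  · have := int_mul_eq_zero (i := j) (Real.sqrt_pos.2 hB) (by push_cast at h2; linarith)
    omega
  · have := int_mul_eq_zero (i := k) (Real.sqrt_pos.2 hC) (by push_cast at h3; linarith)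
    omega

/-- Representatives of the holonomy group of a didicosm. -/
def didiRep (A B C : ℝ) : Fin 4 → Isom 3 :=
  ![1, motion !₂[√A, √B, 0] halfTurnX, motion !₂[0, √B, √C] halfTurnY,
    motion !₂[√A, 0, √C] halfTurnZ]

lemma IsDiagMotion.linearIsometryEquiv_apply {a b c : ℝ} {i j k e₁ e₂ e₃ : ℤ} {g : Isom 3}
    (h : IsDiagMotion a b c i j k e₁ e₂ e₃ g) (v : E 3) :
    g.linearIsometryEquiv v = !₂[e₁ * v 0, e₂ * v 1, e₃ * v 2] := by
  have h1 := isom_apply g v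
  obtain ⟨h01, h02, h03⟩ := h 0
  obtain ⟨h11, h12, h13⟩ := h v
  rw [← sub_eq_iff_eq_add] at h1
  rw [← h1]
  ext s
  fin_cases s <;> simp [h01, h02, h03, h11, h12, h13]

lemma holonomyReps_didicosm (A B C : ℝ) : HolonomyReps (didicosm A B C) (didiRep A B C) where
  mem η := by
    fin_cases η
    exacts [one_mem _, didicosm_memX A B C, didicosm_memY A B C, didicosm_memZ A B C]
  exists_eq g hg := by
    obtain ⟨i, j, k, e₁, e₂, e₃, ht, hd⟩ := exists_didiType hg
    have hg := hd.linearIsometryEquiv_apply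
    rcases ht with ⟨-, -, -, rfl, rfl, rfl⟩ | ⟨-, -, -, rfl, rfl, rfl⟩ |
      ⟨-, -, -, rfl, rfl, rfl⟩ | ⟨-, -, -, rfl, rfl, rfl⟩
    · refine ⟨0, ?_⟩
      ext1 v
      rw [hg]
      ext s
      fin_cases s <;> simp [didiRep] <;> rfl
    · refine ⟨1, ?_⟩
      ext1 v
      rw [hg]
      simp [didiRep, linearIsometryEquiv_motion, halfTurnX_apply]
    · refine ⟨2, ?_⟩
      ext1 v
      rw [hg]
      simp [didiRep, linearIsometryEquiv_motion, halfTurnY_apply]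
    · refine ⟨3, ?_⟩
      ext1 v
      rw [hg]
      simp [didiRep, linearIsometryEquiv_motion, halfTurnZ_apply]
  inj η η' h := by
    have h1 : ∀ η, (didiRep A B C η).linearIsometryEquiv !₂[1, 1, 1] =
      (![!₂[1, 1, 1], !₂[1, -1, -1], !₂[-1, 1, -1], !₂[-1, -1, 1]] : Fin 4 → E 3) η := by
      intro η
      fin_cases η
      · rfl
      · simp [didiRep, linearIsometryEquiv_motion, halfTurnX_apply]
      · simp [didiRep, linearIsometryEquiv_motion, halfTurnY_apply]
      · simp [didiRep, linearIsometryEquiv_motion, halfTurnZ_apply]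
    have h2 := h1 η
    rw [h, h1 η'] at h2
    -- This functional takes the values `3, 1, -1, -3` on the four images, so it separates them.
    have h3 := congrArg (fun w : E 3 => 2 * w 0 + w 1) h2
    clear h h1 h2
    fin_cases η <;> fin_cases η' <;> first | rfl | (exfalso; norm_num at h3)

/-- Each screw motion advances by half of the lattice period along its axis, whence the three phases
`1 / 2`. -/
theorem finrank_didicosm {A B C : ℝ} (hA : 0 < A) (hB : 0 < B) (hC : 0 < C) (μ : ℝ) :
    4 * (Module.finrank ℂ (laplaceEigenspace (didicosm A B C) μ) : ℂ) =
      boxCount ![2 * √A, 2 * √B, 2 * √C] μ + axisSum (2 * √A) (1 / 2) μ +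
        axisSum (2 * √B) (1 / 2) μ + axisSum (2 * √C) (1 / 2) μ := by
  classical
  have h := card_mul_finrank_laplaceEigenspace (isFlatManifoldGroup_didicosm hA hB hC)
    (holonomyReps_didicosm A B C) μ
  have hbox := hasBoxLattice_didicosm A B C
  have hpos := two_sqrt_pos hA hB hC
  have hhalf : ∀ {x : ℝ}, 0 < x → √x / (2 * √x) = 1 / 2 := fun {x} hx => by
    have := (Real.sqrt_pos.2 hx).ne'
    field_simp
  rw [Fin.sum_univ_four, Fintype.card_fin] at h
  have hX := hbox.finsum_axis hpos μ (g := didiRep A B C 1) (t := 0) (fun w => by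
    simp only [didiRep, Matrix.cons_val, linearIsometryEquiv_motion, halfTurnX_apply]
    simp [PiLp.ext_iff, Fin.forall_fin_succ, neg_eq_self])
  have hY := hbox.finsum_axis hpos μ (g := didiRep A B C 2) (t := 1) (fun w => by
    simp only [didiRep, Matrix.cons_val, linearIsometryEquiv_motion, halfTurnY_apply]
    simp [PiLp.ext_iff, Fin.forall_fin_succ, neg_eq_self])
  have hZ := hbox.finsum_axis hpos μ (g := didiRep A B C 3) (t := 2) (fun w => by
    simp only [didiRep, Matrix.cons_val, linearIsometryEquiv_motion, halfTurnZ_apply]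
    simp [PiLp.ext_iff, Fin.forall_fin_succ, neg_eq_self])
  rw [hX, hY, hZ, show didiRep A B C 0 = 1 from rfl, hbox.finsum_one hpos] at h
  simpa [didiRep, motion_apply, halfTurnX_apply, halfTurnY_apply, halfTurnZ_apply, hhalf hA,
    hhalf hB, hhalf hC] using h

end Didicosm

/-! ### The space group of a tetracosm, and isospectrality -/

section Tetracosm

/-- The rotation `p + q i` about the `z`-axis and the shift `k` along the `z`-axis, in units of
the screw vector, that occur in the space group of a tetracosm. -/
def TetraType (k p q : ℤ) : Prop :=
  (k % 4 = 0 ∧ p = 1 ∧ q = 0) ∨ (k % 4 = 1 ∧ p = 0 ∧ q = 1) ∨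
  (k % 4 = 2 ∧ p = -1 ∧ q = 0) ∨ (k % 4 = 3 ∧ p = 0 ∧ q = -1)

lemma TetraType.mul {k p q k' p' q' : ℤ} (h : TetraType k p q) (h' : TetraType k' p' q') :
    TetraType (k + k') (p * p' - q * q') (p * q' + q * p') := by
  unfold TetraType
  rcases h with ⟨h1, rfl, rfl⟩ | ⟨h1, rfl, rfl⟩ | ⟨h1, rfl, rfl⟩ | ⟨h1, rfl, rfl⟩ <;>
  rcases h' with ⟨h1', rfl, rfl⟩ | ⟨h1', rfl, rfl⟩ | ⟨h1', rfl, rfl⟩ | ⟨h1', rfl, rfl⟩ <;>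
  norm_num <;> omega

lemma TetraType.inv {k p q : ℤ} (h : TetraType k p q) : TetraType (-k) p (-q) := by
  unfold TetraType at *
  omega

lemma TetraType.sq_add_sq {k p q : ℤ} (h : TetraType k p q) : (p : ℝ) ^ 2 + (q : ℝ) ^ 2 = 1 := by
  rcases h with ⟨-, rfl, rfl⟩ | ⟨-, rfl, rfl⟩ | ⟨-, rfl, rfl⟩ | ⟨-, rfl, rfl⟩ <;> norm_num

/-- The isometry `g` is a screw motion about an axis parallel to the `z`-axis with the given
rotation and shifts. -/
def IsScrewMotion (a d : ℝ) (i j k p q : ℤ) (g : Isom 3) : Prop :=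
  ∀ x : E 3, g x 0 = p * x 0 - q * x 1 + i * a ∧ g x 1 = q * x 0 + p * x 1 + j * a ∧
    g x 2 = x 2 + k * d

/-- The screw motion of a tetracosm. -/
def tetraScrew (D : ℝ) : Isom 3 := motion !₂[0, 0, √D] quarterTurnZ

lemma tetraScrew_apply (D : ℝ) (x : E 3) :
    tetraScrew D x = !₂[0, 0, √D] + !₂[-x 1, x 0, x 2] := rfl

lemma tetracosm_mem_translationX (D A : ℝ) : translation !₂[√A, 0, 0] ∈ tetracosm D A :=
  Subgroup.subset_closure (by simp)

lemma tetracosm_mem_translationY (D A : ℝ) : translation !₂[0, √A, 0] ∈ tetracosm D A :=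
  Subgroup.subset_closure (by simp)

lemma tetraScrew_mem (D A : ℝ) : tetraScrew D ∈ tetracosm D A :=
  Subgroup.subset_closure (by simp [tetraScrew])

/-- The rotation part is the power of the quarter-turn given by the height shift `k` modulo `4`; the
horizontal shifts stay in the square lattice because the quarter-turn preserves it. -/
theorem exists_tetraType {D A : ℝ} {g : Isom 3} (hg : g ∈ tetracosm D A) :
    ∃ i j k p q, TetraType k p q ∧ IsScrewMotion √A √D i j k p q g := by
  induction hg using Subgroup.closure_induction with
  | mem g hg =>
    rcases hg with rfl | rfl | rfl
    · exact ⟨1, 0, 0, 1, 0, by simp [TetraType], fun x => by simp [add_comm]⟩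
    · exact ⟨0, 1, 0, 1, 0, by simp [TetraType], fun x => by simp [add_comm]⟩
    · exact ⟨0, 0, 1, 0, 1, by simp [TetraType],
        fun x => by simp [motion_apply, quarterTurnZ_apply, add_comm]⟩
  | one => exact ⟨0, 0, 0, 1, 0, by simp [TetraType], fun x => by simp⟩
  | mul g h _ _ ihg ihh =>
    obtain ⟨i, j, k, p, q, ht, hd⟩ := ihg
    obtain ⟨i', j', k', p', q', ht', hd'⟩ := ihh
    refine ⟨p * i' - q * j' + i, q * i' + p * j' + j, _, _, _, ht.mul ht', fun x => ?_⟩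
    obtain ⟨h1, h2, h3⟩ := hd (h x)
    obtain ⟨h1', h2', h3'⟩ := hd' x
    rw [AffineIsometryEquiv.coe_mul, Function.comp_apply, h1, h2, h3, h1', h2', h3']
    push_cast
    refine ⟨by ring, by ring, by ring⟩
  | inv g _ ih =>
    obtain ⟨i, j, k, p, q, ht, hd⟩ := ih
    refine ⟨-(p * i + q * j), q * i - p * j, _, _, _, ht.inv, fun x => ?_⟩
    obtain ⟨h1, h2, h3⟩ := hd (g⁻¹ x)
    have hs := ht.sq_add_sq
    rw [show g (g⁻¹ x) = x from g.apply_symm_apply x] at h1 h2 h3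
    rw [h1, h2, h3]
    push_cast
    refine ⟨?_, ?_, ?_⟩
    · linear_combination (-(g⁻¹ x) 0) * hs
    · linear_combination (-(g⁻¹ x) 1) * hs
    · ring

lemma single_mem_translationLattice_tetracosm (D A : ℝ) (t : Fin 3) :
    EuclideanSpace.single t ((![√A, √A, 4 * √D] : Fin 3 → ℝ) t) ∈
      translationLattice (tetracosm D A) := by
  have key : ∀ {v w : E 3}, translation w ∈ tetracosm D A → w = v →
      v ∈ translationLattice (tetracosm D A) := fun h hw => hw ▸ h
  fin_cases t
  · refine key (tetracosm_mem_translationX D A) ?_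
    ext s
    fin_cases s <;> simp
  · refine key (tetracosm_mem_translationY D A) ?_
    ext s
    fin_cases s <;> simp
  · have h := tetraScrew_mem D A
    rw [mem_translationLattice]
    convert mul_mem (mul_mem h h) (mul_mem h h)
    ext x s
    fin_cases s <;> simp [tetraScrew_apply]
    ring

theorem hasBoxLattice_tetracosm (D A : ℝ) :
    HasBoxLattice (tetracosm D A) ![√A, √A, 4 * √D] := by
  intro v
  constructor
  · intro hv
    obtain ⟨i, j, k, p, q, ht, hd⟩ := exists_tetraType (mem_translationLattice.1 hv)
    have h0 := hd 0
    -- The first coordinate reads off `p = 1`, which forces `k` to be divisible by `4`.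
    have h1 := hd !₂[1, 0, 0]
    simp only [translation_apply, PiLp.add_apply] at h0 h1
    simp at h0 h1
    obtain ⟨h01, h02, h03⟩ := h0
    have e1 : (p : ℝ) = 1 := by linarith
    obtain rfl : p = 1 := by exact_mod_cast e1
    obtain ⟨k₁, rfl⟩ : ∃ k₁, k = 4 * k₁ := ⟨k / 4, by unfold TetraType at ht; omega⟩
    refine ⟨![i, j, k₁], fun s => ?_⟩
    push_cast at h03
    fin_cases s <;> simp [h01, h02, h03]
    ring
  · rintro ⟨k, hk⟩
    exact mem_translationLattice_of_single (single_mem_translationLattice_tetracosm D A) hk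

lemma tetracosm_lengths_pos {D A : ℝ} (hD : 0 < D) (hA : 0 < A) (i : Fin 3) :
    0 < (![√A, √A, 4 * √D] : Fin 3 → ℝ) i := by
  fin_cases i <;> simpa

theorem isFlatManifoldGroup_tetracosm {D A : ℝ} (hD : 0 < D) (hA : 0 < A) :
    IsFlatManifoldGroup (tetracosm D A) := by
  refine (hasBoxLattice_tetracosm D A).isFlatManifoldGroup (tetracosm_lengths_pos hD hA)
    fun g hg x hx => ?_
  obtain ⟨i, j, k, p, q, ht, hd⟩ := exists_tetraType hg
  obtain ⟨h1, h2, h3⟩ := hd x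
  rw [hx] at h1 h2 h3
  obtain rfl := int_mul_eq_zero (i := k) (Real.sqrt_pos.2 hD) (by linarith)
  obtain ⟨rfl, rfl⟩ : p = 1 ∧ q = 0 := by unfold TetraType at ht; omega
  obtain rfl := int_mul_eq_zero (i := i) (Real.sqrt_pos.2 hA) (by push_cast at h1; linarith)
  obtain rfl := int_mul_eq_zero (i := j) (Real.sqrt_pos.2 hA) (by push_cast at h2; linarith)
  ext y s
  obtain ⟨h1, h2, h3⟩ := hd y
  fin_cases s <;> simp [h1, h2, h3]

/-- Representatives of the holonomy group of a tetracosm. -/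
def tetraRep (D : ℝ) : Fin 4 → Isom 3 :=
  ![1, tetraScrew D, tetraScrew D * tetraScrew D, tetraScrew D * tetraScrew D * tetraScrew D]

lemma IsScrewMotion.linearIsometryEquiv_apply {a d : ℝ} {i j k p q : ℤ} {g : Isom 3}
    (h : IsScrewMotion a d i j k p q g) (v : E 3) :
    g.linearIsometryEquiv v = !₂[p * v 0 - q * v 1, q * v 0 + p * v 1, v 2] := by
  have h1 := isom_apply g v
  obtain ⟨h01, h02, h03⟩ := h 0
  obtain ⟨h11, h12, h13⟩ := h v
  rw [← sub_eq_iff_eq_add] at h1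
  rw [← h1]
  ext s
  fin_cases s <;> simp [h01, h02, h03, h11, h12, h13]

lemma linearIsometryEquiv_tetraScrew (D : ℝ) :
    (tetraScrew D).linearIsometryEquiv = quarterTurnZ := linearIsometryEquiv_motion _ _

lemma linearIsometryEquiv_tetraRep (D : ℝ) (η : Fin 4) (v : E 3) :
    (tetraRep D η).linearIsometryEquiv v =
      (![v, !₂[-v 1, v 0, v 2], !₂[-v 0, -v 1, v 2], !₂[v 1, -v 0, v 2]] : Fin 4 → E 3) η := by
  fin_cases η
  · rfl
  all_goals simp [tetraRep, linearIsometryEquiv_mul, linearIsometryEquiv_tetraScrew,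
    quarterTurnZ_apply]

lemma holonomyReps_tetracosm (D A : ℝ) : HolonomyReps (tetracosm D A) (tetraRep D) where
  mem η := by
    have h := tetraScrew_mem D A
    fin_cases η
    exacts [one_mem _, h, mul_mem h h, mul_mem (mul_mem h h) h]
  exists_eq g hg := by
    obtain ⟨i, j, k, p, q, ht, hd⟩ := exists_tetraType hg
    have hg := hd.linearIsometryEquiv_apply
    have key : ∀ η, (∀ v, g.linearIsometryEquiv v = (tetraRep D η).linearIsometryEquiv v) →
      ∃ η, g.linearIsometryEquiv = (tetraRep D η).linearIsometryEquiv :=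
      fun η h => ⟨η, LinearIsometryEquiv.ext h⟩
    rcases ht with ⟨-, rfl, rfl⟩ | ⟨-, rfl, rfl⟩ | ⟨-, rfl, rfl⟩ | ⟨-, rfl, rfl⟩
    · refine key 0 fun v => ?_
      rw [hg, linearIsometryEquiv_tetraRep]
      ext s
      fin_cases s <;> simp
    · refine key 1 fun v => ?_
      rw [hg, linearIsometryEquiv_tetraRep]
      simp
    · refine key 2 fun v => ?_
      rw [hg, linearIsometryEquiv_tetraRep]
      simp
    · refine key 3 fun v => ?_
      rw [hg, linearIsometryEquiv_tetraRep]
      simp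
  inj η η' h := by
    -- The four rotations give this vector the distinct first coordinates `1, -2, -1, 2`.
    have h2 := DFunLike.congr_fun h !₂[1, 2, 0]
    rw [linearIsometryEquiv_tetraRep, linearIsometryEquiv_tetraRep] at h2
    have h3 := congrArg (fun w : E 3 => w 0) h2
    clear h h2
    fin_cases η <;> fin_cases η' <;> first | rfl | (exfalso; norm_num at h3)

theorem finrank_tetracosm {D A : ℝ} (hD : 0 < D) (hA : 0 < A) (μ : ℝ) :
    4 * (Module.finrank ℂ (laplaceEigenspace (tetracosm D A) μ) : ℂ) =
      boxCount ![√A, √A, 4 * √D] μ + axisSum (4 * √D) (1 / 4) μ +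
        axisSum (4 * √D) (1 / 2) μ + axisSum (4 * √D) (3 / 4) μ := by
  classical
  have h := card_mul_finrank_laplaceEigenspace (isFlatManifoldGroup_tetracosm hD hA)
    (holonomyReps_tetracosm D A) μ
  have hbox := hasBoxLattice_tetracosm D A
  have hpos := tetracosm_lengths_pos hD hA
  have h0 := (Real.sqrt_pos.2 hD).ne'
  rw [Fin.sum_univ_four, Fintype.card_fin] at h
  have h1 := hbox.finsum_axis hpos μ (g := tetraRep D 1) (t := 2) (fun w => by
    rw [linearIsometryEquiv_tetraRep]
    simp only [PiLp.ext_iff, Fin.forall_fin_succ]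
    simp
    constructor
    · rintro ⟨h1, h2⟩
      constructor <;> linarith
    · rintro ⟨h1, h2⟩
      simp [h1, h2])
  have h2 := hbox.finsum_axis hpos μ (g := tetraRep D 2) (t := 2) (fun w => by
    rw [linearIsometryEquiv_tetraRep]
    simp [PiLp.ext_iff, Fin.forall_fin_succ, neg_eq_self])
  have h3 := hbox.finsum_axis hpos μ (g := tetraRep D 3) (t := 2) (fun w => by
    rw [linearIsometryEquiv_tetraRep]
    simp only [PiLp.ext_iff, Fin.forall_fin_succ]
    simp
    constructor
    · rintro ⟨h1, h2⟩
      constructor <;> linarith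
    · rintro ⟨h1, h2⟩
      simp [h1, h2])
  have s1 : tetraRep D 1 0 2 / (![√A, √A, 4 * √D] : Fin 3 → ℝ) 2 = 1 / 4 := by
    simp [tetraRep, tetraScrew_apply]
    field_simp
  have s2 : tetraRep D 2 0 2 / (![√A, √A, 4 * √D] : Fin 3 → ℝ) 2 = 1 / 2 := by
    simp [tetraRep, tetraScrew_apply]
    field_simp
    norm_num
  have s3 : tetraRep D 3 0 2 / (![√A, √A, 4 * √D] : Fin 3 → ℝ) 2 = 3 / 4 := by
    simp [tetraRep, tetraScrew_apply]
    field_simp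
    norm_num
  rw [h1, h2, h3, s1, s2, s3, show tetraRep D 0 = 1 from rfl, hbox.finsum_one hpos] at h
  exact h

/-- After `axisSum_quarter_add` only half-turn sums remain on both sides, so a matching of boxes and
of axis periods suffices. -/
theorem isospectral_didicosm_tetracosm {A B C D A' : ℝ} (hA : 0 < A) (hB : 0 < B) (hC : 0 < C)
    (hD : 0 < D) (hA' : 0 < A') (σ : Equiv.Perm (Fin 3))
    (hbox : (![√A', √A', 4 * √D] : Fin 3 → ℝ) ∘ σ = ![2 * √A, 2 * √B, 2 * √C])
    (haxis : ∀ μ, axisSum (2 * √A) (1 / 2) μ + axisSum (2 * √B) (1 / 2) μ +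
      axisSum (2 * √C) (1 / 2) μ =
        axisSum (4 * √D) (1 / 2) μ + 2 * axisSum (2 * √D) (1 / 2) μ) :
    Isospectral (didicosm A B C) (tetracosm D A') := by
  rw [isospectral_iff_finrank (isFlatManifoldGroup_didicosm hA hB hC)
    (isFlatManifoldGroup_tetracosm hD hA')]
  intro μ
  have h1 := finrank_didicosm hA hB hC μ
  have h2 := finrank_tetracosm hD hA' μ
  have h3 := axisSum_quarter_add (p := 2 * √D) (by positivity) μ
  rw [show 2 * (2 * √D) = 4 * √D by ring] at h3
  rw [← hbox, boxCount_comp_perm] at h1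
  have h4 : (4 : ℂ) * (Module.finrank ℂ (laplaceEigenspace (didicosm A B C) μ) : ℂ) =
      4 * (Module.finrank ℂ (laplaceEigenspace (tetracosm D A') μ) : ℂ) := by
    rw [h1, h2]
    linear_combination haxis μ - h3
  exact_mod_cast mul_left_cancel₀ (by norm_num) h4

theorem isospectral_didicosm_tetracosm_scale {D : ℝ} (hD : 0 < D) :
    Isospectral (didicosm D (4 * D) D) (tetracosm D (4 * D)) := by
  have h : √(4 * D) = 2 * √D := by
    rw [Real.sqrt_mul (by norm_num), show (4 : ℝ) = 2 ^ 2 by norm_num,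
      Real.sqrt_sq (by norm_num)]
  -- The boxes are `(2√D, 4√D, 2√D)` and `(2√D, 2√D, 4√D)`; both sides have half-turn axes with
  -- periods `2√D`, `2√D`, `4√D`.
  refine isospectral_didicosm_tetracosm hD (by positivity) hD hD (by positivity)
    (Equiv.swap 1 2) ?_ fun μ => ?_
  · rw [h]
    ext s
    fin_cases s <;> simp [Equiv.swap_apply_def]
    ring
  · rw [h, show 2 * (2 * √D) = 4 * √D by ring]
    ring

theorem isospectral_didi_tetra : Isospectral (didicosm 1 1 (2 ^ 2)) (tetracosm 1 (2 ^ 2)) := by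
  have h : √((2 : ℝ) ^ 2) = 2 := Real.sqrt_sq (by norm_num)
  refine isospectral_didicosm_tetracosm one_pos one_pos (by positivity) one_pos (by positivity)
    (Equiv.refl _) ?_ fun μ => ?_
  · rw [h]
    ext s
    fin_cases s <;> norm_num
  · rw [h, Real.sqrt_one]
    norm_num
    ring

end Tetracosm

/-! ### Closed geodesics as traces of axes -/

section Multiplicity

variable {n : ℕ}

/-- The point set traced out by the projection of a straight line. -/
def lineTrace (Γ : Subgroup (Isom n)) (p v : E n) : Set (FlatQuot Γ) :=
  Set.range fun t : ℝ => proj Γ (p + t • v)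

/-- The length `ℓ` is the displacement of an element of `Γ` along its axis through `p` in the
direction `v`. -/
def IsAxis (Γ : Subgroup (Isom n)) (ℓ : ℝ) (p v : E n) : Prop :=
  ‖v‖ = 1 ∧ ∃ g ∈ Γ, g.linearIsometryEquiv v = v ∧ g p = p + ℓ • v

theorem mem_closedGeodesics_iff {Γ : Subgroup (Isom n)} (hΓ : IsFlatManifoldGroup Γ) {ℓ : ℝ}
    {S : Set (FlatQuot Γ)} : S ∈ closedGeodesics Γ ℓ ↔
      0 < ℓ ∧ ∃ p v, IsAxis Γ ℓ p v ∧ S = lineTrace Γ p v := by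
  constructor
  · rintro ⟨c, hc, rfl⟩
    obtain ⟨hℓ, p, v, hv, hcv, hg⟩ := (isClosedGeodesic_iff hΓ).1 hc
    exact ⟨hℓ, p, v, ⟨hv, hg⟩, congrArg Set.range (funext hcv)⟩
  · rintro ⟨hℓ, p, v, ⟨hv, hg⟩, rfl⟩
    exact ⟨_, (isClosedGeodesic_iff hΓ).2 ⟨hℓ, p, v, hv, fun _ => rfl, hg⟩, rfl⟩

theorem mem_geodesicLengths_iff_isAxis {Γ : Subgroup (Isom n)} (hΓ : IsFlatManifoldGroup Γ)
    {ℓ : ℝ} : ℓ ∈ geodesicLengths Γ ↔ 0 < ℓ ∧ ∃ p v, IsAxis Γ ℓ p v := by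
  rw [mem_geodesicLengths_iff hΓ]
  refine and_congr_right fun _ => ⟨?_, ?_⟩
  · rintro ⟨g, hg, p, v, hv, h⟩
    exact ⟨p, v, hv, g, hg, h⟩
  · rintro ⟨p, v, hv, g, hg, h⟩
    exact ⟨g, hg, p, v, hv, h⟩

/-- The sign `ε` allows the line to be carried onto the other with reversed direction, since traces
forget orientation. -/
lemma lineTrace_eq {Γ : Subgroup (Isom n)} {g : Isom n} (hg : g ∈ Γ) {p v q w : E n} {s ε : ℝ}
    (hε : ε * ε = 1) (hp : g p = q + s • w) (hv : g.linearIsometryEquiv v = ε • w) :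
    lineTrace Γ p v = lineTrace Γ q w := by
  have h : ∀ t : ℝ, proj Γ (p + t • v) = proj Γ (q + (s + t * ε) • w) := fun t =>
    proj_eq_iff.2 ⟨g, hg, by rw [isom_apply_add_smul, hp, hv, add_smul, smul_smul, add_assoc]⟩
  refine Set.Subset.antisymm ?_ ?_
  · rintro _ ⟨t, rfl⟩
    exact ⟨s + t * ε, (h t).symm⟩
  · rintro _ ⟨t, rfl⟩
    refine ⟨(t - s) * ε, ?_⟩
    beta_reduce
    rw [h, mul_assoc, hε, mul_one, add_sub_cancel]

lemma exists_of_lineTrace_eq {Γ : Subgroup (Isom n)} {p v q w : E n}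
    (h : lineTrace Γ p v = lineTrace Γ q w) : ∃ g ∈ Γ, ∃ t : ℝ, g p = q + t • w := by
  have h1 : proj Γ p ∈ lineTrace Γ q w := by
    rw [← h]
    exact ⟨0, by simp⟩
  obtain ⟨t, ht⟩ := h1
  obtain ⟨g, hg, hgp⟩ := proj_eq_iff.1 ht.symm
  exact ⟨g, hg, t, hgp⟩

lemma norm_eq_one_iff (v : E 3) : ‖v‖ = 1 ↔ v 0 ^ 2 + v 1 ^ 2 + v 2 ^ 2 = 1 := by
  rw [← pow_eq_one_iff_of_nonneg (norm_nonneg v) two_ne_zero, EuclideanSpace.real_norm_sq_eq,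
    Fin.sum_univ_three]

lemma one_le_of_sq_eq_int {ℓ : ℝ} (hℓ : 0 < ℓ) {m : ℤ} (h : ℓ ^ 2 = m) : 1 ≤ ℓ := by
  have h1 : (0 : ℝ) < m := h ▸ by positivity
  have h2 : 0 < m := by exact_mod_cast h1
  have h3 : (1 : ℝ) ≤ m := by exact_mod_cast h2
  nlinarith

lemma sqrt_two_sq : √((2 : ℝ) ^ 2) = 2 := Real.sqrt_sq (by norm_num)

end Multiplicity

/-! ### The four shortest closed geodesics of Didi -/

section Didi

/-- The space group of Didi. -/
abbrev didi : Subgroup (Isom 3) := didicosm 1 1 (2 ^ 2)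

lemma isFlatManifoldGroup_didi : IsFlatManifoldGroup didi :=
  isFlatManifoldGroup_didicosm one_pos one_pos (by positivity)

lemma exists_didiType_didi {g : Isom 3} (hg : g ∈ didi) :
    ∃ i j k e₁ e₂ e₃, DidiType i j k e₁ e₂ e₃ ∧ IsDiagMotion 1 1 2 i j k e₁ e₂ e₃ g := by
  have h := exists_didiType hg
  rwa [Real.sqrt_one, sqrt_two_sq] at h

lemma exists_mem_didi {i j k e₁ e₂ e₃ : ℤ} (h : DidiType i j k e₁ e₂ e₃) :
    ∃ g ∈ didi, IsDiagMotion 1 1 2 i j k e₁ e₂ e₃ g := by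
  have h := exists_mem_didicosm 1 1 (2 ^ 2) h
  rwa [Real.sqrt_one, sqrt_two_sq] at h

lemma lineTrace_didi_eq {i j k e₁ e₂ e₃ : ℤ} (h : DidiType i j k e₁ e₂ e₃) {p v q w : E 3}
    {s ε : ℝ} (hε : ε * ε = 1) (hp0 : e₁ * p 0 + i = q 0 + s * w 0)
    (hp1 : e₂ * p 1 + j = q 1 + s * w 1) (hp2 : e₃ * p 2 + k * 2 = q 2 + s * w 2)
    (hv0 : e₁ * v 0 = ε * w 0) (hv1 : e₂ * v 1 = ε * w 1) (hv2 : e₃ * v 2 = ε * w 2) :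
    lineTrace didi p v = lineTrace didi q w := by
  obtain ⟨g, hg, hd⟩ := exists_mem_didi h
  refine lineTrace_eq hg (s := s) hε ?_ ?_
  · obtain ⟨h1, h2, h3⟩ := hd p
    ext t
    fin_cases t <;> simp [h1, h2, h3, hp0, hp1, hp2]
  · rw [hd.linearIsometryEquiv_apply]
    ext t
    fin_cases t <;> simp [hv0, hv1, hv2]

/-- A line parallel to the `x`-axis on Didi. -/
def didiLineX (y : ℝ) : Set (FlatQuot didi) := lineTrace didi !₂[0, y, 0] !₂[1, 0, 0]

/-- A line parallel to the `y`-axis on Didi. -/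
def didiLineY (x : ℝ) : Set (FlatQuot didi) := lineTrace didi !₂[x, 0, 1] !₂[0, 1, 0]

/-- The displacement along the direction gives `ℓ`, and the shifts perpendicular to a half-turn axis
locate it at half of their values. Translations have even shifts and the half-turns about `z`
advance by multiples of `2`, so length `1` can only come from the two middle types. -/
lemma isAxis_didi_cases {ℓ : ℝ} {p v : E 3} (h : IsAxis didi ℓ p v) :
    ∃ i j k : ℤ,
      (i % 2 = 0 ∧ j % 2 = 0 ∧ k % 2 = 0 ∧ ℓ ^ 2 = (i ^ 2 + j ^ 2 + 4 * k ^ 2 : ℤ)) ∨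
      (i % 2 = 1 ∧ j % 2 = 1 ∧ k % 2 = 0 ∧ ℓ ^ 2 = (i ^ 2 : ℤ) ∧ ℓ * v 0 = i ∧ v 1 = 0 ∧ v 2 = 0 ∧
        2 * p 1 = j ∧ p 2 = k) ∨
      (i % 2 = 0 ∧ j % 2 = 1 ∧ k % 2 = 1 ∧ ℓ ^ 2 = (j ^ 2 : ℤ) ∧ ℓ * v 1 = j ∧ v 0 = 0 ∧ v 2 = 0 ∧
        2 * p 0 = i ∧ p 2 = k) ∨
      ℓ ^ 2 = (4 * k ^ 2 : ℤ) := by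
  obtain ⟨hv, g, hg, hgv, hgp⟩ := h
  rw [norm_eq_one_iff] at hv
  obtain ⟨i, j, k, e₁, e₂, e₃, ht, hd⟩ := exists_didiType_didi hg
  rw [hd.linearIsometryEquiv_apply] at hgv
  obtain ⟨h1, h2, h3⟩ := hd p
  have hv0 := congrArg (fun w : E 3 => w 0) hgv
  have hv1 := congrArg (fun w : E 3 => w 1) hgv
  have hv2 := congrArg (fun w : E 3 => w 2) hgv
  rw [hgp] at h1 h2 h3
  simp at hv0 hv1 hv2 h1 h2 h3
  refine ⟨i, j, k, ?_⟩
  rcases ht with ⟨hi, hj, hk, rfl, rfl, rfl⟩ | ⟨hi, hj, hk, rfl, rfl, rfl⟩ |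
    ⟨hi, hj, hk, rfl, rfl, rfl⟩ | ⟨hi, hj, hk, rfl, rfl, rfl⟩ <;> push_cast at *
  · refine Or.inl ⟨hi, hj, hk, ?_⟩
    have a1 : ℓ * v 0 = i := by linarith
    have a2 : ℓ * v 1 = j := by linarith
    have a3 : ℓ * v 2 = k * 2 := by linarith
    rw [← a1, ← a2]
    linear_combination (-ℓ ^ 2) * hv + (ℓ * v 2 + k * 2) * a3
  · have b1 : v 1 = 0 := by linarith
    have b2 : v 2 = 0 := by linarith
    rw [b1] at h2 hv
    rw [b2] at h3 hv
    have a1 : ℓ * v 0 = i := by linarith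
    refine Or.inr (Or.inl ⟨hi, hj, hk, ?_, a1, b1, b2, by linarith, by linarith⟩)
    rw [← a1]
    linear_combination (-ℓ ^ 2) * hv
  · have b1 : v 0 = 0 := by linarith
    have b2 : v 2 = 0 := by linarith
    rw [b1] at h1 hv
    rw [b2] at h3 hv
    have a1 : ℓ * v 1 = j := by linarith
    refine Or.inr (Or.inr (Or.inl ⟨hi, hj, hk, ?_, a1, b1, b2, by linarith, by linarith⟩))
    rw [← a1]
    linear_combination (-ℓ ^ 2) * hv
  · have b1 : v 0 = 0 := by linarith
    have b2 : v 1 = 0 := by linarith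
    rw [b1, b2] at hv
    have a1 : ℓ * v 2 = k * 2 := by linarith
    refine Or.inr (Or.inr (Or.inr ?_))
    linear_combination (-ℓ ^ 2) * hv + (ℓ * v 2 + k * 2) * a1

lemma one_le_of_isAxis_didi {ℓ : ℝ} (hℓ : 0 < ℓ) {p v : E 3} (h : IsAxis didi ℓ p v) : 1 ≤ ℓ := by
  obtain ⟨i, j, k, ⟨-, -, -, h⟩ | ⟨-, -, -, h, -⟩ | ⟨-, -, -, h, -⟩ | h⟩ := isAxis_didi_cases h
  all_goals exact one_le_of_sq_eq_int hℓ h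

lemma lineTrace_didi_of_isAxis {p v : E 3} (h : IsAxis didi 1 p v) :
    lineTrace didi p v ∈
      ({didiLineX (1 / 2), didiLineX (3 / 2), didiLineY 0, didiLineY 1} : Set _) := by
  obtain ⟨i, j, k, ⟨hi, hj, hk, h⟩ | ⟨hi, hj, hk, h, hv0, hv1, hv2, hp1, hp2⟩ |
    ⟨hi, hj, hk, h, hv1, hv0, hv2, hp0, hp2⟩ | h⟩ := isAxis_didi_cases h
  · have h : i ^ 2 + j ^ 2 + 4 * k ^ 2 = 1 := by
      rw [one_pow] at h
      exact_mod_cast h.symm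
    obtain ⟨i, rfl⟩ := Int.dvd_of_emod_eq_zero hi
    obtain ⟨j, rfl⟩ := Int.dvd_of_emod_eq_zero hj
    ring_nf at h
    omega
  · have hε : v 0 * v 0 = 1 := by
      push_cast at h
      rw [← hv0] at h
      linarith
    -- The axis has `y = j/2`, `z = k`, and the lattice has periods `2` and `4` in these directions,
    -- so these residues list the axes parallel to `x` modulo translations.
    obtain hk | hk : k % 4 = 0 ∨ k % 4 = 2 := by omega
    all_goals obtain hj | hj : j % 4 = 1 ∨ j % 4 = 3 := by omega
    all_goals
      obtain ⟨m, hm⟩ : ∃ m, k = 4 * m + k % 4 := ⟨k / 4, by omega⟩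
      rw [hk] at hm
      subst hm
      obtain ⟨r, hr⟩ : ∃ r, j = 4 * r + j % 4 := ⟨j / 4, by omega⟩
      rw [hj] at hr
      subst hr
      push_cast at hp1 hp2
    · left
      refine lineTrace_didi_eq (i := 0) (j := -2 * r) (k := -2 * m) (e₁ := 1) (e₂ := 1) (e₃ := 1)
        (s := p 0) (ε := v 0) (by unfold DidiType; omega) hε ?_ ?_ ?_ ?_ ?_ ?_ <;>
        simp [hv1, hv2] <;> linarith
    · right; left
      refine lineTrace_didi_eq (i := 0) (j := -2 * r) (k := -2 * m) (e₁ := 1) (e₂ := 1) (e₃ := 1)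
        (s := p 0) (ε := v 0) (by unfold DidiType; omega) hε ?_ ?_ ?_ ?_ ?_ ?_ <;>
        simp [hv1, hv2] <;> linarith
    -- An axis at `z ≡ 2` is brought to `z = 0` by a screw motion in the `y`-direction, which also
    -- exchanges `y ≡ 1/2` and `y ≡ 3/2`.
    · right; left
      refine lineTrace_didi_eq (i := 0) (j := -2 * r + 1) (k := 2 * m + 1) (e₁ := -1) (e₂ := 1)
        (e₃ := -1) (s := -p 0) (ε := -v 0) (by unfold DidiType; omega) (by linarith)
        ?_ ?_ ?_ ?_ ?_ ?_ <;>
        simp [hv1, hv2] <;> linarith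
    · left
      refine lineTrace_didi_eq (i := 0) (j := -2 * r - 1) (k := 2 * m + 1) (e₁ := -1) (e₂ := 1)
        (e₃ := -1) (s := -p 0) (ε := -v 0) (by unfold DidiType; omega) (by linarith)
        ?_ ?_ ?_ ?_ ?_ ?_ <;>
        simp [hv1, hv2] <;> linarith
  · have hε : v 1 * v 1 = 1 := by
      push_cast at h
      rw [← hv1] at h
      linarith
    obtain hk | hk : k % 4 = 1 ∨ k % 4 = 3 := by omega
    all_goals obtain hi | hi : i % 4 = 0 ∨ i % 4 = 2 := by omega
    all_goals
      obtain ⟨m, hm⟩ : ∃ m, k = 4 * m + k % 4 := ⟨k / 4, by omega⟩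
      rw [hk] at hm
      subst hm
      obtain ⟨r, hr⟩ : ∃ r, i = 4 * r + i % 4 := ⟨i / 4, by omega⟩
      rw [hi] at hr
      subst hr
      push_cast at hp0 hp2
    · right; right; left
      refine lineTrace_didi_eq (i := -2 * r) (j := 0) (k := -2 * m) (e₁ := 1) (e₂ := 1) (e₃ := 1)
        (s := p 1) (ε := v 1) (by unfold DidiType; omega) hε ?_ ?_ ?_ ?_ ?_ ?_ <;>
        simp [hv0, hv2] <;> linarith
    · right; right; right
      refine lineTrace_didi_eq (i := -2 * r) (j := 0) (k := -2 * m) (e₁ := 1) (e₂ := 1) (e₃ := 1)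
        (s := p 1) (ε := v 1) (by unfold DidiType; omega) hε ?_ ?_ ?_ ?_ ?_ ?_ <;>
        simp [hv0, hv2] <;> linarith
    -- Likewise a screw motion in the `x`-direction brings `z ≡ 3` to `z = 1` and exchanges `x ≡ 0`
    -- and `x ≡ 1`.
    · right; right; right
      refine lineTrace_didi_eq (i := -2 * r + 1) (j := 1) (k := 2 * m + 2) (e₁ := 1) (e₂ := -1)
        (e₃ := -1) (s := -p 1 + 1) (ε := -v 1) (by unfold DidiType; omega) (by linarith)
        ?_ ?_ ?_ ?_ ?_ ?_ <;>
        simp [hv0, hv2] <;> linarith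
    · right; right; left
      refine lineTrace_didi_eq (i := -2 * r - 1) (j := 1) (k := 2 * m + 2) (e₁ := 1) (e₂ := -1)
        (e₃ := -1) (s := -p 1 + 1) (ε := -v 1) (by unfold DidiType; omega) (by linarith)
        ?_ ?_ ?_ ?_ ?_ ?_ <;>
        simp [hv0, hv2] <;> linarith
  · have h : 4 * k ^ 2 = 1 := by
      rw [one_pow] at h
      exact_mod_cast h.symm
    omega

lemma isAxis_didi {i j k e₁ e₂ e₃ : ℤ} (h : DidiType i j k e₁ e₂ e₃) {p v : E 3}
    (hv : v 0 ^ 2 + v 1 ^ 2 + v 2 ^ 2 = 1) (hp0 : e₁ * p 0 + i = p 0 + v 0)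
    (hp1 : e₂ * p 1 + j = p 1 + v 1) (hp2 : e₃ * p 2 + k * 2 = p 2 + v 2)
    (hv0 : e₁ * v 0 = v 0) (hv1 : e₂ * v 1 = v 1) (hv2 : e₃ * v 2 = v 2) :
    IsAxis didi 1 p v := by
  obtain ⟨g, hg, hd⟩ := exists_mem_didi h
  refine ⟨(norm_eq_one_iff v).2 hv, g, hg, ?_, ?_⟩
  · rw [hd.linearIsometryEquiv_apply]
    ext t
    fin_cases t <;> simp [hv0, hv1, hv2]
  · obtain ⟨h1, h2, h3⟩ := hd p
    ext t
    fin_cases t <;> simp [h1, h2, h3, hp0, hp1, hp2]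

theorem closedGeodesics_didi : closedGeodesics didi 1 =
    {didiLineX (1 / 2), didiLineX (3 / 2), didiLineY 0, didiLineY 1} := by
  ext S
  rw [mem_closedGeodesics_iff isFlatManifoldGroup_didi]
  constructor
  · rintro ⟨-, p, v, h, rfl⟩
    exact lineTrace_didi_of_isAxis h
  · rintro (rfl | rfl | rfl | rfl)
    -- The perpendicular shift is twice the axis coordinate: `j = 1, 3` for `y = 1/2, 3/2`, and
    -- below `i = 0, 2` for `x = 0, 1`.
    · refine ⟨one_pos, _, _, isAxis_didi (i := 1) (j := 1) (k := 0) (e₁ := 1) (e₂ := -1)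
        (e₃ := -1) (by simp [DidiType]) ?_ ?_ ?_ ?_ ?_ ?_ ?_, rfl⟩ <;>
        (simp; try norm_num)
    · refine ⟨one_pos, _, _, isAxis_didi (i := 1) (j := 3) (k := 0) (e₁ := 1) (e₂ := -1)
        (e₃ := -1) (by simp [DidiType]) ?_ ?_ ?_ ?_ ?_ ?_ ?_, rfl⟩ <;>
        (simp; try norm_num)
    · refine ⟨one_pos, _, _, isAxis_didi (i := 0) (j := 1) (k := 1) (e₁ := -1) (e₂ := 1)
        (e₃ := -1) (by simp [DidiType]) ?_ ?_ ?_ ?_ ?_ ?_ ?_, rfl⟩ <;>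
        (simp; try norm_num)
    · refine ⟨one_pos, _, _, isAxis_didi (i := 2) (j := 1) (k := 1) (e₁ := -1) (e₂ := 1)
        (e₃ := -1) (by simp [DidiType]) ?_ ?_ ?_ ?_ ?_ ?_ ?_, rfl⟩ <;>
        (simp; try norm_num)

/-- An element carrying one line to the other has `k = 0` and `e₂ + 2j = 3`. For even `k` either `e₂
= 1` with `j` even or `e₂ = -1` with `j` odd, so `e₂ + 2j ≡ 1` modulo `4`. -/
lemma didiLineX_ne : didiLineX (1 / 2) ≠ didiLineX (3 / 2) := by
  intro h
  obtain ⟨g, hg, t, hgt⟩ := exists_of_lineTrace_eq h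
  obtain ⟨i, j, k, e₁, e₂, e₃, ht, hd⟩ := exists_didiType_didi hg
  obtain ⟨-, h2, h3⟩ := hd !₂[0, 1 / 2, 0]
  rw [hgt] at h2 h3
  simp at h2 h3
  have h2' : ((3 : ℤ) : ℝ) = ((e₂ + 2 * j : ℤ) : ℝ) := by push_cast; linarith
  have h2'' := Int.cast_injective h2'
  unfold DidiType at ht
  omega

/-- Here `i = 1` is odd, which forces `e₃ + 2k ≡ 3` modulo `4`, while the `z`-coordinate demands `e₃
+ 2k = 1`. -/
lemma didiLineY_ne : didiLineY 0 ≠ didiLineY 1 := by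
  intro h
  obtain ⟨g, hg, t, hgt⟩ := exists_of_lineTrace_eq h
  obtain ⟨i, j, k, e₁, e₂, e₃, ht, hd⟩ := exists_didiType_didi hg
  obtain ⟨h1, -, h3⟩ := hd !₂[0, 0, 1]
  rw [hgt] at h1 h3
  simp at h1 h3
  have h1' : ((1 : ℤ) : ℝ) = (i : ℝ) := by push_cast; linarith
  have h3' : ((1 : ℤ) : ℝ) = ((e₃ + k * 2 : ℤ) : ℝ) := by push_cast; linarith
  have h1'' := Int.cast_injective h1'
  have h3'' := Int.cast_injective h3'
  unfold DidiType at ht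
  omega

/-- Elements of the group change `z` by a sign and an even integer, so heights `0` and `1` are never
equivalent. -/
lemma didiLineX_ne_didiLineY (x y : ℝ) : didiLineX y ≠ didiLineY x := by
  intro h
  obtain ⟨g, hg, t, hgt⟩ := exists_of_lineTrace_eq h
  obtain ⟨i, j, k, e₁, e₂, e₃, ht, hd⟩ := exists_didiType_didi hg
  obtain ⟨-, -, h3⟩ := hd !₂[0, y, 0]
  rw [hgt] at h3
  simp at h3
  have h3' : ((1 : ℤ) : ℝ) = ((k * 2 : ℤ) : ℝ) := by push_cast; linarith
  have h3'' := Int.cast_injective h3'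
  omega

theorem geodesicMultiplicity_didi : geodesicMultiplicity didi 1 = 4 := by
  rw [geodesicMultiplicity, closedGeodesics_didi, Set.encard_insert_of_notMem,
    Set.encard_insert_of_notMem, Set.encard_pair didiLineY_ne]
  · norm_num
  · simp [didiLineX_ne_didiLineY]
  · simp only [Set.mem_insert_iff, Set.mem_singleton_iff, didiLineX_ne_didiLineY, or_false]
    exact didiLineX_ne

theorem isLeast_geodesicLengths_didi : IsLeast (geodesicLengths didi) 1 := by
  constructor
  · have h : didiLineY 0 ∈ closedGeodesics didi 1 := by
      rw [closedGeodesics_didi]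
      simp
    obtain ⟨c, hc, -⟩ := h
    exact ⟨c, hc⟩
  · intro ℓ hℓ
    obtain ⟨h, p, v, hpv⟩ := (mem_geodesicLengths_iff_isAxis isFlatManifoldGroup_didi).1 hℓ
    exact one_le_of_isAxis_didi h hpv

end Didi

/-! ### The two shortest closed geodesics of Tetra -/

section Tetra

/-- The space group of Tetra. -/
abbrev tetra : Subgroup (Isom 3) := tetracosm 1 (2 ^ 2)

lemma isFlatManifoldGroup_tetra : IsFlatManifoldGroup tetra :=
  isFlatManifoldGroup_tetracosm one_pos (by positivity)

lemma exists_tetraType_tetra {g : Isom 3} (hg : g ∈ tetra) :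
    ∃ i j k p q, TetraType k p q ∧ IsScrewMotion 2 1 i j k p q g := by
  have h := exists_tetraType hg
  rwa [Real.sqrt_one, sqrt_two_sq] at h

lemma translation_mem_tetra (i j : ℤ) : translation !₂[(i : ℝ) * 2, (j : ℝ) * 2, 0] ∈ tetra := by
  refine mem_translationLattice.1 ((hasBoxLattice_tetracosm 1 (2 ^ 2) _).2 ⟨![i, j, 0], fun s => ?_⟩)
  rw [sqrt_two_sq]
  fin_cases s <;> simp

/-- A line parallel to the screw axis on Tetra. -/
def tetraLine (x : ℝ) : Set (FlatQuot tetra) := lineTrace tetra !₂[x, x, 0] !₂[0, 0, 1]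

/-- The integers `i`, `j` are lattice shifts in the first alternative, but for quarter-turns they
are the coordinates of the axis. An axis of length `1` needs odd `k`, hence a quarter-turn. -/
lemma isAxis_tetra_cases {ℓ : ℝ} {x v : E 3} (h : IsAxis tetra ℓ x v) :
    ∃ i j k : ℤ, (k % 4 = 0 ∧ ℓ ^ 2 = (4 * i ^ 2 + 4 * j ^ 2 + k ^ 2 : ℤ)) ∨
      (ℓ ^ 2 = (k ^ 2 : ℤ) ∧ v 0 = 0 ∧ v 1 = 0 ∧ ℓ * v 2 = k ∧
        (k % 2 = 0 ∨ ((i - j) % 2 = 0 ∧ x 0 = i ∧ x 1 = j))) := by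
  obtain ⟨hv, g, hg, hgv, hgp⟩ := h
  rw [norm_eq_one_iff] at hv
  obtain ⟨i, j, k, p, q, ht, hd⟩ := exists_tetraType_tetra hg
  rw [hd.linearIsometryEquiv_apply] at hgv
  obtain ⟨h1, h2, h3⟩ := hd x
  have hv0 := congrArg (fun w : E 3 => w 0) hgv
  have hv1 := congrArg (fun w : E 3 => w 1) hgv
  rw [hgp] at h1 h2 h3
  simp at hv0 hv1 h1 h2 h3
  have key : v 0 = 0 → v 1 = 0 → ℓ ^ 2 = (k ^ 2 : ℤ) := by
    intro b1 b2
    rw [b1, b2] at hv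
    push_cast
    rw [← h3]
    linear_combination (-ℓ ^ 2) * hv
  rcases ht with ⟨hk, rfl, rfl⟩ | ⟨hk, rfl, rfl⟩ | ⟨hk, rfl, rfl⟩ | ⟨hk, rfl, rfl⟩ <;>
    push_cast at h1 h2 hv0 hv1
  · refine ⟨i, j, k, Or.inl ⟨hk, ?_⟩⟩
    have a1 : ℓ * v 0 = i * 2 := by linarith
    have a2 : ℓ * v 1 = j * 2 := by linarith
    push_cast
    rw [← h3]
    linear_combination (-ℓ ^ 2) * hv + (ℓ * v 0 + i * 2) * a1 + (ℓ * v 1 + j * 2) * a2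
  · have b1 : v 0 = 0 := by linarith
    have b2 : v 1 = 0 := by linarith
    rw [b1] at h1
    rw [b2] at h2
    -- Solution of `x = -y + 2i`, `y = x + 2j`, the fixed-axis equations of the quarter-turn; the
    -- two coordinates have equal parity.
    refine ⟨i - j, i + j, k, Or.inr ⟨key b1 b2, b1, b2, h3, Or.inr ⟨by omega, ?_, ?_⟩⟩⟩ <;>
      push_cast <;> linarith
  · have b1 : v 0 = 0 := by linarith
    have b2 : v 1 = 0 := by linarith
    exact ⟨i, j, k, Or.inr ⟨key b1 b2, b1, b2, h3, Or.inl (by omega)⟩⟩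
  · have b1 : v 0 = 0 := by linarith
    have b2 : v 1 = 0 := by linarith
    rw [b1] at h1
    rw [b2] at h2
    refine ⟨i + j, j - i, k, Or.inr ⟨key b1 b2, b1, b2, h3, Or.inr ⟨by omega, ?_, ?_⟩⟩⟩ <;>
      push_cast <;> linarith

lemma one_le_of_isAxis_tetra {ℓ : ℝ} (hℓ : 0 < ℓ) {p v : E 3} (h : IsAxis tetra ℓ p v) :
    1 ≤ ℓ := by
  obtain ⟨i, j, k, ⟨-, h⟩ | ⟨h, -⟩⟩ := isAxis_tetra_cases h
  all_goals exact one_le_of_sq_eq_int hℓ h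

lemma lineTrace_tetra_eq (i j : ℤ) {x v : E 3} {y : ℝ} (hx0 : x 0 + i * 2 = y)
    (hx1 : x 1 + j * 2 = y) (hv0 : v 0 = 0) (hv1 : v 1 = 0) (hv2 : v 2 * v 2 = 1) :
    lineTrace tetra x v = tetraLine y := by
  refine lineTrace_eq (translation_mem_tetra i j) (s := x 2) hv2 ?_ ?_
  · ext t
    fin_cases t <;> simp <;> linarith
  · rw [linearIsometryEquiv_translation]
    ext t
    fin_cases t <;> simp [hv0, hv1]

lemma lineTrace_tetra_of_isAxis {x v : E 3} (h : IsAxis tetra 1 x v) :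
    lineTrace tetra x v ∈ ({tetraLine 0, tetraLine 1} : Set _) := by
  obtain ⟨i, j, k, ⟨hk, h⟩ | ⟨h, hv0, hv1, hv2, hk⟩⟩ := isAxis_tetra_cases h
  · have h : 4 * i ^ 2 + 4 * j ^ 2 + k ^ 2 = 1 := by
      rw [one_pow] at h
      exact_mod_cast h.symm
    obtain ⟨k, rfl⟩ := Int.dvd_of_emod_eq_zero hk
    ring_nf at h
    omega
  · have hε : v 2 * v 2 = 1 := by
      push_cast at h
      rw [← hv2] at h
      linarith
    have h : k ^ 2 = 1 := by
      rw [one_pow] at h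
      exact_mod_cast h.symm
    rcases hk with hk | ⟨hij, hx0, hx1⟩
    · obtain ⟨k, rfl⟩ := Int.dvd_of_emod_eq_zero hk
      ring_nf at h
      omega
    -- Both coordinates have the parity of `i`, so modulo the lattice of side `2` the axis passes
    -- through `(0, 0)` or `(1, 1)`.
    · obtain hi | hi : i % 2 = 0 ∨ i % 2 = 1 := by omega
      all_goals
        obtain ⟨m, hm⟩ : ∃ m, i = 2 * m + i % 2 := ⟨i / 2, by omega⟩
        obtain ⟨r, hr⟩ : ∃ r, j = 2 * r + i % 2 := ⟨j / 2, by omega⟩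
        rw [hi] at hm hr
        rw [hm] at hx0
        rw [hr] at hx1
        push_cast at hx0 hx1
      · left
        exact lineTrace_tetra_eq (-m) (-r) (by push_cast; linarith) (by push_cast; linarith)
          hv0 hv1 hε
      · right
        exact lineTrace_tetra_eq (-m) (-r) (by push_cast; linarith) (by push_cast; linarith)
          hv0 hv1 hε

/-- The screw motion followed by the translation by `2i` along `x` sends `(i, i)` to `(-i + 2i, i)`
in the horizontal plane, and raises it by `1`. -/
lemma isAxis_tetraLine (i : ℤ) : IsAxis tetra 1 !₂[(i : ℝ), (i : ℝ), 0] !₂[0, 0, 1] := by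
  refine ⟨(norm_eq_one_iff _).2 (by simp), _,
    mul_mem (translation_mem_tetra i 0) (tetraScrew_mem 1 (2 ^ 2)), ?_, ?_⟩
  · rw [linearIsometryEquiv_mul, linearIsometryEquiv_translation, one_mul,
      linearIsometryEquiv_tetraScrew, quarterTurnZ_apply]
    simp
  · rw [AffineIsometryEquiv.coe_mul, Function.comp_apply, translation_apply, tetraScrew_apply]
    ext t
    fin_cases t <;> simp
    ring

theorem closedGeodesics_tetra : closedGeodesics tetra 1 = {tetraLine 0, tetraLine 1} := by
  ext S
  rw [mem_closedGeodesics_iff isFlatManifoldGroup_tetra]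
  constructor
  · rintro ⟨-, x, v, h, rfl⟩
    exact lineTrace_tetra_of_isAxis h
  · rintro (rfl | rfl)
    · exact ⟨one_pos, _, _, by simpa using isAxis_tetraLine 0, rfl⟩
    · exact ⟨one_pos, _, _, by simpa using isAxis_tetraLine 1, rfl⟩

/-- The orbit of the origin has only even first coordinates. -/
lemma tetraLine_ne : tetraLine 0 ≠ tetraLine 1 := by
  intro h
  obtain ⟨g, hg, t, hgt⟩ := exists_of_lineTrace_eq h
  obtain ⟨i, j, k, p, q, -, hd⟩ := exists_tetraType_tetra hg
  obtain ⟨h1, -, -⟩ := hd !₂[0, 0, 0]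
  rw [hgt] at h1
  simp at h1
  have h1' : ((1 : ℤ) : ℝ) = ((i * 2 : ℤ) : ℝ) := by push_cast; linarith
  have h1'' := Int.cast_injective h1'
  omega

theorem geodesicMultiplicity_tetra : geodesicMultiplicity tetra 1 = 2 := by
  rw [geodesicMultiplicity, closedGeodesics_tetra, Set.encard_pair tetraLine_ne]

theorem isLeast_geodesicLengths_tetra : IsLeast (geodesicLengths tetra) 1 := by
  constructor
  · have h : tetraLine 0 ∈ closedGeodesics tetra 1 := by
      rw [closedGeodesics_tetra]
      simp
    obtain ⟨c, hc, -⟩ := h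
    exact ⟨c, hc⟩
  · intro ℓ hℓ
    obtain ⟨h, p, v, hpv⟩ := (mem_geodesicLengths_iff_isAxis isFlatManifoldGroup_tetra).1 hℓ
    exact one_le_of_isAxis_tetra h hpv

end Tetra

end FlatManifold

end

theorem mainTheorem2 :
    -- Didi is isospectral to Tetra
    (FlatManifold.IsFlatManifoldGroup (FlatManifold.didicosm (1 ^ 2) (1 ^ 2) (2 ^ 2)) ∧
      FlatManifold.IsFlatManifoldGroup (FlatManifold.tetracosm (1 ^ 2) (2 ^ 2)) ∧
      FlatManifold.Isospectral (FlatManifold.didicosm (1 ^ 2) (1 ^ 2) (2 ^ 2))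
        (FlatManifold.tetracosm (1 ^ 2) (2 ^ 2))) ∧
    -- the form with a scale parameter
    (∀ D : ℝ, 0 < D →
      FlatManifold.IsFlatManifoldGroup (FlatManifold.didicosm D (4 * D) D) ∧
      FlatManifold.IsFlatManifoldGroup (FlatManifold.tetracosm D (4 * D)) ∧
      FlatManifold.Isospectral (FlatManifold.didicosm D (4 * D) D)
        (FlatManifold.tetracosm D (4 * D))) ∧
    -- the set of lengths of closed geodesics can be heard
    (∀ (n : ℕ) (Γ Γ' : Subgroup (FlatManifold.Isom n)),
      FlatManifold.IsFlatManifoldGroup Γ → FlatManifold.IsFlatManifoldGroup Γ' →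
      FlatManifold.Isospectral Γ Γ' →
      FlatManifold.geodesicLengths Γ = FlatManifold.geodesicLengths Γ') ∧
    -- the multiplicities cannot: those of the shortest length differ for Didi and Tetra
    (IsLeast (FlatManifold.geodesicLengths (FlatManifold.didicosm (1 ^ 2) (1 ^ 2) (2 ^ 2))) 1 ∧
      FlatManifold.geodesicMultiplicity
        (FlatManifold.didicosm (1 ^ 2) (1 ^ 2) (2 ^ 2)) 1 = 4 ∧
      IsLeast (FlatManifold.geodesicLengths (FlatManifold.tetracosm (1 ^ 2) (2 ^ 2))) 1 ∧
      FlatManifold.geodesicMultiplicity (FlatManifold.tetracosm (1 ^ 2) (2 ^ 2)) 1 = 2) := by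
  simp only [one_pow]
  refine ⟨⟨FlatManifold.isFlatManifoldGroup_didi, FlatManifold.isFlatManifoldGroup_tetra,
    FlatManifold.isospectral_didi_tetra⟩, fun D hD => ⟨?_, ?_, ?_⟩, ?_,
    FlatManifold.isLeast_geodesicLengths_didi, FlatManifold.geodesicMultiplicity_didi,
    FlatManifold.isLeast_geodesicLengths_tetra, FlatManifold.geodesicMultiplicity_tetra⟩
  · exact FlatManifold.isFlatManifoldGroup_didicosm hD (by positivity) hD
  · exact FlatManifold.isFlatManifoldGroup_tetracosm hD (by positivity)
  · exact FlatManifold.isospectral_didicosm_tetracosm_scale hD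
  · exact fun n Γ Γ' hΓ hΓ' h => FlatManifold.geodesicLengths_eq_of_isospectral hΓ hΓ' h
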